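/- Let $(\mathcal X,\mathcal B_{\mathcal X})$ and $(\mathcal Y_1,\mathcal B_1),\dots,(\mathcal Y_M,\mathcal B_M)$ be measurable spaces with countably generated $\sigma$-algebras, let $\mathcal Y=\mathcal Y_1\times\dots\times\mathcal Y_M$, and let $\{(X^t,Y^t)\}_{t\ge 0}$, $Y^t=(Y^t_1,\dots,Y^t_M)$, be a time-homogeneous Markov chain on $\mathcal X\times\mathcal Y$ (with the product $\sigma$-algebra). A set $D$ of states of a Markov chain $\{Z^t\}$ is called *positive recurrent* if $\tau(D)=\min\{t\ge 1: Z^t\in D\}$ satisfies $\tau(D)<\infty$ $\mathbf P_z$-a.s. for every initial state $z$ and $\sup_{z\in D}\mathbf E_z\tau(D)<\infty$. Assume condition A: - (A0) $\{X^t\}$ is itself a Markov chain with autonomous dynamics: $\mathbf P_{x,y}(X^1\in\cdot)=\mathbf P_x(X^1\in\cdot)$ for all $x,y$; - (A1) $\{X^t\}$ is aperiodic; - (A2) some set $V\in\mathcal B_{\mathcal X}$ is positive recurrent for $\{X^t\}$; - (A3) there exist $0<p\le 1$, a probability measure $\mu$ and an integer $m\ge 1$ such that $\mathbf P_x(X^m\in\cdot)\ge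 p\,\mu(\cdot)$ for all $x\in V$. Let $\pi$ be the stationary distribution of $\{X^t\}$ (which exists and is unique under A). For each $i$ let $L_{2,i}:\mathcal Y_i\to[0,\infty)$ be measurable, and assume - ($\widetilde{B}1$) there is $U<\infty$ with $\sup_{x,y}\mathbf E_{x,y}|L_{2,i}(Y^1_i)-L_{2,i}(y_i)|\le U$ for all $i$, and, in addition, either both $\widetilde B2$ and $\widetilde B3$, or $\widehat B$: - ($\widetilde{B}2$) for each $i$ there are a non-negative non-increasing function $h_i$ on $[0,\infty)$ with $h_i(N)\downarrow 0$ as $N\to\infty$ and a bounded measurable $f_i:\mathcal X\to\mathbb R$ with $\int f_i\,d\pi<0$ such that $\mathbf E_{x,y}\bigl(L_{2,i}(Y^1_i)-L_{2,i}(y_i)\bigr)\le f_i(x)+h_i(L_{2,i}(y_i))$ for all $x\in\mathcal X$, $y\in\mathcal Y$; - ($\widetilde{B}3$) for each $i$, $$\sup_{t\ge N}\ \sup_{y\in\mathcal Y,\,x\in V}\frac{\mathbf E_{x,y}\bigl(L_{2,i}(Y^t_i)-L_{2,i}(y_i)\bigr)}{t}\to 0\quad\text{as }N\to\infty;$$ -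 ($\widehat{B}$) for each $i$ there are a non-negative non-increasing function $h_i$ on $[0,\infty)$ with $h_i(N)\downarrow0$ and distribution functions $F_{x,i}$, $x\in\mathcal X$, with $x\mapsto F_{x,i}(s)$ measurable for each $s$, such that for every initial state $(x_0,y_0)$ the chain started there can be realized on a probability space carrying mutually independent random variables $\{\varphi^t_{x,i}\}_{x\in\mathcal X,\,t\ge 0}$ for which: (i) for each $t$ the family $\{\varphi^t_{x,i}\}_{x\in\mathcal X}$ is uniformly integrable; (ii) $\varphi^t_{x,i}$ has distribution function $F_{x,i}$ for all $x,t$; (iii) $L_{2,i}(Y^{t+1}_i)-L_{2,i}(Y^t_i)\le\varphi^t_{X^t,i}+h_i(L_{2,i}(Y^t_i))$ a.s. for all $t\ge 0$; (iv) $f_i(x)=\mathbf E\varphi^1_{x,i}$ satisfies $\int f_i\,d\pi<0$. Then for every real $N_0$ there exists $N_1\ge N_0$ such that the set $$D=V\times\Bigl\{y\in\mathcal Y:\ \sum_{i=1}^M L_{2,i}(y_i)\le N_1\Bigr\}$$ is positive recurrent for the Markov chain $\{(X^t,Y^t)\}$. -/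

import Mathlib

open MeasureTheory ProbabilityTheory Filter Topology
open scoped ENNReal NNReal

universe u v w

namespace MarkovStability

noncomputable section

/-! ### Markov chains on a general state space -/

/-- The law `𝐏_z` on path space of the time-homogeneous Markov chain with transition kernel `κ`
started at `z` (as a kernel in `z`); the chain itself is the coordinate process `w 0, w 1, …`. -/
def pathLaw {S : Type u} [MeasurableSpace S] (κ : Kernel S S) [IsMarkovKernel κ] :
    Kernel S (ℕ → S) :=
  (Kernel.traj (X := fun _ : ℕ => S)
    (fun n => κ.comap (fun h : (Π _ : Finset.Iic n, S) => h ⟨n, Finset.mem_Iic.2 le_rfl⟩)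
      (measurable_pi_apply _)) 0).comap (fun z _ => z) (measurable_pi_lambda _ fun _ => measurable_id)

/-- `τ(D) = min {t ≥ 1 : w t ∈ D}`, equal to `∞` if there is no such `t`. -/
def returnTime {S : Type u} (D : Set S) (w : ℕ → S) : ℝ≥0∞ :=
  ⨅ (t : ℕ) (_ : 1 ≤ t ∧ w t ∈ D), (t : ℝ≥0∞)

/-- `D` is positive recurrent: `τ(D) < ∞` almost surely from every initial state, and
`sup_{z ∈ D} 𝐄_z τ(D) < ∞`. -/
def PositiveRecurrent {S : Type u} [MeasurableSpace S] (κ : Kernel S S) [IsMarkovKernel κ]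
    (D : Set S) : Prop :=
  (∀ z, ∀ᵐ w ∂(pathLaw κ z), returnTime D w < ∞) ∧
    (⨆ z ∈ D, ∫⁻ w, returnTime D w ∂(pathLaw κ z)) < ∞

/-- Aperiodicity: there is no `d`-cycle with `d ≥ 2`, i.e. no pairwise disjoint nonempty measurable
sets `E 0, …, E (d - 1)` such that the chain moves from `E k` to `E (k + 1 mod d)` with
probability one. (The union of a cycle is absorbing, hence automatically of full measure for the
irreducibility measure when the chain is irreducible.) -/
def Aperiodic {S : Type u} [MeasurableSpace S] (κ : Kernel S S) : Prop :=
  ¬ ∃ d : ℕ, 2 ≤ d ∧ ∃ E : ZMod d → Set S,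
    (∀ k, MeasurableSet (E k)) ∧ (∀ k, (E k).Nonempty) ∧
    Pairwise (fun j k => Disjoint (E j) (E k)) ∧ ∀ k, ∀ z ∈ E k, κ z (E (k + 1)) = 1

/-- `V` admits a minorant probability measure: for some `0 < p ≤ 1`, some probability measure `μ`
and some `m ≥ 1`, `𝐏_z (Z^m ∈ ·) ≥ p μ(·)` for all `z ∈ V`. -/
def AdmitsMinorant {S : Type u} [MeasurableSpace S] (κ : Kernel S S) [IsMarkovKernel κ]
    (V : Set S) : Prop :=
  ∃ (p : ℝ) (μ : Measure S) (m : ℕ), 0 < p ∧ p ≤ 1 ∧ IsProbabilityMeasure μ ∧ 1 ≤ m ∧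
    ∀ z ∈ V, ∀ B, MeasurableSet B → ENNReal.ofReal p * μ B ≤ pathLaw κ z {w | w m ∈ B}

/-- `∫ f dπ < 0` for the stationary distribution `π` of the chain. (Existence of the stationary
distribution is not part of this condition.) -/
def NegativeStationaryMean {S : Type u} [MeasurableSpace S] (κ : Kernel S S) (f : S → ℝ) : Prop :=
  ∀ π : Measure S, IsProbabilityMeasure π → κ.Invariant π → ∫ x, f x ∂π < 0

/-- A non-negative, non-increasing function on `[0, ∞)` with limit `0` at infinity. -/
def DecreasesToZero (h : ℝ → ℝ) : Prop :=
  (∀ s, 0 ≤ s → 0 ≤ h s) ∧ AntitoneOn h (Set.Ici 0) ∧ Tendsto h atTop (𝓝 0)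

/-! ### Two-component chains -/

/-- The first component has autonomous dynamics, with transition kernel `κX`. -/
def Autonomous {X : Type u} {Y : Type v} [MeasurableSpace X] [MeasurableSpace Y]
    (κ : Kernel (X × Y) (X × Y)) (κX : Kernel X X) : Prop :=
  ∀ x y, ∀ B, MeasurableSet B → κ (x, y) {z | z.1 ∈ B} = κX x B

section Multi

variable {M : ℕ} {X : Type u} {Y : Fin M → Type v} [MeasurableSpace X]
  [∀ i, MeasurableSpace (Y i)]

/-- Condition `B̃1`: the mean absolute one-step increments of all `L i (Y_i^t)` are bounded by a
finite constant. -/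
def ConditionB1 (κ : Kernel (X × (Π i, Y i)) (X × (Π i, Y i))) (L : Π i, Y i → ℝ) : Prop :=
  ∃ U : ℝ≥0, ∀ i,
    (⨆ (x : X) (y : Π i, Y i), ∫⁻ z, ENNReal.ofReal |L i (z.2 i) - L i (y i)| ∂(κ (x, y))) ≤ U

/-- Condition `B̃2`: the mean one-step drift of `L i (Y_i^t)` is at most `f (x) + h (L i (y_i))`,
with `f` bounded, measurable and of negative stationary mean, and with `h ↓ 0`. -/
def ConditionB2 (κ : Kernel (X × (Π i, Y i)) (X × (Π i, Y i))) (κX : Kernel X X)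
    (L : Π i, Y i → ℝ) : Prop :=
  ∀ i, ∃ (h : ℝ → ℝ) (f : X → ℝ), DecreasesToZero h ∧ Measurable f ∧ (∃ K, ∀ x, |f x| ≤ K) ∧
    NegativeStationaryMean κX f ∧
    ∀ (x : X) (y : Π i, Y i),
      ∫ z, (L i (z.2 i) - L i (y i)) ∂(κ (x, y)) ≤ f x + h (L i (y i))

/-- Condition `B̃3`: the mean `t`-step drift of each `L i (Y_i^t)` grows sublinearly in `t`,
uniformly in the initial states `x ∈ V` and `y`. -/
def ConditionB3 (κ : Kernel (X × (Π i, Y i)) (X × (Π i, Y i))) [IsMarkovKernel κ] (V : Set X)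
    (L : Π i, Y i → ℝ) : Prop :=
  ∀ i, Tendsto (fun N : ℕ => ⨆ (t : ℕ) (_ : N ≤ t) (y : Π i, Y i) (x : X) (_ : x ∈ V),
      (((∫ w, (L i ((w t).2 i) - L i (y i)) ∂(pathLaw κ (x, y))) / (t : ℝ) : ℝ) : EReal))
    atTop (𝓝 0)

end Multi

/-- Condition `B̂`. For each `i` there are a function `h ↓ 0`, distribution functions `F x`
depending measurably on `x`, with means `f x` of negative stationary mean, such that for every
initial state `z` the chain `Z = (X^t, Y^t)` started at `z` can be realized on a probability space
which carries mutually independent random variables `φ x t` (`x ∈ X`, `t = 0, 1, …`), uniformly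
integrable over `x` for each `t`, with `φ x t` distributed according to `F x`, and with
`L i (Y_i^{t+1}) - L i (Y_i^t) ≤ φ (X^t) t + h (L i (Y_i^t))` almost surely for every `t`. -/
def ConditionBHat.{w₁, w₂, w₃} {M : ℕ} {X : Type w₁} {Y : Fin M → Type w₂} [MeasurableSpace X]
    [∀ i, MeasurableSpace (Y i)]
    (κ : Kernel (X × (Π i, Y i)) (X × (Π i, Y i))) [IsMarkovKernel κ] (κX : Kernel X X)
    (L : Π i, Y i → ℝ) : Prop :=
  ∀ i, ∃ (h : ℝ → ℝ) (F : X → ℝ → ℝ) (f : X → ℝ), DecreasesToZero h ∧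
    (∀ s, Measurable fun x => F x s) ∧ NegativeStationaryMean κX f ∧
    ∀ z : X × (Π i, Y i),
      ∃ (Ω : Type w₃) (_ : MeasurableSpace Ω) (P : Measure Ω) (Z : ℕ → Ω → X × (Π i, Y i))
        (φ : X → ℕ → Ω → ℝ),
        IsProbabilityMeasure P ∧
        (∀ᵐ ω ∂P, Z 0 ω = z) ∧ HasLaw (fun ω t => Z t ω) (pathLaw κ z) P ∧
        (∀ x t, Measurable (φ x t)) ∧
        iIndepFun (fun a : X × ℕ => φ a.1 a.2) P ∧
        (∀ t, UniformIntegrable (fun x => φ x t) 1 P) ∧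
        (∀ x t s, P.real {ω | φ x t ω ≤ s} = F x s) ∧
        (∀ t, ∀ᵐ ω ∂P, L i ((Z (t + 1) ω).2 i) - L i ((Z t ω).2 i)
          ≤ φ (Z t ω).1 t ω + h (L i ((Z t ω).2 i))) ∧
        ∀ x, f x = ∫ ω, φ x 1 ω ∂P

end

end MarkovStability

open MarkovStability

/-! The proof is a Foster–Lyapunov argument with state-dependent times. The Lyapunov function is `Λ
(x, y) = ∑ L i (y i) + c₀ * meanHitting x`, whose second part measures the expected time for `X` to
hit `V` and vanishes on `V`. Off `V` one step suffices: the mean hitting time drops by one, and `c₀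
= M U + 1` pays for the mean growth of the sum. On `V`, when the sum exceeds `N₁`, one looks `T`
steps ahead. Some coordinate is so large that its `h i` is negligible over `T` steps, and its mean
falls linearly in `T` because `f i` has negative stationary mean. The other coordinates grow by
`o(T)`, and the mean time still needed to come back to `V` is `o(T)` as well. Fixing `T` large and
then `N₁` large gives the drift (`meanReturn_le_of_drift`, `exists_positiveRecurrent`).

Two ergodic facts about `X`, uniform over initial states in `V`, carry this: additive functionals of
a bounded `f` with negative mean decrease linearly (`exists_invariant_sum_le`), and the mean
residual hitting time is sublinear (`lintegral_meanHitting_sublinear`). Both come from the chain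
watched at its visits to `V`, with kernel `E = entranceKernel`. The inequality `P E ≤ E + E²`
transfers the minorization of `P^m` to a power of the lazy kernel `Θ = (1 + E) / 2`, which then
satisfies Doeblin's condition (`exists_minorant_lazy_entrance`). Hence `E` has an invariant law `ρ`,
and every bounded `F` of negative `ρ`-mean admits a bounded `g` with `E g + F ≤ g`
(`exists_potential`). Extending `g` off `V` by its mean at the next entrance (`harmonicExtension`)
yields a drift inequality for `P` itself.

The sublinear growth of the coordinates is what `B̃3` provides. Under `B̂` it is proved with a
second Lyapunov function, `huber K l + ramp K l * u`: the small slope at low levels suppresses `h`,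
uniform integrability controls the curvature of `huber K`, and the corrector `u` replaces `f` by a
function of small long-run average (`exists_corrector`, `integral_sub_le_of_dominated`). -/

namespace MarkovStability

/-! ### Path space and taboo kernels -/

section Path

variable {S : Type u} [MeasurableSpace S]

/-- The taboo kernel: one step of the chain, killed on entering `D`. -/
noncomputable def tabooKernel (κ : Kernel S S) {D : Set S} (hD : MeasurableSet D) : Kernel S S :=
  κ.restrict hD.compl

/-- The Green kernel `∑ₙ Kⁿ` of the chain killed on entering `D`: its value at `z` is the
expected occupation measure up to the time `τ(D) - 1` of the chain started at `z`. -/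
noncomputable def greenKernel (κ : Kernel S S) {D : Set S} (hD : MeasurableSet D) : Kernel S S :=
  Kernel.sum fun n : ℕ => tabooKernel κ hD ^ n

/-- The expected return time `𝐄_z τ(D)`. -/
noncomputable def meanReturn (κ : Kernel S S) {D : Set S} (hD : MeasurableSet D) (z : S) : ℝ≥0∞ :=
  greenKernel κ hD z Set.univ

lemma lintegral_pow_zero (κ : Kernel S S) {φ : S → ℝ≥0∞} (hφ : Measurable φ) (z : S) :
    ∫⁻ y, φ y ∂((κ ^ 0) z) = φ z := by
  rw [pow_zero]
  change ∫⁻ y, φ y ∂(Kernel.id z) = φ z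
  exact lintegral_dirac' z hφ

lemma lintegral_pow_succ (κ : Kernel S S) {φ : S → ℝ≥0∞} (hφ : Measurable φ) (n : ℕ) (z : S) :
    ∫⁻ y, φ y ∂((κ ^ (n + 1)) z) = ∫⁻ x, ∫⁻ y, φ y ∂(κ x) ∂((κ ^ n) z) := by
  rw [pow_succ']
  exact Kernel.lintegral_comp _ _ _ hφ

lemma lintegral_pow_succ' (κ : Kernel S S) {φ : S → ℝ≥0∞} (hφ : Measurable φ) (n : ℕ) (z : S) :
    ∫⁻ y, φ y ∂((κ ^ (n + 1)) z) = ∫⁻ x, ∫⁻ y, φ y ∂((κ ^ n) x) ∂(κ z) := by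
  rw [pow_succ]
  exact Kernel.lintegral_comp _ _ _ hφ

instance isMarkovKernel_pow (κ : Kernel S S) [IsMarkovKernel κ] (n : ℕ) :
    IsMarkovKernel (κ ^ n) := by
  induction n with
  | zero => rw [pow_zero]; exact inferInstanceAs (IsMarkovKernel Kernel.id)
  | succ n ih => rw [pow_succ]; exact inferInstanceAs (IsMarkovKernel ((κ ^ n) ∘ₖ κ))

instance isMarkovKernel_pathLaw (κ : Kernel S S) [IsMarkovKernel κ] :
    IsMarkovKernel (pathLaw κ) := by
  unfold pathLaw; infer_instance

/-- The one-step Markov property of the path law. -/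
lemma lintegral_pathLaw_succ (κ : Kernel S S) [IsMarkovKernel κ] (z : S) (n : ℕ)
    {Φ : (Π _ : Finset.Iic n, S) → ℝ≥0∞} (hΦ : Measurable Φ) {φ : S → ℝ≥0∞} (hφ : Measurable φ) :
    ∫⁻ w, Φ (fun i => w i) * φ (w (n + 1)) ∂(pathLaw κ z) =
      ∫⁻ w, Φ (fun i => w i) * ∫⁻ y, φ y ∂(κ (w n)) ∂(pathLaw κ z) := by
  set K : (k : ℕ) → Kernel (Π _ : Finset.Iic k, S) S := fun n =>
    κ.comap (fun h : (Π _ : Finset.Iic n, S) => h ⟨n, Finset.mem_Iic.2 le_rfl⟩)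
      (measurable_pi_apply _) with hK
  have hpl : pathLaw κ z = Kernel.traj (X := fun _ : ℕ => S) K 0 (fun _ => z) := rfl
  have hψ : Measurable fun x => ∫⁻ y, φ y ∂(κ x) := hφ.lintegral_kernel
  have hΦ' : Measurable fun w : ℕ → S => Φ (fun i => w i) :=
    hΦ.comp (measurable_pi_lambda _ fun i => measurable_pi_apply _)
  -- Conditioning on the path up to time `n`. The continuation is rewritten so that its past is
  -- literally `u`, which makes `Φ` constant in the inner integral.
  have key : ∀ (F : (Π _ : Finset.Iic n, S) → (ℕ → S) → ℝ≥0∞),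
      Measurable (fun w : ℕ → S => F (fun i => w i) w) →
      ∫⁻ w, F (fun i => w i) w ∂(pathLaw κ z) =
        ∫⁻ u, ∫⁻ w, F u (Function.updateFinset w (Finset.Iic n) u)
          ∂(Kernel.traj (X := fun _ : ℕ => S) K n u)
          ∂(Kernel.partialTraj (X := fun _ : ℕ => S) K 0 n (fun _ => z)) := by
    intro F hF
    rw [hpl, ← Kernel.traj_comp_partialTraj (X := fun _ : ℕ => S) (κ := K) (Nat.zero_le n),
      Kernel.lintegral_comp _ _ _ hF]
    refine lintegral_congr fun u => ?_
    rw [Kernel.lintegral_traj (X := fun _ : ℕ => S) (κ := K) u hF]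
    refine lintegral_congr fun w => ?_
    congr 1
    funext i
    simp [Function.updateFinset, i.2]
  rw [key (fun u w => Φ u * φ (w (n + 1))) (hΦ'.mul (hφ.comp (measurable_pi_apply _))),
    key (fun u w => Φ u * ∫⁻ y, φ y ∂(κ (w n))) (hΦ'.mul (hψ.comp (measurable_pi_apply _)))]
  refine lintegral_congr fun u => ?_
  have e1 : ∀ w : ℕ → S, Function.updateFinset w (Finset.Iic n) u (n + 1) = w (n + 1) := by
    intro w; simp [Function.updateFinset]
  have e2 : ∀ w : ℕ → S, Function.updateFinset w (Finset.Iic n) u n =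
      u ⟨n, Finset.mem_Iic.2 le_rfl⟩ := by
    intro w; simp [Function.updateFinset]
  simp only [e1, e2]
  have hφn : Measurable fun w : ℕ → S => φ (w (n + 1)) := hφ.comp (measurable_pi_apply _)
  rw [lintegral_const_mul _ hφn, lintegral_const, measure_univ, mul_one]
  congr 1
  have hm := Kernel.map_traj_succ_self (X := fun _ : ℕ => S) (κ := K) (a := n)
  calc ∫⁻ w, φ (w (n + 1)) ∂(Kernel.traj (X := fun _ : ℕ => S) K n u)
      = ∫⁻ y, φ y ∂((Kernel.traj (X := fun _ : ℕ => S) K n).map (fun x => x (n + 1)) u) := by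
        rw [Kernel.lintegral_map _ (measurable_pi_apply _) _ hφ]
    _ = ∫⁻ y, φ y ∂(K n u) := by rw [hm]
    _ = ∫⁻ y, φ y ∂(κ (u ⟨n, Finset.mem_Iic.2 le_rfl⟩)) := by
        rw [hK]; rfl

lemma pathLaw_zero (κ : Kernel S S) [IsMarkovKernel κ] (z : S) {φ : S → ℝ≥0∞}
    (hφ : Measurable φ) : ∫⁻ w, φ (w 0) ∂(pathLaw κ z) = φ z := by
  have h := Kernel.lintegral_traj (X := fun _ : ℕ => S)
    (κ := fun n => κ.comap (fun h : (Π _ : Finset.Iic n, S) => h ⟨n, Finset.mem_Iic.2 le_rfl⟩)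
      (measurable_pi_apply _)) (a := 0) (fun _ => z) (f := fun w => φ (w 0))
      (hφ.comp (measurable_pi_apply (X := fun _ : ℕ => S) 0))
  change ∫⁻ w, φ (w 0) ∂(Kernel.traj (X := fun _ : ℕ => S) _ 0 (fun _ => z)) = φ z
  rw [h]
  simp [Function.updateFinset]

/-- The law at time `n` of the chain killed on entering `D`. -/
lemma lintegral_pathLaw_taboo (κ : Kernel S S) [IsMarkovKernel κ] {D : Set S}
    (hD : MeasurableSet D) (n : ℕ) (z : S) :
    ∀ {φ : S → ℝ≥0∞}, Measurable φ →
    ∫⁻ w, {w : ℕ → S | ∀ s, 1 ≤ s → s ≤ n → w s ∉ D}.indicator (fun w => φ (w n)) w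
      ∂(pathLaw κ z) = ∫⁻ y, φ y ∂((tabooKernel κ hD ^ n) z) := by
  induction n with
  | zero =>
    intro φ hφ
    rw [lintegral_pow_zero _ hφ, ← pathLaw_zero κ z hφ]
    refine lintegral_congr fun w => ?_
    rw [Set.indicator_of_mem]
    intro s h1 h0; omega
  | succ n ih =>
    intro φ hφ
    set Φ : (Π _ : Finset.Iic n, S) → ℝ≥0∞ :=
      {u | ∀ s : Finset.Iic n, 1 ≤ (s : ℕ) → u s ∉ D}.indicator 1 with hΦdef
    have hΦ : Measurable Φ := by
      refine measurable_one.indicator ?_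
      have : {u : Π _ : Finset.Iic n, S | ∀ s : Finset.Iic n, 1 ≤ (s : ℕ) → u s ∉ D} =
          ⋂ s : Finset.Iic n, {u | 1 ≤ (s : ℕ) → u s ∉ D} := by ext; simp
      rw [this]
      refine MeasurableSet.iInter fun s => ?_
      by_cases hs : 1 ≤ (s : ℕ)
      · have h1 : Measurable fun u : Π _ : Finset.Iic n, S => u s := measurable_pi_apply s
        have h2 : {u : Π _ : Finset.Iic n, S | 1 ≤ (s : ℕ) → u s ∉ D} = (fun u => u s) ⁻¹' Dᶜ := by
          ext; simp [hs]
        rw [h2]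
        exact h1 hD.compl
      · simp [hs]
    have hiff : ∀ w : ℕ → S, ((fun i : Finset.Iic n => w i) ∈
        {u : Π _ : Finset.Iic n, S | ∀ s : Finset.Iic n, 1 ≤ (s : ℕ) → u s ∉ D}) ↔
        ∀ s, 1 ≤ s → s ≤ n → w s ∉ D := by
      intro w
      constructor
      · intro h s h1 h2
        exact h ⟨s, Finset.mem_Iic.2 h2⟩ h1
      · intro h s h1
        exact h s h1 (Finset.mem_Iic.1 s.2)
    have hφ' : Measurable (Dᶜ.indicator φ) := hφ.indicator hD.compl
    rw [lintegral_pow_succ _ hφ, ← ih hφ.lintegral_kernel]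
    calc _ = ∫⁻ w, Φ (fun i => w i) * Dᶜ.indicator φ (w (n + 1)) ∂(pathLaw κ z) := by
          refine lintegral_congr fun w => ?_
          by_cases h1 : ∀ s, 1 ≤ s → s ≤ n → w s ∉ D
          · rw [hΦdef, Set.indicator_of_mem ((hiff w).2 h1)]
            by_cases h2 : w (n + 1) ∈ D
            · rw [Set.indicator_of_notMem, Set.indicator_of_notMem (by simpa using h2)]
              · simp
              · intro h; exact h (n + 1) (by omega) le_rfl h2
            · rw [Set.indicator_of_mem, Set.indicator_of_mem (by simpa using h2)]
              · simp
              · intro s hs1 hs2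
                rcases Nat.lt_or_ge n s with h | h
                · have : s = n + 1 := by omega
                  rwa [this]
                · exact h1 s hs1 h
          · rw [hΦdef, Set.indicator_of_notMem (fun h => h1 ((hiff w).1 h)), zero_mul,
              Set.indicator_of_notMem]
            intro h; exact h1 fun s hs1 hs2 => h s hs1 (by omega)
      _ = ∫⁻ w, Φ (fun i => w i) * ∫⁻ y, Dᶜ.indicator φ y ∂(κ (w n)) ∂(pathLaw κ z) :=
          lintegral_pathLaw_succ κ z n hΦ hφ'
      _ = _ := by
          refine lintegral_congr fun w => ?_
          have : ∀ x, ∫⁻ y, Dᶜ.indicator φ y ∂(κ x) = ∫⁻ y, φ y ∂(tabooKernel κ hD x) := by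
            intro x
            rw [lintegral_indicator hD.compl, tabooKernel, Kernel.lintegral_restrict]
          rw [this]
          by_cases h1 : ∀ s, 1 ≤ s → s ≤ n → w s ∉ D
          · rw [hΦdef, Set.indicator_of_mem ((hiff w).2 h1), Set.indicator_of_mem (by exact h1)]
            simp
          · rw [hΦdef, Set.indicator_of_notMem (fun h => h1 ((hiff w).1 h)), zero_mul,
              Set.indicator_of_notMem (by exact h1)]

/-- The law of the chain at time `n`. -/
lemma map_pathLaw (κ : Kernel S S) [IsMarkovKernel κ] (n : ℕ) (z : S) :
    (pathLaw κ z).map (fun w => w n) = (κ ^ n) z := by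
  have hm : Measurable fun w : ℕ → S => w n := measurable_pi_apply n
  ext B hB
  have h := lintegral_pathLaw_taboo κ (MeasurableSet.empty (α := S)) n z
    (measurable_one.indicator hB : Measurable (B.indicator 1))
  -- With nothing forbidden no mass is killed.
  have hk : tabooKernel κ (MeasurableSet.empty (α := S)) = κ := by
    unfold tabooKernel
    ext x s hs
    rw [Kernel.restrict_apply' _ _ _ hs]; simp
  rw [hk, lintegral_indicator_one hB] at h
  rw [← h, ← lintegral_indicator_one hB, lintegral_map (measurable_one.indicator hB) hm]
  refine lintegral_congr fun w => ?_
  refine (Set.indicator_of_mem ?_ (fun w : ℕ → S => B.indicator (1 : S → ℝ≥0∞) (w n))).symm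
  intro s _ _ h
  exact h

lemma measurableSet_avoid {D : Set S} (hD : MeasurableSet D) (n : ℕ) :
    MeasurableSet {w : ℕ → S | ∀ s, 1 ≤ s → s ≤ n → w s ∉ D} := by
  have : {w : ℕ → S | ∀ s, 1 ≤ s → s ≤ n → w s ∉ D} =
      ⋂ s : ℕ, ⋂ (_ : 1 ≤ s), ⋂ (_ : s ≤ n), {w | w s ∉ D} := by ext; simp
  rw [this]
  exact MeasurableSet.iInter fun s => MeasurableSet.iInter fun _ => MeasurableSet.iInter fun _ =>
    (measurable_pi_apply s : Measurable fun w : ℕ → S => w s) hD.compl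

lemma pathLaw_avoid (κ : Kernel S S) [IsMarkovKernel κ] {D : Set S}
    (hD : MeasurableSet D) (n : ℕ) (z : S) :
    pathLaw κ z {w | ∀ s, 1 ≤ s → s ≤ n → w s ∉ D} = (tabooKernel κ hD ^ n) z Set.univ := by
  have h := lintegral_pathLaw_taboo κ hD n z (measurable_one (α := ℝ≥0∞))
  have e : ∀ w : ℕ → S, {w : ℕ → S | ∀ s, 1 ≤ s → s ≤ n → w s ∉ D}.indicator
      (fun w => (1 : S → ℝ≥0∞) (w n)) w =
      {w : ℕ → S | ∀ s, 1 ≤ s → s ≤ n → w s ∉ D}.indicator 1 w := fun w => rfl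
  simp only [e] at h
  rw [lintegral_indicator_one (measurableSet_avoid hD n)] at h
  simpa using h

omit [MeasurableSpace S] in
-- Layer-cake formula `τ = ∑ₙ 1{τ > n}`. The term `n = 0` is always `1`, and both sides are infinite
-- on paths that never visit `D`.
lemma returnTime_eq_tsum (D : Set S) (w : ℕ → S) :
    returnTime D w =
      ∑' n : ℕ, {w : ℕ → S | ∀ s, 1 ≤ s → s ≤ n → w s ∉ D}.indicator (1 : (ℕ → S) → ℝ≥0∞) w := by
  classical
  by_cases h : ∃ t, 1 ≤ t ∧ w t ∈ D
  · set t := Nat.find h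
    have ht := Nat.find_spec h
    have hmin : ∀ s, 1 ≤ s → s < t → w s ∉ D := fun s hs hst hsD => Nat.find_min h hst ⟨hs, hsD⟩
    have h1 : returnTime D w = t := by
      apply le_antisymm
      · exact iInf₂_le t ht
      · refine le_iInf₂ fun s hs => ?_
        exact_mod_cast Nat.find_min' h hs
    have h2 : ∀ n : ℕ, {w : ℕ → S | ∀ s, 1 ≤ s → s ≤ n → w s ∉ D}.indicator
        (1 : (ℕ → S) → ℝ≥0∞) w = if n ∈ Finset.range t then 1 else 0 := by
      intro n
      by_cases hn : n < t
      · rw [if_pos (Finset.mem_range.2 hn), Set.indicator_of_mem]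
        · rfl
        · intro s hs hsn; exact hmin s hs (by omega)
      · rw [if_neg (by simpa using hn), Set.indicator_of_notMem]
        intro hw; exact hw t ht.1 (by omega) ht.2
    rw [h1, tsum_congr h2, tsum_eq_sum (s := Finset.range t)]
    · rw [Finset.sum_congr rfl fun n hn => if_pos hn]; simp
    · intro b hb; simp [hb]
  · push Not at h
    have h1 : returnTime D w = ⊤ := by
      refine top_unique (le_iInf₂ fun s hs => ?_)
      exact absurd hs.2 (h s hs.1)
    rw [h1]
    have h2 : ∀ n : ℕ, {w : ℕ → S | ∀ s, 1 ≤ s → s ≤ n → w s ∉ D}.indicator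
        (1 : (ℕ → S) → ℝ≥0∞) w = 1 := by
      intro n
      rw [Set.indicator_of_mem]
      · rfl
      · intro s hs _; exact h s hs
    rw [tsum_congr h2, ENNReal.tsum_const_eq_top_of_ne_zero one_ne_zero]

lemma lintegral_returnTime (κ : Kernel S S) [IsMarkovKernel κ] {D : Set S}
    (hD : MeasurableSet D) (z : S) :
    ∫⁻ w, returnTime D w ∂(pathLaw κ z) = meanReturn κ hD z := by
  simp_rw [returnTime_eq_tsum]
  rw [lintegral_tsum]
  · rw [meanReturn, greenKernel, Kernel.sum_apply' _ _ MeasurableSet.univ]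
    congr 1
    funext n
    rw [lintegral_indicator_one (measurableSet_avoid hD n), pathLaw_avoid κ hD]
  · intro n
    exact (measurable_one.indicator (measurableSet_avoid hD n)).aemeasurable

omit [MeasurableSpace S] in
lemma returnTime_lt_top_iff (D : Set S) (w : ℕ → S) :
    returnTime D w < ⊤ ↔ ∃ t, 1 ≤ t ∧ w t ∈ D := by
  simp only [returnTime, iInf_lt_iff]
  constructor
  · rintro ⟨t, ht, -⟩; exact ⟨t, ht⟩
  · rintro ⟨t, ht⟩; exact ⟨t, ht, ENNReal.natCast_lt_top t⟩

/-- Continuity from above: `{τ = ∞}` is the decreasing intersection of the events `{τ > n}`. -/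
lemma ae_returnTime_lt_top_iff (κ : Kernel S S) [IsMarkovKernel κ] {D : Set S}
    (hD : MeasurableSet D) (z : S) :
    (∀ᵐ w ∂(pathLaw κ z), returnTime D w < ⊤) ↔
      Tendsto (fun n => (tabooKernel κ hD ^ n) z Set.univ) atTop (𝓝 0) := by
  have hlim : Tendsto (fun n => (tabooKernel κ hD ^ n) z Set.univ) atTop
      (𝓝 (pathLaw κ z {w | ¬ returnTime D w < ⊤})) := by
    have hset : {w : ℕ → S | ¬ returnTime D w < ⊤} =
        ⋂ n : ℕ, {w | ∀ s, 1 ≤ s → s ≤ n → w s ∉ D} := by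
      ext w
      simp only [Set.mem_ofPred_eq, returnTime_lt_top_iff, Set.mem_iInter]
      push Not
      exact ⟨fun h n s hs _ => h s hs, fun h s hs => h s s hs le_rfl⟩
    rw [hset]
    simp_rw [← pathLaw_avoid κ hD]
    refine tendsto_measure_iInter_atTop
      (fun n => (measurableSet_avoid hD n).nullMeasurableSet) ?_ ⟨0, measure_ne_top _ _⟩
    intro a b hab w hw s hs hsa
    exact hw s hs (hsa.trans hab)
  rw [ae_iff]
  constructor
  · intro h; rwa [h] at hlim
  · intro h; exact tendsto_nhds_unique hlim h

/-- Removes path space from recurrence, so that the recurrence arguments below deal with kernels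
only. -/
lemma positiveRecurrent_iff (κ : Kernel S S) [IsMarkovKernel κ] {D : Set S}
    (hD : MeasurableSet D) :
    PositiveRecurrent κ D ↔
      (∀ z, Tendsto (fun n => (tabooKernel κ hD ^ n) z Set.univ) atTop (𝓝 0)) ∧
      (⨆ z ∈ D, meanReturn κ hD z) < ⊤ := by
  unfold PositiveRecurrent
  simp_rw [ae_returnTime_lt_top_iff κ hD, lintegral_returnTime κ hD]

end Path

end MarkovStability

namespace MarkovStability

/-! ### Green kernels, entrance kernels and Foster's criterion -/

section Green

variable {S : Type u} [MeasurableSpace S] (κ : Kernel S S) {D : Set S} (hD : MeasurableSet D)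

/-- The law of the chain at its first visit to `D` (after time `0`). -/
noncomputable def entranceKernel : Kernel S S := κ.restrict hD ∘ₖ greenKernel κ hD

lemma lintegral_taboo (φ : S → ℝ≥0∞) (x : S) :
    ∫⁻ y, φ y ∂(tabooKernel κ hD x) = ∫⁻ y in Dᶜ, φ y ∂(κ x) := by
  rw [tabooKernel, Kernel.lintegral_restrict]

lemma lintegral_taboo_le (φ : S → ℝ≥0∞) (x : S) :
    ∫⁻ y, φ y ∂(tabooKernel κ hD x) ≤ ∫⁻ y, φ y ∂(κ x) := by
  rw [lintegral_taboo]; exact setLIntegral_le_lintegral _ _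

lemma lintegral_add_taboo (φ : S → ℝ≥0∞) (x : S) :
    ∫⁻ y in D, φ y ∂(κ x) + ∫⁻ y, φ y ∂(tabooKernel κ hD x) = ∫⁻ y, φ y ∂(κ x) := by
  rw [lintegral_taboo, lintegral_add_compl _ hD]

lemma lintegral_green (φ : S → ℝ≥0∞) (x : S) :
    ∫⁻ y, φ y ∂(greenKernel κ hD x) = ∑' n : ℕ, ∫⁻ y, φ y ∂((tabooKernel κ hD ^ n) x) := by
  rw [greenKernel, Kernel.sum_apply, lintegral_sum_measure]

/-- `H φ = φ + K (H φ)`. -/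
lemma lintegral_green_eq {φ : S → ℝ≥0∞} (hφ : Measurable φ) (x : S) :
    ∫⁻ y, φ y ∂(greenKernel κ hD x) =
      φ x + ∫⁻ y, ∫⁻ y', φ y' ∂(greenKernel κ hD y) ∂(tabooKernel κ hD x) := by
  rw [lintegral_green, tsum_eq_zero_add' ENNReal.summable, lintegral_pow_zero _ hφ]
  congr 1
  simp_rw [lintegral_green]
  rw [lintegral_tsum fun n => hφ.lintegral_kernel.aemeasurable]
  exact tsum_congr fun n => lintegral_pow_succ' _ hφ n x

/-- `H φ = φ + H (K φ)`. -/
lemma lintegral_green_eq' {φ : S → ℝ≥0∞} (hφ : Measurable φ) (x : S) :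
    ∫⁻ y, φ y ∂(greenKernel κ hD x) =
      φ x + ∫⁻ y, ∫⁻ y', φ y' ∂(tabooKernel κ hD y) ∂(greenKernel κ hD x) := by
  rw [lintegral_green, tsum_eq_zero_add' ENNReal.summable, lintegral_pow_zero _ hφ,
    lintegral_green]
  congr 1
  exact tsum_congr fun n => lintegral_pow_succ _ hφ n x

lemma lintegral_entrance {φ : S → ℝ≥0∞} (hφ : Measurable φ) (x : S) :
    ∫⁻ y, φ y ∂(entranceKernel κ hD x) =
      ∫⁻ y, ∫⁻ y' in D, φ y' ∂(κ y) ∂(greenKernel κ hD x) := by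
  rw [entranceKernel, Kernel.lintegral_comp _ _ _ hφ]
  simp_rw [Kernel.lintegral_restrict]

lemma measurable_setLIntegral_kernel (κ : Kernel S S) (hD : MeasurableSet D) {φ : S → ℝ≥0∞}
    (hφ : Measurable φ) :
    Measurable fun x => ∫⁻ y in D, φ y ∂(κ x) := by
  simp_rw [← Kernel.lintegral_restrict κ hD]
  exact hφ.lintegral_kernel

/-- `E φ = P (1_D φ) + K (E φ)`. -/
lemma lintegral_entrance_eq {φ : S → ℝ≥0∞} (hφ : Measurable φ) (x : S) :
    ∫⁻ y, φ y ∂(entranceKernel κ hD x) = ∫⁻ y in D, φ y ∂(κ x) +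
      ∫⁻ y, ∫⁻ y', φ y' ∂(entranceKernel κ hD y) ∂(tabooKernel κ hD x) := by
  simp_rw [lintegral_entrance κ hD hφ]
  exact lintegral_green_eq κ hD (measurable_setLIntegral_kernel κ hD hφ) x

/-- `P (E φ) ≤ E φ + E (E φ)`. -/
lemma lintegral_comp_entrance_le {φ : S → ℝ≥0∞} (hφ : Measurable φ) (x : S) :
    ∫⁻ y, ∫⁻ y', φ y' ∂(entranceKernel κ hD y) ∂(κ x) ≤
      ∫⁻ y, φ y ∂(entranceKernel κ hD x) +
        ∫⁻ y, ∫⁻ y', φ y' ∂(entranceKernel κ hD y) ∂(entranceKernel κ hD x) := by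
  have hψ : Measurable fun y => ∫⁻ y', φ y' ∂(entranceKernel κ hD y) := hφ.lintegral_kernel
  -- If the first step avoids `D`, the entrance that follows is the entrance from `x`. If it lands
  -- in `D`, that point is itself the first entrance and a second one follows.
  rw [← lintegral_add_taboo κ hD, add_comm]
  gcongr ?_ + ?_
  · rw [lintegral_entrance_eq κ hD hφ x]; exact le_add_self
  · rw [lintegral_entrance_eq κ hD hψ x]; exact le_self_add

/-- `H (P φ) + φ = H φ + E φ`. -/
lemma lintegral_green_comp {φ : S → ℝ≥0∞} (hφ : Measurable φ) (x : S) :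
    ∫⁻ y, ∫⁻ y', φ y' ∂(κ y) ∂(greenKernel κ hD x) + φ x =
      ∫⁻ y, φ y ∂(greenKernel κ hD x) + ∫⁻ y, φ y ∂(entranceKernel κ hD x) := by
  rw [lintegral_entrance κ hD hφ, lintegral_green_eq' κ hD hφ]
  have h : ∫⁻ y, ∫⁻ y', φ y' ∂(κ y) ∂(greenKernel κ hD x) =
      ∫⁻ y, (∫⁻ y' in D, φ y' ∂(κ y) + ∫⁻ y', φ y' ∂(tabooKernel κ hD y))
        ∂(greenKernel κ hD x) := lintegral_congr fun y => (lintegral_add_taboo κ hD φ y).symm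
  rw [h, lintegral_add_left (measurable_setLIntegral_kernel κ hD hφ)]
  ring

/-- The last step before the entrance is integrated over `D` only, so a comparison on `D` is enough.
-/
lemma lintegral_entrance_le (κ : Kernel S S) (hD : MeasurableSet D) {φ ψ : S → ℝ≥0∞}
    (h : ∀ x ∈ D, φ x ≤ ψ x) (hφ : Measurable φ) (hψ : Measurable ψ) (x : S) :
    ∫⁻ y, φ y ∂(entranceKernel κ hD x) ≤ ∫⁻ y, ψ y ∂(entranceKernel κ hD x) := by
  rw [lintegral_entrance κ hD hφ, lintegral_entrance κ hD hψ]
  exact lintegral_mono fun y => setLIntegral_mono hψ h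

lemma entrance_compl (x : S) : entranceKernel κ hD x Dᶜ = 0 := by
  rw [← lintegral_indicator_one hD.compl]
  refine le_antisymm ((lintegral_entrance_le κ hD (ψ := 0) ?_ ?_ ?_ x).trans (by simp)) zero_le
  · intro y hy; simp [hy]
  · exact measurable_one.indicator hD.compl
  · exact measurable_zero

/-- Entering `D` within `N` steps and avoiding it for `N` steps are complementary; the avoidance
term disappears in the limit. -/
lemma entrance_univ [IsMarkovKernel κ] (x : S)
    (h : Tendsto (fun n => (tabooKernel κ hD ^ n) x Set.univ) atTop (𝓝 0)) :
    entranceKernel κ hD x Set.univ = 1 := by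
  have hm : Measurable fun x => κ x D := κ.measurable_coe hD
  have key : ∀ N : ℕ, ∑ n ∈ Finset.range N, ∫⁻ y, κ y D ∂((tabooKernel κ hD ^ n) x) +
      (tabooKernel κ hD ^ N) x Set.univ = 1 := by
    intro N
    induction N with
    | zero =>
      have := lintegral_pow_zero (tabooKernel κ hD) (measurable_one (α := ℝ≥0∞)) x
      simpa using this
    | succ N ih =>
      rw [Finset.sum_range_succ, ← ih, add_assoc]
      congr 1
      have e : ∀ ψ : Measure S, ψ Set.univ = ∫⁻ _, 1 ∂ψ := fun ψ => by simp
      rw [e, e, lintegral_pow_succ _ measurable_const, ← lintegral_add_left hm]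
      refine lintegral_congr fun y => ?_
      have := lintegral_add_taboo κ hD (fun _ => 1) y
      simpa using this
  have h1 : entranceKernel κ hD x Set.univ = ∑' n, ∫⁻ y, κ y D ∂((tabooKernel κ hD ^ n) x) := by
    rw [← lintegral_green, ← lintegral_one, lintegral_entrance κ hD measurable_const]
    simp
  rw [h1]
  have h2 := (ENNReal.summable (f := fun n => ∫⁻ y, κ y D ∂((tabooKernel κ hD ^ n) x))).hasSum.tendsto_sum_nat
  have h3 := h2.add h
  simp_rw [key] at h3
  rw [add_zero] at h3
  exact tendsto_nhds_unique h3 tendsto_const_nhds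

/-- **Foster's criterion** with state-dependent times. -/
theorem meanReturn_le_of_drift [IsMarkovKernel κ] {Λ : S → ℝ≥0∞} (c : ℝ≥0∞)
    (hdrift : ∀ z ∉ D, ∃ k : ℕ, 1 ≤ k ∧ c * k + ∫⁻ y, Λ y ∂((κ ^ k) z) ≤ Λ z) (z : S) (k : ℕ)
    (hk : 1 ≤ k) : c * meanReturn κ hD z ≤ c * k + ∫⁻ y, Λ y ∂((κ ^ k) z) := by
  -- `v n z` is `𝐄_z min(τ, n)`; the estimate is proved by induction on the truncation level.
  set v : ℕ → S → ℝ≥0∞ := fun n z =>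
    ∑ j ∈ Finset.range n, (tabooKernel κ hD ^ j) z Set.univ with hv
  have hvm : ∀ n, Measurable (v n) := fun n =>
    Finset.measurable_sum _ fun j _ => Kernel.measurable_coe _ MeasurableSet.univ
  have e : ∀ ψ : Measure S, ψ Set.univ = ∫⁻ _, 1 ∂ψ := fun ψ => by simp
  have hvs : ∀ n z, v (n + 1) z = 1 + ∫⁻ y, Dᶜ.indicator (v n) y ∂(κ z) := by
    intro n z
    rw [lintegral_indicator hD.compl, ← lintegral_taboo κ hD]
    simp only [hv]
    rw [Finset.sum_range_succ', lintegral_finsetSum _ fun j _ =>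
      Kernel.measurable_coe _ MeasurableSet.univ, add_comm]
    congr 1
    · rw [e, lintegral_pow_zero _ measurable_const]
    · refine Finset.sum_congr rfl fun j _ => ?_
      rw [e, lintegral_pow_succ' _ measurable_const]
      simp
  have hmono : ∀ n z, v n z ≤ v (n + 1) z := fun n z => by
    simp only [hv, Finset.sum_range_succ]; exact le_self_add
  -- Visits to `D` strictly before time `k` are ignored. This only increases the bound, and it lets
  -- the drift condition refer to the unkilled power `κ ^ k`.
  have hstep : ∀ n k : ℕ, 1 ≤ k → ∀ z,
      v (n + 1) z ≤ k + ∫⁻ y, Dᶜ.indicator (v n) y ∂((κ ^ k) z) := by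
    intro n k hk z
    induction k, hk using Nat.le_induction with
    | base => rw [hvs, pow_one, Nat.cast_one]
    | succ k hk ih =>
      refine ih.trans ?_
      have h1 : ∀ y, Dᶜ.indicator (v n) y ≤ 1 + ∫⁻ y', Dᶜ.indicator (v n) y' ∂(κ y) := by
        intro y
        rw [← hvs]
        exact (Set.indicator_le_self _ _ _).trans (hmono n y)
      calc (k : ℝ≥0∞) + ∫⁻ y, Dᶜ.indicator (v n) y ∂((κ ^ k) z)
          ≤ k + ∫⁻ y, (1 + ∫⁻ y', Dᶜ.indicator (v n) y' ∂(κ y)) ∂((κ ^ k) z) := by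
            gcongr with y; exact h1 y
        _ = ((k + 1 : ℕ) : ℝ≥0∞) + ∫⁻ y, Dᶜ.indicator (v n) y ∂((κ ^ (k + 1)) z) := by
            rw [lintegral_add_left measurable_const, lintegral_pow_succ _ ((hvm n).indicator hD.compl)]
            simp [add_assoc]
  have hstep' : ∀ n k : ℕ, 1 ≤ k → (∀ z ∉ D, c * v n z ≤ Λ z) → ∀ z,
      c * v (n + 1) z ≤ c * k + ∫⁻ y, Λ y ∂((κ ^ k) z) := by
    intro n k hk h z
    calc c * v (n + 1) z ≤ c * (k + ∫⁻ y, Dᶜ.indicator (v n) y ∂((κ ^ k) z)) := by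
          gcongr; exact hstep n k hk z
      _ = c * k + ∫⁻ y, c * Dᶜ.indicator (v n) y ∂((κ ^ k) z) := by
          rw [mul_add, lintegral_const_mul _ ((hvm n).indicator hD.compl)]
      _ ≤ _ := by
          gcongr with y
          by_cases hy : y ∈ D
          · simp [hy]
          · rw [Set.indicator_of_mem (by simpa using hy)]; exact h y hy
  have hind : ∀ n, ∀ z ∉ D, c * v n z ≤ Λ z := by
    intro n
    induction n with
    | zero => intro z _; simp [hv]
    | succ n ih =>
      intro z hz
      obtain ⟨k, hk, h⟩ := hdrift z hz
      exact (hstep' n k hk ih z).trans h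
  have hsum : meanReturn κ hD z = ⨆ n, v n z := by
    rw [meanReturn, greenKernel, Kernel.sum_apply' _ _ MeasurableSet.univ, ENNReal.tsum_eq_iSup_nat]
  rw [hsum, ENNReal.mul_iSup]
  refine iSup_le fun n => ?_
  calc c * v n z ≤ c * v (n + 1) z := by gcongr; exact hmono n z
    _ ≤ _ := hstep' n k hk (hind n) z

lemma tendsto_taboo_of_meanReturn_lt_top (z : S) (h : meanReturn κ hD z ≠ ⊤) :
    Tendsto (fun n => (tabooKernel κ hD ^ n) z Set.univ) atTop (𝓝 0) := by
  rw [meanReturn, greenKernel, Kernel.sum_apply' _ _ MeasurableSet.univ] at h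
  exact ENNReal.tendsto_atTop_zero_of_tsum_ne_top h

lemma taboo_pow_succ_univ_le [IsMarkovKernel κ] (n : ℕ) (z : S) :
    (tabooKernel κ hD ^ (n + 1)) z Set.univ ≤ (tabooKernel κ hD ^ n) z Set.univ := by
  have e : ∀ ψ : Measure S, ψ Set.univ = ∫⁻ _, 1 ∂ψ := fun ψ => by simp
  rw [e, e, lintegral_pow_succ _ measurable_const]
  refine lintegral_mono fun y => (lintegral_taboo_le κ hD _ y).trans ?_
  simp

/-- If `D` is a.s. reached from every point of `C`, and `C` is a.s. reached from everywhere, then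
`D` is a.s. reached from everywhere. -/
lemma tendsto_taboo_of_tendsto_taboo [IsMarkovKernel κ] {C : Set S} (hC : MeasurableSet C)
    (hCall : ∀ z, Tendsto (fun n => (tabooKernel κ hC ^ n) z Set.univ) atTop (𝓝 0))
    (hCD : ∀ z ∈ C, Tendsto (fun n => (tabooKernel κ hD ^ n) z Set.univ) atTop (𝓝 0)) (z : S) :
    Tendsto (fun n => (tabooKernel κ hD ^ n) z Set.univ) atTop (𝓝 0) := by
  have e : ∀ ψ : Measure S, ψ Set.univ = ∫⁻ _, 1 ∂ψ := fun ψ => by simp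
  have hanti : ∀ z, Antitone fun n => (tabooKernel κ hD ^ n) z Set.univ := fun z =>
    antitone_nat_of_succ_le fun n => taboo_pow_succ_univ_le κ hD n z
  -- `q z` is the probability of never visiting `D`. It satisfies `q ≤ P q` and vanishes on `C`,
  -- hence is at most the probability of avoiding `C` for `n` steps, for every `n`.
  set q : S → ℝ≥0∞ := fun z => ⨅ n, (tabooKernel κ hD ^ n) z Set.univ with hq
  have hqm : Measurable q := Measurable.iInf fun n => Kernel.measurable_coe _ MeasurableSet.univ
  have hlim : ∀ z, Tendsto (fun n => (tabooKernel κ hD ^ n) z Set.univ) atTop (𝓝 (q z)) :=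
    fun z => tendsto_atTop_iInf (hanti z)
  have hq1 : ∀ z, q z ≤ 1 := fun z => by
    refine (iInf_le _ 0).trans ?_
    rw [e, lintegral_pow_zero _ measurable_const]
  have hqC : ∀ z ∈ C, q z = 0 := fun z hz => tendsto_nhds_unique (hlim z) (hCD z hz)
  have hle : ∀ z, q z ≤ ∫⁻ y, q y ∂(κ z) := by
    intro z
    have h1 : ∫⁻ y, q y ∂(κ z) = ⨅ n, ∫⁻ y, (tabooKernel κ hD ^ n) y Set.univ ∂(κ z) := by
      refine lintegral_iInf (fun n => Kernel.measurable_coe _ MeasurableSet.univ) ?_ ?_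
      · intro a b hab y; exact hanti y hab
      · refine ne_of_lt (lt_of_le_of_lt (b := 1) ?_ ENNReal.one_lt_top)
        have : ∀ y, (tabooKernel κ hD ^ 0) y Set.univ ≤ 1 := fun y => by
          rw [e, lintegral_pow_zero _ measurable_const]
        exact (lintegral_mono this).trans (by simp)
    rw [h1]
    refine le_iInf fun n => (iInf_le _ (n + 1)).trans ?_
    rw [e, lintegral_pow_succ' _ measurable_const]
    refine (lintegral_taboo_le κ hD _ z).trans ?_
    simp
  have hle' : ∀ z, q z ≤ ∫⁻ y, q y ∂(tabooKernel κ hC z) := by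
    intro z
    refine (hle z).trans ?_
    rw [← lintegral_add_taboo κ hC]
    rw [setLIntegral_congr_fun hC (g := fun _ => 0) (fun y hy => hqC y hy)]
    simp
  have hit : ∀ n, q z ≤ ∫⁻ y, q y ∂((tabooKernel κ hC ^ n) z) := by
    intro n
    induction n with
    | zero => rw [lintegral_pow_zero _ hqm]
    | succ n ih =>
      rw [lintegral_pow_succ _ hqm]
      exact ih.trans (lintegral_mono hle')
  have hit' : ∀ n, q z ≤ (tabooKernel κ hC ^ n) z Set.univ := fun n => by
    rw [e]; exact (hit n).trans (lintegral_mono hq1)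
  have : q z = 0 := le_antisymm (ge_of_tendsto' (hCall z) hit') zero_le
  rw [← this]; exact hlim z

end Green

end MarkovStability

namespace MarkovStability

/-! ### Doeblin's condition, lazy chains and potentials of bounded functions -/

section Doeblin

variable {S : Type u} [MeasurableSpace S]

lemma integrable_of_abs_le {ν : Measure S} [IsFiniteMeasure ν] {F : S → ℝ} (hF : Measurable F)
    {K : ℝ} (hK : ∀ x, |F x| ≤ K) : Integrable F ν :=
  Integrable.of_bound hF.aestronglyMeasurable K (ae_of_all _ hK)

lemma abs_integral_le {ν : Measure S} [IsProbabilityMeasure ν] {F : S → ℝ}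
    {K : ℝ} (hK : ∀ x, |F x| ≤ K) : |∫ x, F x ∂ν| ≤ K := by
  have := norm_integral_le_of_norm_le_const (μ := ν) (f := F) (C := K) (ae_of_all _ hK)
  simpa using this

lemma measurable_integral_kernel (Q : Kernel S S) {F : S → ℝ} (hF : Measurable F) :
    Measurable fun x => ∫ y, F y ∂(Q x) :=
  hF.stronglyMeasurable.integral_kernel.measurable

lemma integral_pow_zero (κ : Kernel S S) {F : S → ℝ} (hF : Measurable F) (z : S) :
    ∫ y, F y ∂((κ ^ 0) z) = F z := by
  rw [pow_zero]
  exact integral_dirac' F z hF.stronglyMeasurable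

lemma integral_pow_succ (κ : Kernel S S) {F : S → ℝ} (n : ℕ) (z : S)
    (hF : Integrable F ((κ ^ (n + 1)) z)) :
    ∫ y, F y ∂((κ ^ (n + 1)) z) = ∫ x, ∫ y, F y ∂(κ x) ∂((κ ^ n) z) := by
  rw [pow_succ'] at hF ⊢
  exact Kernel.integral_comp hF

lemma integral_pow_succ' (κ : Kernel S S) {F : S → ℝ} (n : ℕ) (z : S)
    (hF : Integrable F ((κ ^ (n + 1)) z)) :
    ∫ y, F y ∂((κ ^ (n + 1)) z) = ∫ x, ∫ y, F y ∂((κ ^ n) x) ∂(κ z) := by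
  rw [pow_succ] at hF ⊢
  exact Kernel.integral_comp hF

lemma integral_invariant {Q : Kernel S S} {π : Measure S} (hπ : Q.Invariant π) {F : S → ℝ}
    (hF : Integrable F π) : ∫ x, ∫ y, F y ∂(Q x) ∂π = ∫ x, F x ∂π := by
  have h := Kernel.integral_comp (κ := Kernel.const Unit π) (η := Q) (a := ()) (f := F)
  rw [← Measure.comp_eq_comp_const_apply, hπ.def] at h
  rw [h hF, Kernel.const_apply]

lemma lintegral_invariant {Q : Kernel S S} {π : Measure S} (hπ : Q.Invariant π) {φ : S → ℝ≥0∞}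
    (hφ : Measurable φ) : ∫⁻ x, ∫⁻ y, φ y ∂(Q x) ∂π = ∫⁻ x, φ x ∂π := by
  rw [← Measure.lintegral_bind Q.aemeasurable hφ.aemeasurable, hπ.def]

lemma invariant_pow {Q : Kernel S S} {π : Measure S} (hπ : Q.Invariant π) (n : ℕ) :
    (Q ^ n).Invariant π := by
  induction n with
  | zero =>
    rw [pow_zero]
    change π.bind (Kernel.id : Kernel S S) = π
    exact Measure.id_comp
  | succ n ih => rw [pow_succ]; exact Kernel.Invariant.comp ih hπ

/-- Regeneration: write `Q = ε μ + R` with `R` of constant mass `1 - ε`. The geometric series `ε ∑ₙ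
μ Rⁿ` has mass one and is invariant. -/
lemma exists_invariant_of_minorized (Q : Kernel S S) [IsMarkovKernel Q] (μ : Measure S)
    [IsProbabilityMeasure μ] {ε : ℝ≥0∞} (hε : ε ≠ 0) (h : ∀ x, ε • μ ≤ Q x) :
    ∃ π : Measure S, IsProbabilityMeasure π ∧ Q.Invariant π := by
  have hS : Nonempty S := nonempty_of_isProbabilityMeasure μ
  have hε1 : ε ≤ 1 := by
    have := h hS.some Set.univ
    simpa using this
  have hεt : ε ≠ ⊤ := ne_top_of_le_ne_top ENNReal.one_ne_top hε1
  have : IsFiniteMeasure (ε • μ) := ⟨by simpa using hεt.lt_top⟩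
  let R : Kernel S S := ⟨fun x => Q x - ε • μ, by
    refine Measure.measurable_of_measurable_coe _ fun s hs => ?_
    simp_rw [Measure.sub_apply hs (h _)]
    exact (Q.measurable_coe hs).sub_const _⟩
  have hR : ∀ x, R x = Q x - ε • μ := fun x => rfl
  have hRQ : ∀ x B, MeasurableSet B → Q x B = R x B + ε * μ B := by
    intro x B hB
    rw [hR, Measure.sub_apply hB (h x), Measure.smul_apply, smul_eq_mul, tsub_add_cancel_of_le]
    exact h x B
  have hR1 : ∀ x, R x Set.univ = 1 - ε := by
    intro x
    rw [hR, Measure.sub_apply MeasurableSet.univ (h x)]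
    simp
  let ν : ℕ → Measure S := fun n => Nat.rec μ (fun _ ρ => ρ.bind R) n
  have hν0 : ν 0 = μ := rfl
  have hνs : ∀ n, ν (n + 1) = (ν n).bind R := fun n => rfl
  have hν1 : ∀ n, ν n Set.univ = (1 - ε) ^ n := by
    intro n
    induction n with
    | zero => simp [hν0]
    | succ n ih =>
      rw [hνs, Measure.bind_apply MeasurableSet.univ R.aemeasurable]
      simp_rw [hR1]
      rw [lintegral_const, ih, pow_succ, mul_comm]
  have hgeom : ε * ∑' n, ν n Set.univ = 1 := by
    simp_rw [hν1]
    rw [ENNReal.tsum_geometric, ENNReal.sub_sub_cancel ENNReal.one_ne_top hε1,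
      ENNReal.mul_inv_cancel hε hεt]
  refine ⟨ε • Measure.sum ν, ⟨?_⟩, ?_⟩
  · rw [Measure.smul_apply, Measure.sum_apply _ MeasurableSet.univ, smul_eq_mul, hgeom]
  · unfold Kernel.Invariant
    ext B hB
    rw [Measure.bind_apply hB Q.aemeasurable, lintegral_smul_measure, lintegral_sum_measure,
      Measure.smul_apply, Measure.sum_apply _ hB]
    have h1 : ∀ n, ∫⁻ x, Q x B ∂(ν n) = ν (n + 1) B + ε * ν n Set.univ * μ B := by
      intro n
      simp_rw [hRQ _ B hB]
      rw [lintegral_add_right _ measurable_const, lintegral_const, hνs,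
        Measure.bind_apply hB R.aemeasurable]
      ring
    simp_rw [h1]
    rw [ENNReal.tsum_add, ENNReal.tsum_mul_right, ENNReal.tsum_mul_left, hgeom, one_mul, add_comm]
    congr 1
    rw [tsum_eq_zero_add' (f := fun n => ν n B) ENNReal.summable, hν0]

/-- Average `π₀ Q^j` over `j < r`: applying `Q` shifts the sum, and the two end terms coincide. -/
lemma exists_invariant_of_pow (Q : Kernel S S) [IsMarkovKernel Q] {r : ℕ} (hr : 1 ≤ r)
    {π₀ : Measure S} [IsProbabilityMeasure π₀] (h : (Q ^ r).Invariant π₀) :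
    ∃ π : Measure S, IsProbabilityMeasure π ∧ Q.Invariant π := by
  have hr0 : (r : ℝ≥0∞) ≠ 0 := by
    simp only [ne_eq, Nat.cast_eq_zero]; omega
  refine ⟨(r : ℝ≥0∞)⁻¹ • ∑ j ∈ Finset.range r, π₀.bind ⇑(Q ^ j), ⟨?_⟩, ?_⟩
  · rw [Measure.smul_apply, Measure.finsetSum_apply]
    have h1 : ∀ j, π₀.bind ⇑(Q ^ j) Set.univ = 1 := by
      intro j
      rw [Measure.bind_apply MeasurableSet.univ (Q ^ j).aemeasurable]
      simp
    simp_rw [h1]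
    simp only [Finset.sum_const, Finset.card_range, nsmul_eq_mul, mul_one, smul_eq_mul]
    exact ENNReal.inv_mul_cancel hr0 (ENNReal.natCast_ne_top r)
  · unfold Kernel.Invariant
    ext B hB
    rw [Measure.bind_apply hB Q.aemeasurable, lintegral_smul_measure, lintegral_finsetSum_measure,
      Measure.smul_apply, Measure.finsetSum_apply]
    congr 1
    have h1 : ∀ j, ∫⁻ x, Q x B ∂(π₀.bind ⇑(Q ^ j)) = π₀.bind ⇑(Q ^ (j + 1)) B := by
      intro j
      rw [← Measure.bind_apply hB Q.aemeasurable, Measure.comp_assoc, pow_succ']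
      rfl
    simp_rw [h1]
    have h0 : π₀.bind ⇑(Q ^ 0) = π₀ := by
      rw [pow_zero]
      change π₀.bind (Kernel.id : Kernel S S) = π₀
      exact Measure.id_comp
    have h2 := Finset.sum_range_succ (fun j => π₀.bind ⇑(Q ^ j) B) r
    rw [Finset.sum_range_succ', h.def, h0] at h2
    exact (ENNReal.add_left_inj (measure_ne_top _ _)).1 h2

/-- The part `ε μ` is common to all `Q x`, so only the fraction `1 - ε` of the oscillation survives.
-/
lemma integral_range_of_minorized (Q : Kernel S S) [IsMarkovKernel Q] (μ : Measure S)
    [IsProbabilityMeasure μ] {ε : ℝ≥0∞} (h : ∀ x, ε • μ ≤ Q x) {F : S → ℝ}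
    (hF : Measurable F) {a b : ℝ} (hab : ∀ x, a ≤ F x ∧ F x ≤ b) :
    ∃ a' b', b' - a' = (1 - ε.toReal) * (b - a) ∧
      ∀ x, a' ≤ ∫ y, F y ∂(Q x) ∧ ∫ y, F y ∂(Q x) ≤ b' := by
  have hint : ∀ (ν : Measure S) [IsFiniteMeasure ν], Integrable F ν := fun ν _ =>
    integrable_of_abs_le hF (K := max |a| |b|) fun x => abs_le_max_abs_abs (hab x).1 (hab x).2
  set m := ∫ y, F y ∂μ
  refine ⟨a + ε.toReal * (m - a), b - ε.toReal * (b - m), by ring, fun x => ⟨?_, ?_⟩⟩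
  · have h1 : ∫ y, (F y - a) ∂(ε • μ) ≤ ∫ y, (F y - a) ∂(Q x) :=
      integral_mono_measure (h x) (ae_of_all _ fun y => sub_nonneg.2 (hab y).1)
        ((hint _).sub (integrable_const _))
    rw [integral_smul_measure, integral_sub (hint _) (integrable_const _),
      integral_sub (hint _) (integrable_const _)] at h1
    simp only [integral_const, probReal_univ, smul_eq_mul] at h1
    linarith
  · have h1 : ∫ y, (b - F y) ∂(ε • μ) ≤ ∫ y, (b - F y) ∂(Q x) :=
      integral_mono_measure (h x) (ae_of_all _ fun y => sub_nonneg.2 (hab y).2)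
        ((integrable_const _).sub (hint _))
    rw [integral_smul_measure, integral_sub (integrable_const _) (hint _),
      integral_sub (integrable_const _) (hint _)] at h1
    simp only [integral_const, probReal_univ, smul_eq_mul] at h1
    linarith

/-- Under Doeblin's condition, a bounded function of negative stationary mean is eventually
mapped to a non-positive function. -/
lemma exists_integral_pow_nonpos (Q : Kernel S S) [IsMarkovKernel Q] (μ : Measure S)
    [IsProbabilityMeasure μ] {ε : ℝ≥0∞} (hε : ε ≠ 0) (h : ∀ x, ε • μ ≤ Q x) {π : Measure S}
    [IsProbabilityMeasure π] (hπ : Q.Invariant π) {F : S → ℝ} (hF : Measurable F) {K : ℝ}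
    (hK : ∀ x, |F x| ≤ K) (hneg : ∫ x, F x ∂π < 0) : ∃ n, ∀ x, ∫ y, F y ∂((Q ^ n) x) ≤ 0 := by
  have hS : Nonempty S := nonempty_of_isProbabilityMeasure μ
  have hε1 : ε ≤ 1 := by
    have := h hS.some Set.univ
    simpa using this
  have hεt : ε ≠ ⊤ := ne_top_of_le_ne_top ENNReal.one_ne_top hε1
  have hint : ∀ (ν : Measure S) [IsFiniteMeasure ν], Integrable F ν := fun ν _ =>
    integrable_of_abs_le hF hK
  have key : ∀ n, ∃ a b, b - a = (1 - ε.toReal) ^ n * (K - -K) ∧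
      ∀ x, a ≤ ∫ y, F y ∂((Q ^ n) x) ∧ ∫ y, F y ∂((Q ^ n) x) ≤ b := by
    intro n
    induction n with
    | zero =>
      refine ⟨-K, K, by ring, fun x => ?_⟩
      rw [integral_pow_zero _ hF]
      exact abs_le.1 (hK x)
    | succ n ih =>
      obtain ⟨a, b, hab, hx⟩ := ih
      obtain ⟨a', b', h1, h2⟩ := integral_range_of_minorized Q μ h
        (measurable_integral_kernel (Q ^ n) hF) hx
      refine ⟨a', b', by rw [h1, hab]; ring, fun x => ?_⟩
      rw [integral_pow_succ' _ _ _ (hint _)]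
      exact h2 x
  have hlim : Tendsto (fun n : ℕ => (1 - ε.toReal) ^ n * (K - -K)) atTop (𝓝 0) := by
    have h1 : Tendsto (fun n : ℕ => (1 - ε.toReal) ^ n) atTop (𝓝 0) := by
      apply tendsto_pow_atTop_nhds_zero_of_lt_one
      · have := ENNReal.toReal_mono ENNReal.one_ne_top hε1
        simp at this; linarith
      · have := ENNReal.toReal_pos hε hεt; linarith
    simpa using h1.mul_const (K - -K)
  -- The `π`-mean of `Q^n F` does not depend on `n` and lies in the range of `Q^n F`. Once the
  -- oscillation is smaller than the modulus of this negative mean, the whole range is negative.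
  obtain ⟨n, hn⟩ := (hlim.eventually (gt_mem_nhds (neg_pos.2 hneg))).exists
  refine ⟨n, fun x => ?_⟩
  obtain ⟨a, b, hab, hx⟩ := key n
  have h1 : a ≤ ∫ x, F x ∂π := by
    rw [← integral_invariant (invariant_pow hπ n) (hint π)]
    have h2 : ∫ _, a ∂π ≤ ∫ x, ∫ y, F y ∂((Q ^ n) x) ∂π :=
      integral_mono (integrable_const _)
        (integrable_of_abs_le (measurable_integral_kernel _ hF) (K := K)
          fun x => abs_integral_le hK) fun x => (hx x).1
    simpa using h2
  linarith [(hx x).2]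

/-- The lazy version of a kernel: stay put with probability one half. -/
noncomputable def lazyKernel (E : Kernel S S) : Kernel S S :=
  ⟨fun x => (2⁻¹ : ℝ≥0∞) • (Measure.dirac x + E x), by
    refine Measure.measurable_of_measurable_coe _ fun s hs => ?_
    simp only [Measure.smul_apply, Measure.add_apply, smul_eq_mul]
    exact (((Measure.measurable_coe hs).comp Measure.measurable_dirac).add (E.measurable_coe hs)).const_mul _⟩

lemma lazyKernel_apply (E : Kernel S S) (x : S) :
    lazyKernel E x = (2⁻¹ : ℝ≥0∞) • (Measure.dirac x + E x) := rfl

lemma lintegral_lazyKernel (E : Kernel S S) {φ : S → ℝ≥0∞} (hφ : Measurable φ) (x : S) :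
    ∫⁻ y, φ y ∂(lazyKernel E x) = 2⁻¹ * (φ x + ∫⁻ y, φ y ∂(E x)) := by
  rw [lazyKernel_apply, lintegral_smul_measure, lintegral_add_measure, lintegral_dirac' _ hφ]
  rfl

instance isMarkovKernel_lazyKernel (E : Kernel S S) [IsMarkovKernel E] :
    IsMarkovKernel (lazyKernel E) := by
  refine ⟨fun x => ⟨?_⟩⟩
  rw [← lintegral_one, lintegral_lazyKernel E measurable_const]
  simp only [lintegral_const, measure_univ, mul_one]
  rw [one_add_one_eq_two]
  exact ENNReal.inv_mul_cancel two_ne_zero ENNReal.ofNat_ne_top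

lemma integral_lazyKernel (E : Kernel S S) [IsMarkovKernel E] {F : S → ℝ} (hF : Measurable F)
    {K : ℝ} (hK : ∀ x, |F x| ≤ K) (x : S) :
    ∫ y, F y ∂(lazyKernel E x) = 2⁻¹ * (F x + ∫ y, F y ∂(E x)) := by
  rw [lazyKernel_apply, integral_smul_measure, integral_add_measure
    (integrable_of_abs_le hF hK) (integrable_of_abs_le hF hK),
    integral_dirac' _ _ hF.stronglyMeasurable]
  simp

lemma invariant_of_lazyKernel (E : Kernel S S) {π : Measure S} [IsProbabilityMeasure π]
    (h : (lazyKernel E).Invariant π) : E.Invariant π := by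
  unfold Kernel.Invariant
  ext B hB
  have hm : Measurable (B.indicator (1 : S → ℝ≥0∞)) := measurable_one.indicator hB
  have h1 := lintegral_invariant h hm
  simp_rw [lintegral_lazyKernel E hm] at h1
  have hm' : Measurable fun x => B.indicator (1 : S → ℝ≥0∞) x +
      ∫⁻ y, B.indicator (1 : S → ℝ≥0∞) y ∂(E x) := hm.add hm.lintegral_kernel
  rw [lintegral_const_mul _ hm', lintegral_add_left hm] at h1
  simp_rw [lintegral_indicator_one hB] at h1
  rw [Measure.bind_apply hB E.aemeasurable]
  have h2 : π B + ∫⁻ x, E x B ∂π = π B + π B := by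
    have h3 := congrArg (fun t => 2 * t) h1
    simp only [← mul_assoc] at h3
    rwa [ENNReal.mul_inv_cancel two_ne_zero ENNReal.ofNat_ne_top, one_mul, two_mul] at h3
  exact (ENNReal.add_right_inj (measure_ne_top _ _)).1 h2

/-- If a power of the lazy chain satisfies Doeblin's condition, then the chain has a stationary
distribution `π`, and every bounded function of negative `π`-mean has a bounded
superharmonic potential. -/
theorem exists_potential (E : Kernel S S) [IsMarkovKernel E] (μ : Measure S)
    [IsProbabilityMeasure μ] {ε : ℝ≥0∞} (hε : ε ≠ 0) {r : ℕ} (hr : 1 ≤ r)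
    (h : ∀ x, ε • μ ≤ (lazyKernel E ^ r) x) :
    ∃ π : Measure S, IsProbabilityMeasure π ∧ E.Invariant π ∧
      ∀ F : S → ℝ, Measurable F → (∃ K, ∀ x, |F x| ≤ K) → ∫ x, F x ∂π < 0 →
        ∃ g : S → ℝ, Measurable g ∧ (∃ B, ∀ x, |g x| ≤ B) ∧ ∀ x, ∫ y, g y ∂(E x) + F x ≤ g x := by
  obtain ⟨π₀, hπ₀, hinv₀⟩ := exists_invariant_of_minorized (lazyKernel E ^ r) μ hε h
  obtain ⟨π, hπ, hinv⟩ := exists_invariant_of_pow (lazyKernel E) hr hinv₀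
  refine ⟨π, hπ, invariant_of_lazyKernel E hinv, ?_⟩
  rintro F hF ⟨K, hK⟩ hneg
  obtain ⟨n, hn⟩ := exists_integral_pow_nonpos (lazyKernel E ^ r) μ hε h (invariant_pow hinv r)
    hF hK hneg
  rw [← pow_mul] at hn
  set N := r * n
  set Fn : ℕ → S → ℝ := fun j x => ∫ y, F y ∂((lazyKernel E ^ j) x) with hFn
  have hFnm : ∀ j, Measurable (Fn j) := fun j => measurable_integral_kernel _ hF
  have hFnK : ∀ j x, |Fn j x| ≤ K := fun j x => abs_integral_le hK
  -- With `Θ` the lazy kernel, the potential is `g = ½ ∑_{j<N} Θ^j F`. Telescoping gives `Θ g = g -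
  -- ½ F + ½ Θ^N F ≤ g - ½ F`, and `Θ = ½ (1 + E)` turns this into `E g + F ≤ g`.
  have hg : Measurable fun x => ∑ j ∈ Finset.range N, 2⁻¹ * Fn j x :=
    Finset.measurable_sum _ fun j _ => (hFnm j).const_mul _
  have hgB : ∀ x, |∑ j ∈ Finset.range N, 2⁻¹ * Fn j x| ≤ N * K := by
    intro x
    refine (Finset.abs_sum_le_sum_abs _ _).trans ?_
    refine (Finset.sum_le_sum fun j _ => (?_ : _ ≤ K)).trans (by simp)
    rw [abs_mul]
    have := hFnK j x
    have h0 := abs_nonneg (Fn j x)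
    rw [abs_of_pos (by norm_num)]
    linarith
  refine ⟨_, hg, ⟨_, hgB⟩, fun x => ?_⟩
  have h1 := integral_lazyKernel E hg hgB x
  rw [integral_finsetSum _ fun j _ => (integrable_of_abs_le (hFnm j) (hFnK j)).const_mul _] at h1
  have h2 : ∀ j, ∫ y, 2⁻¹ * Fn j y ∂(lazyKernel E x) = 2⁻¹ * Fn (j + 1) x := by
    intro j
    rw [integral_const_mul, hFn]
    simp only
    rw [integral_pow_succ' _ _ _ (integrable_of_abs_le hF hK)]
  simp_rw [h2] at h1
  have h3 := Finset.sum_range_succ (fun j => 2⁻¹ * Fn j x) N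
  rw [Finset.sum_range_succ'] at h3
  have h4 : Fn 0 x = F x := integral_pow_zero _ hF x
  have h5 : Fn N x ≤ 0 := hn x
  rw [h4] at h3
  linarith

end Doeblin

end MarkovStability

namespace MarkovStability

/-! ### Ergodic behaviour of a positive recurrent chain with a minorized recurrent set -/

section Recurrent

variable {S : Type u} [MeasurableSpace S] (κ : Kernel S S) {V : Set S} (hV : MeasurableSet V)

lemma meanReturn_eq (x : S) :
    meanReturn κ hV x = 1 + ∫⁻ y, meanReturn κ hV y ∂(tabooKernel κ hV x) := by
  have := lintegral_green_eq κ hV (measurable_const (a := (1 : ℝ≥0∞))) x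
  simpa [meanReturn] using this

lemma measurable_meanReturn : Measurable (meanReturn κ hV) :=
  Kernel.measurable_coe _ MeasurableSet.univ

/-- The expected hitting time of `V` (equal to `0` on `V`). -/
noncomputable def meanHitting (x : S) : ℝ≥0∞ := Vᶜ.indicator (meanReturn κ hV) x

lemma measurable_meanHitting : Measurable (meanHitting κ hV) :=
  (measurable_meanReturn κ hV).indicator hV.compl

lemma lintegral_indicator_compl (φ : S → ℝ≥0∞) (x : S) :
    ∫⁻ y, Vᶜ.indicator φ y ∂(κ x) = ∫⁻ y, φ y ∂(tabooKernel κ hV x) := by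
  rw [lintegral_indicator hV.compl, lintegral_taboo]

lemma one_add_lintegral_meanHitting (x : S) :
    1 + ∫⁻ y, meanHitting κ hV y ∂(κ x) = meanReturn κ hV x := by
  unfold meanHitting
  rw [lintegral_indicator_compl, ← meanReturn_eq]

/-- `P^m E ≤ 2^m E Θ^m`, where `E` is the entrance kernel and `Θ` its lazy version. -/
lemma lintegral_pow_entrance_le (m : ℕ) (x : S) : ∀ {φ : S → ℝ≥0∞}, Measurable φ →
    ∫⁻ y, ∫⁻ y', φ y' ∂(entranceKernel κ hV y) ∂((κ ^ m) x) ≤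
      2 ^ m * ∫⁻ y, ∫⁻ y', φ y' ∂((lazyKernel (entranceKernel κ hV) ^ m) y)
        ∂(entranceKernel κ hV x) := by
  induction m with
  | zero =>
    intro φ hφ
    rw [lintegral_pow_zero _ hφ.lintegral_kernel]
    simp_rw [lintegral_pow_zero _ hφ]
    simp
  | succ m ih =>
    intro φ hφ
    set E := entranceKernel κ hV
    have hE : Measurable fun y => ∫⁻ y', φ y' ∂(E y) := hφ.lintegral_kernel
    rw [lintegral_pow_succ _ hE]
    -- One step gives `P E ≤ E + E² = 2 E Θ`; the induction hypothesis is then used for the function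
    -- `2 Θ φ`.
    calc ∫⁻ y, ∫⁻ y', ∫⁻ y'', φ y'' ∂(E y') ∂(κ y) ∂((κ ^ m) x)
        ≤ ∫⁻ y, ∫⁻ y', 2 * ∫⁻ y'', φ y'' ∂(lazyKernel E y') ∂(E y) ∂((κ ^ m) x) := by
          refine lintegral_mono fun y => (lintegral_comp_entrance_le κ hV hφ y).trans ?_
          rw [← lintegral_add_left hφ]
          refine lintegral_mono fun y' => ?_
          rw [lintegral_lazyKernel E hφ, ← mul_assoc,
            ENNReal.mul_inv_cancel two_ne_zero ENNReal.ofNat_ne_top, one_mul]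
      _ ≤ 2 ^ m * ∫⁻ y, ∫⁻ y', 2 * ∫⁻ y'', φ y'' ∂(lazyKernel E y') ∂((lazyKernel E ^ m) y)
            ∂(E x) := ih (hφ.lintegral_kernel.const_mul 2)
      _ = _ := by
          have : ∀ y, ∫⁻ y', 2 * ∫⁻ y'', φ y'' ∂(lazyKernel E y') ∂((lazyKernel E ^ m) y) =
              2 * ∫⁻ y', φ y' ∂((lazyKernel E ^ (m + 1)) y) := by
            intro y
            rw [lintegral_const_mul _ hφ.lintegral_kernel, lintegral_pow_succ _ hφ]
          simp_rw [this]
          rw [lintegral_const_mul _ hφ.lintegral_kernel, ← mul_assoc, ← pow_succ]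

lemma admitsMinorant_iff_pow [IsMarkovKernel κ] (V : Set S) :
    AdmitsMinorant κ V ↔ ∃ (p : ℝ) (μ : Measure S) (m : ℕ), 0 < p ∧ p ≤ 1 ∧
      IsProbabilityMeasure μ ∧ 1 ≤ m ∧
      ∀ z ∈ V, ∀ B, MeasurableSet B → ENNReal.ofReal p * μ B ≤ (κ ^ m) z B := by
  unfold AdmitsMinorant
  have h : ∀ (m : ℕ) z B, MeasurableSet B → pathLaw κ z {w | w m ∈ B} = (κ ^ m) z B := by
    intro m z B hB
    rw [← map_pathLaw, Measure.map_apply (measurable_pi_apply m) hB]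
    rfl
  constructor
  · rintro ⟨p, μ, m, h1, h2, h3, h4, h5⟩
    exact ⟨p, μ, m, h1, h2, h3, h4, fun z hz B hB => h m z B hB ▸ h5 z hz B hB⟩
  · rintro ⟨p, μ, m, h1, h2, h3, h4, h5⟩
    exact ⟨p, μ, m, h1, h2, h3, h4, fun z hz B hB => (h m z B hB).symm ▸ h5 z hz B hB⟩

lemma isMarkovKernel_entrance [IsMarkovKernel κ] (hrec : PositiveRecurrent κ V) :
    IsMarkovKernel (entranceKernel κ hV) :=
  ⟨fun x => ⟨entrance_univ κ hV x (((positiveRecurrent_iff κ hV).1 hrec).1 x)⟩⟩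

/-- The number of visits to `V` within `m` steps is random, so the minorization of `κ ^ m` need not
pass to a fixed power of `E`; laziness absorbs the randomness. From `V`, using `E ≤ 2 Θ`, one has `p
μ E ≤ P^m E ≤ 2^m E Θ^m ≤ 2^(m+1) Θ^(m+1)`. -/
lemma exists_minorant_lazy_entrance [IsMarkovKernel κ] (hrec : PositiveRecurrent κ V)
    (hmin : AdmitsMinorant κ V) :
    ∃ (μ : Measure S) (ε : ℝ≥0∞) (r : ℕ), IsProbabilityMeasure μ ∧ ε ≠ 0 ∧ 1 ≤ r ∧
      ∀ x, ε • μ ≤ (lazyKernel (entranceKernel κ hV) ^ r) x := by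
  obtain ⟨p, μ, m, hp, -, hμ, -, h⟩ := (admitsMinorant_iff_pow κ V).1 hmin
  have := isMarkovKernel_entrance κ hV hrec
  set E := entranceKernel κ hV with hEdef
  have htwo : ∀ n : ℕ, (2 : ℝ≥0∞) ^ n ≠ ⊤ := fun n => ENNReal.pow_ne_top ENNReal.ofNat_ne_top
  have hμE : IsProbabilityMeasure (μ.bind E) := by
    refine ⟨?_⟩
    rw [Measure.bind_apply MeasurableSet.univ E.aemeasurable]
    simp
  have hlazy : ∀ {φ : S → ℝ≥0∞} (_ : Measurable φ) (n : ℕ) (x : S),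
      ∫⁻ y, ∫⁻ y', φ y' ∂((lazyKernel E ^ n) y) ∂(E x) ≤
        2 * ∫⁻ y, φ y ∂((lazyKernel E ^ (n + 1)) x) := by
    intro φ hφ n x
    rw [lintegral_pow_succ' _ hφ, lintegral_lazyKernel E hφ.lintegral_kernel, ← mul_assoc,
      ENNReal.mul_inv_cancel two_ne_zero ENNReal.ofNat_ne_top, one_mul]
    exact le_add_self
  refine ⟨μ.bind E, ENNReal.ofReal p / 2 ^ (m + 2), m + 2, hμE, ?_, by omega, fun x => ?_⟩
  · exact (ENNReal.div_pos (by simpa using hp) (htwo _)).ne'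
  · refine Measure.le_iff.2 fun B hB => ?_
    set φ : S → ℝ≥0∞ := B.indicator 1
    have hφ : Measurable φ := measurable_one.indicator hB
    set c := ENNReal.ofReal p * μ.bind E B with hc
    have hVle : ∀ x ∈ V, c ≤ 2 ^ (m + 1) * ∫⁻ y, φ y ∂((lazyKernel E ^ (m + 1)) x) := by
      intro x hx
      have h1 : ENNReal.ofReal p • μ ≤ (κ ^ m) x := Measure.le_iff.2 fun B hB => h x hx B hB
      have h2 : c ≤ ∫⁻ y, ∫⁻ y', φ y' ∂(E y) ∂((κ ^ m) x) := by
        refine le_trans (le_of_eq ?_) (lintegral_mono' h1 le_rfl)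
        rw [lintegral_smul_measure, hc, Measure.bind_apply hB E.aemeasurable]
        simp_rw [φ, lintegral_indicator_one hB]
        rfl
      refine h2.trans ((lintegral_pow_entrance_le κ hV m x hφ).trans ?_)
      rw [pow_succ, mul_assoc]
      gcongr
      exact hlazy hφ m x
    -- For an arbitrary initial state, one more application of `E` lands in `V` and costs another
    -- factor `2`.
    have h3 : c ≤ 2 ^ (m + 2) * ∫⁻ y, φ y ∂((lazyKernel E ^ (m + 2)) x) := by
      calc c = ∫⁻ _, c ∂(E x) := by simp
        _ ≤ ∫⁻ y, 2 ^ (m + 1) * ∫⁻ y', φ y' ∂((lazyKernel E ^ (m + 1)) y) ∂(E x) :=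
            lintegral_entrance_le κ hV hVle measurable_const (hφ.lintegral_kernel.const_mul _) x
        _ = 2 ^ (m + 1) * ∫⁻ y, ∫⁻ y', φ y' ∂((lazyKernel E ^ (m + 1)) y) ∂(E x) :=
            lintegral_const_mul _ hφ.lintegral_kernel
        _ ≤ 2 ^ (m + 1) * (2 * ∫⁻ y, φ y ∂((lazyKernel E ^ (m + 1 + 1)) x)) := by
            gcongr; exact hlazy hφ _ x
        _ = _ := by rw [← mul_assoc, ← pow_succ]
    rw [lintegral_indicator_one hB] at h3
    rw [Measure.smul_apply, smul_eq_mul, ← ENNReal.mul_div_right_comm]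
    exact ENNReal.div_le_of_le_mul (by rw [hc] at h3; rwa [mul_comm _ (2 ^ (m + 2))])

/-- The extension of a function from `V` by its expected value at the first visit to `V` plus the
expected sum of `φ` before that visit. -/
noncomputable def harmonicExtension (G φ : S → ℝ≥0∞) (x : S) : ℝ≥0∞ :=
  V.indicator G x + Vᶜ.indicator
    (fun x => ∫⁻ y, G y ∂(entranceKernel κ hV x) + ∫⁻ y, φ y ∂(greenKernel κ hV x)) x

lemma measurable_harmonicExtension {G φ : S → ℝ≥0∞} (hG : Measurable G) (hφ : Measurable φ) :
    Measurable (harmonicExtension κ hV G φ) :=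
  (hG.indicator hV).add ((hG.lintegral_kernel.add hφ.lintegral_kernel).indicator hV.compl)

lemma harmonicExtension_of_mem {G φ : S → ℝ≥0∞} {x : S} (hx : x ∈ V) :
    harmonicExtension κ hV G φ x = G x := by
  simp [harmonicExtension, hx]

lemma harmonicExtension_of_notMem {G φ : S → ℝ≥0∞} {x : S} (hx : x ∉ V) :
    harmonicExtension κ hV G φ x =
      ∫⁻ y, G y ∂(entranceKernel κ hV x) + ∫⁻ y, φ y ∂(greenKernel κ hV x) := by
  simp [harmonicExtension, hx]

/-- First-step analysis of the entrance and Green kernels, valid at every `x`. Off `V` the right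
side is the extension itself, so there is no drift beyond `-φ`; on `V` a drift inequality for `κ` is
reduced to one for the entrance kernel. -/
lemma lintegral_harmonicExtension {G φ : S → ℝ≥0∞} (hG : Measurable G) (hφ : Measurable φ)
    (x : S) : ∫⁻ y, harmonicExtension κ hV G φ y ∂(κ x) + φ x =
      ∫⁻ y, G y ∂(entranceKernel κ hV x) + ∫⁻ y, φ y ∂(greenKernel κ hV x) := by
  unfold harmonicExtension
  rw [lintegral_add_left (hG.indicator hV), lintegral_indicator hV, lintegral_indicator_compl κ hV,
    lintegral_add_left hG.lintegral_kernel, lintegral_entrance_eq κ hV hG x,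
    lintegral_green_eq κ hV hφ x]
  ring

lemma lintegral_pow_le_of_drift {U : S → ℝ≥0∞} (hU : Measurable U) [IsMarkovKernel κ] {c : ℝ≥0∞}
    (h : ∀ x, ∫⁻ y, U y ∂(κ x) ≤ U x + c) (T : ℕ) (x : S) :
    ∫⁻ y, U y ∂((κ ^ T) x) ≤ U x + T * c := by
  induction T with
  | zero => rw [lintegral_pow_zero _ hU]; simp
  | succ T ih =>
    rw [lintegral_pow_succ _ hU]
    calc ∫⁻ y, ∫⁻ y', U y' ∂(κ y) ∂((κ ^ T) x) ≤ ∫⁻ y, (U y + c) ∂((κ ^ T) x) :=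
          lintegral_mono h
      _ = ∫⁻ y, U y ∂((κ ^ T) x) + c := by
          rw [lintegral_add_left hU]; simp
      _ ≤ U x + T * c + c := by gcongr
      _ = _ := by push_cast; ring

lemma ofReal_lintegral_add_le {ν : Measure S} [IsProbabilityMeasure ν] {g : S → ℝ}
    (hg : Measurable g) {B : ℝ} (hB : ∀ x, |g x| ≤ B) :
    ∫⁻ y, ENNReal.ofReal (g y + B) ∂ν = ENNReal.ofReal (∫ y, g y ∂ν + B) := by
  rw [← ofReal_integral_eq_lintegral_ofReal]
  · rw [integral_add (integrable_of_abs_le hg hB) (integrable_const _)]; simp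
  · exact (integrable_of_abs_le hg hB).add (integrable_const _)
  · exact ae_of_all _ fun x => by have := (abs_le.1 (hB x)).1; simp only [Pi.zero_apply]; linarith

/-- Starting from `V`, the expected time to the next visit of `V` after time `T` is `o(T)`,
uniformly over the starting point. -/
theorem lintegral_meanHitting_sublinear [IsMarkovKernel κ] (hrec : PositiveRecurrent κ V)
    (hmin : AdmitsMinorant κ V) {c : ℝ} (hc : 0 < c) :
    ∃ C : ℝ≥0, ∀ T : ℕ, ∀ x ∈ V,
      ∫⁻ y, meanHitting κ hV y ∂((κ ^ T) x) ≤ C + T * ENNReal.ofReal c := by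
  have hE := isMarkovKernel_entrance κ hV hrec
  obtain ⟨μ, ε, r, hμ, hε, hr, hle⟩ := exists_minorant_lazy_entrance κ hV hrec hmin
  obtain ⟨π, hπ, -, hpot⟩ := exists_potential (entranceKernel κ hV) μ hε hr hle
  set W : ℝ≥0∞ := ⨆ z ∈ V, meanReturn κ hV z with hW
  have hWtop : W < ⊤ := ((positiveRecurrent_iff κ hV).1 hrec).2
  have hWle : ∀ x ∈ V, meanReturn κ hV x ≤ W := fun x hx => le_iSup₂_of_le x hx le_rfl
  -- `tail R x` is `𝐄_x (τ - R)⁺`. A step of the killed chain raises `R` by one, and passing from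
  -- `τ` to the excess costs only the constant `R`.
  set tail : ℕ → S → ℝ≥0∞ := fun R x => ∑' n, (tabooKernel κ hV ^ (n + R)) x Set.univ with htail
  have htm : ∀ R, Measurable (tail R) := fun R =>
    Measurable.tsum fun n => Kernel.measurable_coe _ MeasurableSet.univ
  have hw : ∀ x, meanReturn κ hV x = ∑' n, (tabooKernel κ hV ^ n) x Set.univ := fun x => by
    rw [meanReturn, greenKernel, Kernel.sum_apply' _ _ MeasurableSet.univ]
  have e : ∀ ψ : Measure S, ψ Set.univ = ∫⁻ _, 1 ∂ψ := fun ψ => by simp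
  have hone : ∀ n x, (tabooKernel κ hV ^ n) x Set.univ ≤ 1 := by
    intro n x
    induction n with
    | zero => rw [e, lintegral_pow_zero _ measurable_const]
    | succ n ih => exact (taboo_pow_succ_univ_le κ hV n x).trans ih
  have htail_le : ∀ R x, tail R x ≤ meanReturn κ hV x := fun R x => by
    rw [hw]; exact ENNReal.tsum_comp_le_tsum_of_injective (add_left_injective R) _
  have htail_anti : ∀ R x, tail (R + 1) x ≤ tail R x := fun R x =>
    ENNReal.tsum_le_tsum fun n => by
      rw [← add_assoc]; exact taboo_pow_succ_univ_le κ hV _ x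
  have hsplit : ∀ R x, meanReturn κ hV x ≤ R + tail R x := fun R x => by
    rw [hw, ← ENNReal.summable.sum_add_tsum_nat_add' (f := fun n => (tabooKernel κ hV ^ n) x Set.univ) (k := R)]
    gcongr
    exact (Finset.sum_le_sum fun n _ => hone n x).trans (by simp)
  have htail_step : ∀ R x, ∫⁻ y, tail R y ∂(tabooKernel κ hV x) = tail (R + 1) x := by
    intro R x
    simp only [htail]
    rw [lintegral_tsum fun n => (Kernel.measurable_coe _ MeasurableSet.univ).aemeasurable]
    refine tsum_congr fun n => ?_
    rw [e, ← add_assoc, lintegral_pow_succ' _ measurable_const]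
    simp
  have htend : Tendsto (fun R => ∫⁻ x, V.indicator (tail (R + 1)) x ∂π) atTop (𝓝 0) := by
    have h0 : (0 : ℝ≥0∞) = ∫⁻ _, (0 : ℝ≥0∞) ∂π := by simp
    rw [h0]
    refine tendsto_lintegral_of_dominated_convergence (fun _ => W)
      (fun R => (htm _).indicator hV) (fun R => ae_of_all _ fun x => ?_) ?_ (ae_of_all _ fun x => ?_)
    · by_cases hx : x ∈ V
      · rw [Set.indicator_of_mem hx]; exact (htail_le _ x).trans (hWle x hx)
      · simp [hx]
    · simpa using hWtop.ne
    · by_cases hx : x ∈ V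
      · simp only [Set.indicator_of_mem hx]
        have := ENNReal.tendsto_sum_nat_add (fun n => (tabooKernel κ hV ^ n) x Set.univ)
          (by rw [← hw]; exact ((hWle x hx).trans_lt hWtop).ne)
        exact this.comp (tendsto_add_atTop_nat 1)
      · simp [hx]
  -- This choice makes the mean excess of an excursion beyond `R + 1` smaller than `c` on
  -- `π`-average, so `F` below has negative mean and the entrance chain has a potential for it.
  obtain ⟨R, hR⟩ := (htend.eventually (gt_mem_nhds (ENNReal.ofReal_pos.2 hc))).exists
  set F : S → ℝ := fun x => (V.indicator (tail (R + 1)) x).toReal - c with hF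
  have hindle : ∀ x, V.indicator (tail (R + 1)) x ≤ W := by
    intro x
    by_cases hx : x ∈ V
    · rw [Set.indicator_of_mem hx]; exact (htail_le _ x).trans (hWle x hx)
    · simp [hx]
  have hFm : Measurable F := ((htm _).indicator hV).ennreal_toReal.sub_const _
  have hFb : ∀ x, |F x| ≤ W.toReal + c := by
    intro x
    have h1 := ENNReal.toReal_mono hWtop.ne (hindle x)
    have h2 : 0 ≤ (V.indicator (tail (R + 1)) x).toReal := ENNReal.toReal_nonneg
    rw [abs_le]; constructor <;> simp only [hF] <;> linarith [ENNReal.toReal_nonneg (a := W)]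
  have hFneg : ∫ x, F x ∂π < 0 := by
    have hi : Integrable (fun x => (V.indicator (tail (R + 1)) x).toReal) π :=
      integrable_of_abs_le ((htm _).indicator hV).ennreal_toReal (K := W.toReal) fun x => by
        rw [abs_of_nonneg ENNReal.toReal_nonneg]; exact ENNReal.toReal_mono hWtop.ne (hindle x)
    rw [hF, integral_sub hi (integrable_const _), integral_toReal ((htm _).indicator hV).aemeasurable
      (ae_of_all _ fun x => (hindle x).trans_lt hWtop)]
    have := (ENNReal.toReal_lt_toReal hR.ne_top ENNReal.ofReal_ne_top).2 hR
    rw [ENNReal.toReal_ofReal hc.le] at this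
    simp; linarith
  obtain ⟨g, hgm, ⟨B, hgB⟩, hg⟩ := hpot F hFm ⟨_, hFb⟩ hFneg
  set G : S → ℝ≥0∞ := fun x => ENNReal.ofReal (g x + B) with hG
  have hGm : Measurable G := (hgm.add_const _).ennreal_ofReal
  have hGV : ∀ x ∈ V, ∫⁻ y, G y ∂(entranceKernel κ hV x) + tail (R + 1) x ≤
      G x + ENNReal.ofReal c := by
    intro x hx
    have h1 := hg x
    have h2 : tail (R + 1) x = ENNReal.ofReal (F x + c) := by
      simp only [hF, Set.indicator_of_mem hx, sub_add_cancel]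
      exact (ENNReal.ofReal_toReal (((htail_le _ x).trans (hWle x hx)).trans_lt hWtop).ne).symm
    have h3 : 0 ≤ F x + c := by simp only [hF, sub_add_cancel]; exact ENNReal.toReal_nonneg
    have h4 := abs_le.1 (hgB x)
    have h5 := abs_le.1 (abs_integral_le (ν := entranceKernel κ hV x) hgB)
    rw [h2, ofReal_lintegral_add_le hgm hgB, ← ENNReal.ofReal_add (by linarith) h3,
      ← ENNReal.ofReal_add (by linarith) hc.le]
    exact ENNReal.ofReal_le_ofReal (by linarith)
  -- `U` has drift at most `c`: off `V` neither term increases in mean, and on `V` the newly created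
  -- excess `tail (R + 1)` is compensated by the potential up to `c`.
  set U : S → ℝ≥0∞ := fun x => Vᶜ.indicator (tail R) x + harmonicExtension κ hV G 0 x with hU
  have hhm := measurable_harmonicExtension κ hV hGm (measurable_zero (α := ℝ≥0∞) (β := S))
  have hUm : Measurable U := ((htm R).indicator hV.compl).add hhm
  have hdrift : ∀ x, ∫⁻ y, U y ∂(κ x) ≤ U x + ENNReal.ofReal c := by
    intro x
    have h1 := lintegral_harmonicExtension κ hV hGm (measurable_zero (α := ℝ≥0∞) (β := S)) x
    simp only [Pi.zero_apply, add_zero, lintegral_zero] at h1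
    simp only [hU]
    rw [lintegral_add_right _ hhm, lintegral_indicator_compl κ hV, htail_step, h1]
    by_cases hx : x ∈ V
    · rw [harmonicExtension_of_mem κ hV hx, Set.indicator_of_notMem (by simpa using hx), zero_add,
        add_comm]
      exact hGV x hx
    · rw [harmonicExtension_of_notMem κ hV hx, Set.indicator_of_mem (by simpa using hx)]
      simp only [Pi.zero_apply, lintegral_zero, add_zero]
      refine le_trans ?_ le_self_add
      gcongr
      exact htail_anti R x
  refine ⟨R + (B + B).toNNReal, fun T x hx => ?_⟩
  calc ∫⁻ y, meanHitting κ hV y ∂((κ ^ T) x) ≤ ∫⁻ y, (R + U y) ∂((κ ^ T) x) := by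
        refine lintegral_mono fun y => ?_
        unfold meanHitting
        by_cases hy : y ∈ V
        · simp [hy]
        · rw [Set.indicator_of_mem (by simpa using hy)]
          refine (hsplit R y).trans ?_
          simp only [hU]
          rw [Set.indicator_of_mem (by simpa using hy), ← add_assoc]
          exact le_self_add
    _ = R + ∫⁻ y, U y ∂((κ ^ T) x) := by rw [lintegral_add_left measurable_const]; simp
    _ ≤ R + (U x + T * ENNReal.ofReal c) := by
        gcongr; exact lintegral_pow_le_of_drift κ hUm hdrift T x
    _ ≤ R + (ENNReal.ofReal (B + B) + T * ENNReal.ofReal c) := by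
        gcongr
        simp only [hU]
        rw [harmonicExtension_of_mem κ hV hx, Set.indicator_of_notMem (by simpa using hx), zero_add]
        exact ENNReal.ofReal_le_ofReal (by linarith [(abs_le.1 (hgB x)).2])
    _ = _ := by
        rw [← add_assoc]; push_cast; rfl

end Recurrent

end MarkovStability

namespace MarkovStability

/-! ### The stationary distribution and the linear decrease of additive functionals -/

section Stationary

variable {S : Type u} [MeasurableSpace S]

lemma ofReal_integral_add_const {ν : Measure S} [IsProbabilityMeasure ν] {f : S → ℝ}
    (hf : Measurable f) {K : ℝ} (hK : ∀ x, |f x| ≤ K) {b : ℝ} (hb : K ≤ b) :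
    ∫⁻ y, ENNReal.ofReal (f y + b) ∂ν = ENNReal.ofReal (∫ y, f y ∂ν + b) := by
  have := ofReal_lintegral_add_le (ν := ν) hf (B := b) fun x => (hK x).trans hb
  exact this

/-- A positive recurrent chain with a minorized recurrent set `V` has a stationary distribution `π`
such that the sums of expectations of any bounded function of negative `π`-mean
decrease linearly, uniformly over initial states in `V`. -/
theorem exists_invariant_sum_le [Nonempty S] (κ : Kernel S S) [IsMarkovKernel κ] {V : Set S}
    (hV : MeasurableSet V) (hrec : PositiveRecurrent κ V) (hmin : AdmitsMinorant κ V) :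
    ∃ π : Measure S, IsProbabilityMeasure π ∧ κ.Invariant π ∧
      ∀ f : S → ℝ, Measurable f → (∃ K, ∀ x, |f x| ≤ K) → ∫ x, f x ∂π < 0 →
        ∃ δ C : ℝ, 0 < δ ∧ ∀ T : ℕ, ∀ x ∈ V,
          ∑ t ∈ Finset.range T, ∫ y, f y ∂((κ ^ t) x) ≤ C - δ * T := by
  have hE := isMarkovKernel_entrance κ hV hrec
  obtain ⟨μ, ε, r, hμ, hε, hr, hle⟩ := exists_minorant_lazy_entrance κ hV hrec hmin
  obtain ⟨ρ, hρ, hρinv, hpot⟩ := exists_potential (entranceKernel κ hV) μ hε hr hle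
  set W : ℝ≥0∞ := ⨆ z ∈ V, meanReturn κ hV z with hW
  have hWtop : W < ⊤ := ((positiveRecurrent_iff κ hV).1 hrec).2
  have hWle : ∀ x ∈ V, meanReturn κ hV x ≤ W := fun x hx => le_iSup₂_of_le x hx le_rfl
  have hρV : ∀ᵐ x ∂ρ, x ∈ V := by
    rw [ae_iff]
    change ρ Vᶜ = 0
    rw [← hρinv.def, Measure.bind_apply hV.compl (Kernel.aemeasurable _)]
    simp [entrance_compl]
  have hHm : ∀ {φ : S → ℝ≥0∞}, Measurable φ →
      ∫⁻ x, φ x ∂(ρ.bind (greenKernel κ hV)) = ∫⁻ x, ∫⁻ y, φ y ∂(greenKernel κ hV x) ∂ρ :=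
    fun hφ => Measure.lintegral_bind (Kernel.aemeasurable _) hφ.aemeasurable
  set w : ℝ≥0∞ := ∫⁻ x, meanReturn κ hV x ∂ρ with hw
  have hmass : ρ.bind (greenKernel κ hV) Set.univ = w :=
    Measure.bind_apply MeasurableSet.univ (Kernel.aemeasurable _)
  have hwtop : w ≠ ⊤ := by
    have : w ≤ ∫⁻ _, W ∂ρ := lintegral_mono_ae (hρV.mono fun x hx => hWle x hx)
    exact ne_top_of_le_ne_top hWtop.ne (by simpa using this)
  have hw0 : w ≠ 0 := by
    have : ∫⁻ _, 1 ∂ρ ≤ w := lintegral_mono fun x => by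
      rw [meanReturn_eq]; exact le_self_add
    intro h0
    rw [h0] at this
    simp at this
  -- The normalized occupation measure of an excursion started from `ρ`. With `H` the Green kernel,
  -- invariance follows from `H P + 1 = H + E` and `ρ E = ρ`.
  refine ⟨w⁻¹ • ρ.bind (greenKernel κ hV), ⟨?_⟩, ?_, ?_⟩
  · rw [Measure.smul_apply, hmass, smul_eq_mul, ENNReal.inv_mul_cancel hw0 hwtop]
  · unfold Kernel.Invariant
    rw [Measure.comp_smul]
    congr 1
    ext B hB
    have hm : Measurable (B.indicator (1 : S → ℝ≥0∞)) := measurable_one.indicator hB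
    have h1 : ∫⁻ x, (∫⁻ y, ∫⁻ y', B.indicator 1 y' ∂(κ y) ∂(greenKernel κ hV x) +
        B.indicator (1 : S → ℝ≥0∞) x) ∂ρ =
        ∫⁻ x, (∫⁻ y, B.indicator 1 y ∂(greenKernel κ hV x) +
          ∫⁻ y, B.indicator 1 y ∂(entranceKernel κ hV x)) ∂ρ :=
      lintegral_congr fun x => lintegral_green_comp κ hV hm x
    rw [lintegral_add_right _ hm, lintegral_add_right _ hm.lintegral_kernel,
      lintegral_invariant hρinv hm, ← hHm hm, ← hHm hm.lintegral_kernel] at h1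
    simp_rw [lintegral_indicator_one hB] at h1
    rw [Measure.bind_apply hB κ.aemeasurable]
    exact (ENNReal.add_left_inj (measure_ne_top _ _)).1 h1
  · rintro f hf ⟨K, hK⟩ hneg
    set π : Measure S := w⁻¹ • ρ.bind (greenKernel κ hV) with hπ
    have hπp : IsProbabilityMeasure π := ⟨by
      rw [hπ, Measure.smul_apply, hmass, smul_eq_mul, ENNReal.inv_mul_cancel hw0 hwtop]⟩
    have hK0 : 0 ≤ K := (abs_nonneg _).trans (hK (Classical.arbitrary S))
    set δ := -(∫ x, f x ∂π) / 2 with hδ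
    have hδ0 : 0 < δ := by simp only [hδ]; linarith
    -- The shift makes `φ` non-negative, with `π`-mean `K - δ < a = K`. Hence over an excursion from
    -- `ρ` the mean sum of `φ` is less than `a` times the mean length, which is the negative mean of
    -- `F` below.
    set φ : S → ℝ≥0∞ := fun x => ENNReal.ofReal (f x + (K + δ)) with hφ
    have hφm : Measurable φ := (hf.add_const _).ennreal_ofReal
    set a := ENNReal.ofReal K with ha
    have hat : a ≠ ⊤ := ENNReal.ofReal_ne_top
    set H : S → ℝ≥0∞ := fun x => ∫⁻ y, φ y ∂(greenKernel κ hV x) with hH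
    have hHmeas : Measurable H := hφm.lintegral_kernel
    have hwm := measurable_meanReturn κ hV
    have hlt : ∫⁻ x, H x ∂ρ < a * w := by
      have h1 : ∫⁻ x, φ x ∂π = ENNReal.ofReal (∫ x, f x ∂π + (K + δ)) :=
        ofReal_integral_add_const hf hK (by linarith)
      have hKδ : 0 < K := by
        have := abs_le.1 (abs_integral_le (ν := π) hK)
        linarith
      have h2 : ENNReal.ofReal (∫ x, f x ∂π + (K + δ)) < a :=
        (ENNReal.ofReal_lt_ofReal_iff hKδ).2 (by simp only [hδ]; linarith)
      rw [← h1, hπ, lintegral_smul_measure, hHm hφm, smul_eq_mul] at h2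
      calc ∫⁻ x, H x ∂ρ = w * (w⁻¹ * ∫⁻ x, H x ∂ρ) := by
            rw [← mul_assoc, ENNReal.mul_inv_cancel hw0 hwtop, one_mul]
        _ < w * a := (ENNReal.mul_lt_mul_iff_right hw0 hwtop).2 h2
        _ = a * w := mul_comm _ _
    have hHle : ∀ x ∈ V, H x ≤ ENNReal.ofReal (K + (K + δ)) * W := by
      intro x hx
      calc H x ≤ ∫⁻ _, ENNReal.ofReal (K + (K + δ)) ∂(greenKernel κ hV x) := by
            refine lintegral_mono fun y => ENNReal.ofReal_le_ofReal ?_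
            linarith [(abs_le.1 (hK y)).2]
        _ = ENNReal.ofReal (K + (K + δ)) * meanReturn κ hV x := by
            rw [lintegral_const]; rfl
        _ ≤ _ := by gcongr; exact hWle x hx
    have hHtop : ENNReal.ofReal (K + (K + δ)) * W ≠ ⊤ :=
      ENNReal.mul_ne_top ENNReal.ofReal_ne_top hWtop.ne
    set F : S → ℝ := fun x => (V.indicator H x).toReal - (V.indicator (fun x => a * meanReturn κ hV x) x).toReal with hF
    have hi1 : ∀ x, V.indicator H x ≤ ENNReal.ofReal (K + (K + δ)) * W := fun x => by
      by_cases hx : x ∈ V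
      · rw [Set.indicator_of_mem hx]; exact hHle x hx
      · simp [hx]
    have hi2 : ∀ x, V.indicator (fun x => a * meanReturn κ hV x) x ≤ a * W := fun x => by
      by_cases hx : x ∈ V
      · rw [Set.indicator_of_mem hx]; gcongr; exact hWle x hx
      · simp [hx]
    have haW : a * W ≠ ⊤ := ENNReal.mul_ne_top hat hWtop.ne
    have hm1 : Measurable (V.indicator H) := hHmeas.indicator hV
    have hm2 : Measurable (V.indicator fun x => a * meanReturn κ hV x) :=
      (hwm.const_mul a).indicator hV
    have hb1 : ∀ x, |(V.indicator H x).toReal| ≤ (ENNReal.ofReal (K + (K + δ)) * W).toReal :=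
      fun x => by
        rw [abs_of_nonneg ENNReal.toReal_nonneg]; exact ENNReal.toReal_mono hHtop (hi1 x)
    have hb2 : ∀ x, |(V.indicator (fun x => a * meanReturn κ hV x) x).toReal| ≤ (a * W).toReal :=
      fun x => by
        rw [abs_of_nonneg ENNReal.toReal_nonneg]; exact ENNReal.toReal_mono haW (hi2 x)
    have hFm : Measurable F := hm1.ennreal_toReal.sub hm2.ennreal_toReal
    have hFneg : ∫ x, F x ∂ρ < 0 := by
      rw [hF, integral_sub (integrable_of_abs_le hm1.ennreal_toReal hb1)
        (integrable_of_abs_le hm2.ennreal_toReal hb2),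
        integral_toReal hm1.aemeasurable (ae_of_all _ fun x => (hi1 x).trans_lt hHtop.lt_top),
        integral_toReal hm2.aemeasurable (ae_of_all _ fun x => (hi2 x).trans_lt haW.lt_top)]
      have e1 : ∫⁻ x, V.indicator H x ∂ρ = ∫⁻ x, H x ∂ρ :=
        lintegral_congr_ae (hρV.mono fun x hx => Set.indicator_of_mem hx _)
      have e2 : ∫⁻ x, V.indicator (fun x => a * meanReturn κ hV x) x ∂ρ = a * w := by
        rw [hw, ← lintegral_const_mul _ hwm]
        exact lintegral_congr_ae (hρV.mono fun x hx => Set.indicator_of_mem hx _)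
      rw [e1, e2]
      have := (ENNReal.toReal_lt_toReal hlt.ne_top (ENNReal.mul_ne_top hat hwtop)).2 hlt
      linarith
    obtain ⟨g, hgm, ⟨B, hgB⟩, hg⟩ := hpot F hFm
      ⟨_, fun x => (abs_sub _ _).trans (add_le_add (hb1 x) (hb2 x))⟩ hFneg
    set G : S → ℝ≥0∞ := fun x => ENNReal.ofReal (g x + B) with hG
    have hGm : Measurable G := (hgm.add_const _).ennreal_ofReal
    have hGV : ∀ x ∈ V, ∫⁻ y, G y ∂(entranceKernel κ hV x) + H x ≤
        G x + a * meanReturn κ hV x := by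
      intro x hx
      have h1 := hg x
      have h2 : H x = ENNReal.ofReal (H x).toReal :=
        (ENNReal.ofReal_toReal ((hHle x hx).trans_lt hHtop.lt_top).ne).symm
      have h3 : a * meanReturn κ hV x = ENNReal.ofReal (a * meanReturn κ hV x).toReal :=
        (ENNReal.ofReal_toReal (ENNReal.mul_ne_top hat ((hWle x hx).trans_lt hWtop).ne)).symm
      have h4 := abs_le.1 (hgB x)
      have h5 := abs_le.1 (abs_integral_le (ν := entranceKernel κ hV x) hgB)
      simp only [hF, Set.indicator_of_mem hx] at h1
      rw [h2, h3, ofReal_lintegral_add_le hgm hgB,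
        ← ENNReal.ofReal_add (by linarith) ENNReal.toReal_nonneg,
        ← ENNReal.ofReal_add (by linarith) ENNReal.toReal_nonneg]
      exact ENNReal.ofReal_le_ofReal (by linarith)
    set Gt := harmonicExtension κ hV G φ with hGt
    have hGtm : Measurable Gt := measurable_harmonicExtension κ hV hGm hφm
    have hhm := measurable_meanHitting κ hV
    -- `A` spreads the cost `a * meanReturn`, charged once per excursion, over the steps: `a + P A =
    -- a * meanReturn`, and `A` vanishes on `V`.
    set A : S → ℝ≥0∞ := fun x => a * meanHitting κ hV x with hA
    have hAm : Measurable A := hhm.const_mul a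
    have hdrift : ∀ x, φ x + ∫⁻ y, Gt y ∂(κ x) + A x ≤ Gt x + a + ∫⁻ y, A y ∂(κ x) := by
      intro x
      have h1 := lintegral_harmonicExtension κ hV hGm hφm x
      have h2 : a + ∫⁻ y, A y ∂(κ x) = a * meanReturn κ hV x := by
        simp only [hA]
        rw [lintegral_const_mul _ hhm, ← one_add_lintegral_meanHitting, mul_add, mul_one]
      rw [add_comm (φ x), h1, add_assoc (Gt x), h2]
      by_cases hx : x ∈ V
      · have h3 : A x = 0 := by simp [hA, meanHitting, hx]
        rw [h3, add_zero, hGt, harmonicExtension_of_mem κ hV hx]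
        exact hGV x hx
      · have h3 : A x = a * meanReturn κ hV x := by simp [hA, meanHitting, hx]
        rw [h3, hGt, harmonicExtension_of_notMem κ hV hx]
    -- The leftover term of the telescoping is `P^T A`. Since `K * (δ / (2 (K + 1))) ≤ δ / 2`, it
    -- consumes at most half of the gain `δ` per step.
    obtain ⟨C, hC⟩ := lintegral_meanHitting_sublinear κ hV hrec hmin
      (c := δ / (2 * (K + 1))) (by positivity)
    have hAtop : ∀ x ∈ V, ∀ T : ℕ, ∫⁻ y, A y ∂((κ ^ T) x) ≠ ⊤ := by
      intro x hx T
      simp only [hA]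
      rw [lintegral_const_mul _ hhm]
      refine ENNReal.mul_ne_top hat (ne_top_of_le_ne_top ?_ (hC T x hx))
      exact ENNReal.add_ne_top.2 ⟨ENNReal.coe_ne_top,
        ENNReal.mul_ne_top (ENNReal.natCast_ne_top T) ENNReal.ofReal_ne_top⟩
    have htel : ∀ x ∈ V, ∀ T : ℕ, ∑ t ∈ Finset.range T, ∫⁻ y, φ y ∂((κ ^ t) x) +
        ∫⁻ y, Gt y ∂((κ ^ T) x) ≤ G x + T * a + ∫⁻ y, A y ∂((κ ^ T) x) := by
      intro x hx T
      induction T with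
      | zero =>
        rw [lintegral_pow_zero _ hGtm, hGt, harmonicExtension_of_mem κ hV hx]
        simp
      | succ T ih =>
        have h1 : ∫⁻ y, φ y ∂((κ ^ T) x) + ∫⁻ y, Gt y ∂((κ ^ (T + 1)) x) +
            ∫⁻ y, A y ∂((κ ^ T) x) ≤
            ∫⁻ y, Gt y ∂((κ ^ T) x) + a + ∫⁻ y, A y ∂((κ ^ (T + 1)) x) := by
          have h2 := lintegral_mono (μ := (κ ^ T) x) hdrift
          rw [lintegral_add_right _ hAm, lintegral_add_left hφm,
            lintegral_add_right _ hAm.lintegral_kernel, lintegral_add_right _ measurable_const,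
            ← lintegral_pow_succ _ hGtm, ← lintegral_pow_succ _ hAm] at h2
          simpa using h2
        rw [Finset.sum_range_succ]
        -- Cancelling `P^T A` in `ℝ≥0∞` requires it to be finite, which the sublinear bound
        -- guarantees from `x ∈ V`.
        refine (ENNReal.add_le_add_iff_right (hAtop x hx T)).1 ?_
        calc _ = ∑ t ∈ Finset.range T, ∫⁻ y, φ y ∂((κ ^ t) x) +
              (∫⁻ y, φ y ∂((κ ^ T) x) + ∫⁻ y, Gt y ∂((κ ^ (T + 1)) x) +
              ∫⁻ y, A y ∂((κ ^ T) x)) := by ring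
          _ ≤ ∑ t ∈ Finset.range T, ∫⁻ y, φ y ∂((κ ^ t) x) +
              (∫⁻ y, Gt y ∂((κ ^ T) x) + a + ∫⁻ y, A y ∂((κ ^ (T + 1)) x)) := by gcongr
          _ = (∑ t ∈ Finset.range T, ∫⁻ y, φ y ∂((κ ^ t) x) +
              ∫⁻ y, Gt y ∂((κ ^ T) x)) + (a + ∫⁻ y, A y ∂((κ ^ (T + 1)) x)) := by ring
          _ ≤ (G x + T * a + ∫⁻ y, A y ∂((κ ^ T) x)) +
              (a + ∫⁻ y, A y ∂((κ ^ (T + 1)) x)) := by gcongr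
          _ = _ := by push_cast; ring
    refine ⟨δ / 2, B + B + K * C, by linarith, fun T x hx => ?_⟩
    have hB0 : 0 ≤ B := (abs_nonneg _).trans (hgB x)
    have h1 : ∑ t ∈ Finset.range T, ∫⁻ y, φ y ∂((κ ^ t) x) ≤
        ENNReal.ofReal (B + B + T * K + K * (C + T * (δ / (2 * (K + 1))))) := by
      calc _ ≤ _ := le_self_add
        _ ≤ _ := htel x hx T
        _ ≤ ENNReal.ofReal (B + B) + ENNReal.ofReal (T * K) +
            ENNReal.ofReal (K * (C + T * (δ / (2 * (K + 1))))) := by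
          gcongr
          · exact ENNReal.ofReal_le_ofReal (by linarith [(abs_le.1 (hgB x)).2])
          · rw [ENNReal.ofReal_mul (by positivity), ENNReal.ofReal_natCast]
          · simp only [hA]
            rw [lintegral_const_mul _ hhm, ENNReal.ofReal_mul hK0,
              ENNReal.ofReal_add (by positivity) (by positivity),
              ENNReal.ofReal_mul (by positivity), ENNReal.ofReal_natCast, ENNReal.ofReal_coe_nnreal]
            gcongr
            exact hC T x hx
        _ = _ := by
          rw [← ENNReal.ofReal_add (p := B + B) (by positivity) (by positivity),
            ← ENNReal.ofReal_add (by positivity) (by positivity)]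
    have h2 : ∑ t ∈ Finset.range T, ∫⁻ y, φ y ∂((κ ^ t) x) =
        ENNReal.ofReal (∑ t ∈ Finset.range T, (∫ y, f y ∂((κ ^ t) x) + (K + δ))) := by
      rw [ENNReal.ofReal_sum_of_nonneg]
      · exact Finset.sum_congr rfl fun t _ => ofReal_integral_add_const hf hK (by linarith)
      · intro t _
        have := abs_le.1 (abs_integral_le (ν := (κ ^ t) x) hK)
        linarith
    rw [h2, ENNReal.ofReal_le_ofReal_iff (by positivity), Finset.sum_add_distrib] at h1
    simp only [Finset.sum_const, Finset.card_range, nsmul_eq_mul] at h1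
    have h3 : K * (T * (δ / (2 * (K + 1)))) ≤ T * (δ / 2) := by
      have : K * (δ / (2 * (K + 1))) ≤ δ / 2 := by
        rw [← mul_div_assoc, div_le_div_iff₀ (by positivity) (by positivity)]
        nlinarith
      calc K * (T * (δ / (2 * (K + 1)))) = T * (K * (δ / (2 * (K + 1)))) := by ring
        _ ≤ _ := by gcongr
    nlinarith

end Stationary

end MarkovStability

namespace MarkovStability

/-! ### Chains with an autonomous component -/

section Drift

variable {S : Type u} [MeasurableSpace S]

lemma lintegral_abs_sub_pow_le (κ : Kernel S S) [IsMarkovKernel κ] {l : S → ℝ}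
    (hl : Measurable l) {U : ℝ≥0∞}
    (h : ∀ z, ∫⁻ z', ENNReal.ofReal |l z' - l z| ∂(κ z) ≤ U) (t : ℕ) (z : S) :
    ∫⁻ z', ENNReal.ofReal |l z' - l z| ∂((κ ^ t) z) ≤ t * U := by
  have hm : ∀ a, Measurable fun z' => ENNReal.ofReal |l z' - a| := fun a => by fun_prop
  have := lintegral_pow_le_of_drift κ (hm (l z)) (c := U) (fun x => ?_) t z
  · simpa using this
  · calc ∫⁻ y, ENNReal.ofReal |l y - l z| ∂(κ x)
        ≤ ∫⁻ y, (ENNReal.ofReal |l x - l z| + ENNReal.ofReal |l y - l x|) ∂(κ x) := by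
          refine lintegral_mono fun y => ?_
          rw [← ENNReal.ofReal_add (abs_nonneg _) (abs_nonneg _)]
          refine ENNReal.ofReal_le_ofReal ?_
          rw [add_comm]
          exact abs_sub_le _ _ _
      _ ≤ _ := by
          rw [lintegral_add_left measurable_const]
          simp only [lintegral_const, measure_univ, mul_one]
          gcongr
          exact h x

lemma integrable_sub_pow (κ : Kernel S S) [IsMarkovKernel κ] {l : S → ℝ}
    (hl : Measurable l) {U : ℝ≥0}
    (h : ∀ z, ∫⁻ z', ENNReal.ofReal |l z' - l z| ∂(κ z) ≤ U) (t : ℕ) (z : S) :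
    Integrable (fun z' => l z' - l z) ((κ ^ t) z) := by
  refine ⟨(hl.sub_const _).aestronglyMeasurable, ?_⟩
  rw [hasFiniteIntegral_iff_norm]
  simp only [Real.norm_eq_abs]
  refine (lintegral_abs_sub_pow_le κ hl h t z).trans_lt ?_
  exact ENNReal.mul_lt_top (ENNReal.natCast_lt_top t) ENNReal.coe_lt_top

lemma integrable_pow (κ : Kernel S S) [IsMarkovKernel κ] {l : S → ℝ}
    (hl : Measurable l) {U : ℝ≥0}
    (h : ∀ z, ∫⁻ z', ENNReal.ofReal |l z' - l z| ∂(κ z) ≤ U) (t : ℕ) (z : S) :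
    Integrable l ((κ ^ t) z) := by
  refine ((integrable_sub_pow κ hl h t z).add (integrable_const (l z))).congr
    (ae_of_all _ fun x => ?_)
  simp

lemma integral_abs_sub_pow_le (κ : Kernel S S) [IsMarkovKernel κ] {l : S → ℝ}
    (hl : Measurable l) {U : ℝ≥0}
    (h : ∀ z, ∫⁻ z', ENNReal.ofReal |l z' - l z| ∂(κ z) ≤ U) (t : ℕ) (z : S) :
    ∫ z', |l z' - l z| ∂((κ ^ t) z) ≤ t * U := by
  rw [integral_eq_lintegral_of_nonneg_ae (ae_of_all _ fun _ => abs_nonneg _)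
    ((hl.sub_const _).abs.aestronglyMeasurable)]
  refine ENNReal.toReal_le_of_le_ofReal (by positivity) ?_
  rw [ENNReal.ofReal_mul (by positivity), ENNReal.ofReal_natCast, ENNReal.ofReal_coe_nnreal]
  exact lintegral_abs_sub_pow_le κ hl h t z

/-- Dynkin's inequality. -/
lemma integral_pow_le_of_drift (κ : Kernel S S) [IsMarkovKernel κ] {l a : S → ℝ} (z : S)
    (hint : ∀ t : ℕ, Integrable l ((κ ^ t) z)) (hl : Measurable l)
    (ha : ∀ t : ℕ, Integrable a ((κ ^ t) z)) (h : ∀ x, ∫ y, l y ∂(κ x) ≤ l x + a x) (T : ℕ) :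
    ∫ y, l y ∂((κ ^ T) z) ≤ l z + ∑ t ∈ Finset.range T, ∫ y, a y ∂((κ ^ t) z) := by
  induction T with
  | zero => rw [integral_pow_zero _ hl]; simp
  | succ T ih =>
    rw [integral_pow_succ _ _ _ (hint _), Finset.sum_range_succ]
    have h1 : Integrable (fun x => ∫ y, l y ∂(κ x)) ((κ ^ T) z) := by
      have := hint (T + 1)
      rw [pow_succ'] at this
      exact this.integral_comp
    have h2 := integral_mono h1 ((hint T).add (ha T)) h
    simp only [Pi.add_apply] at h2
    rw [integral_add (hint T) (ha T)] at h2
    linarith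

end Drift

/-! ### Passing between the pair and its autonomous first component -/

section Autonomous

variable {X : Type u} {Y : Type v} [MeasurableSpace X] [MeasurableSpace Y]

lemma map_fst_of_autonomous {κ : Kernel (X × Y) (X × Y)} {κX : Kernel X X}
    (hA : Autonomous κ κX) (z : X × Y) : (κ z).map Prod.fst = κX z.1 := by
  ext B hB
  rw [Measure.map_apply measurable_fst hB]
  exact hA z.1 z.2 B hB

lemma map_fst_pow_of_autonomous {κ : Kernel (X × Y) (X × Y)} {κX : Kernel X X}
    (hA : Autonomous κ κX) (t : ℕ) (z : X × Y) : ((κ ^ t) z).map Prod.fst = (κX ^ t) z.1 := by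
  induction t generalizing z with
  | zero =>
    rw [pow_zero, pow_zero]
    exact Measure.map_dirac' measurable_fst z
  | succ t ih =>
    ext B hB
    have hm : Measurable (B.indicator (1 : X → ℝ≥0∞)) := measurable_one.indicator hB
    have hm' : Measurable fun z : X × Y => B.indicator (1 : X → ℝ≥0∞) z.1 := hm.comp measurable_fst
    rw [← lintegral_indicator_one hB, ← lintegral_indicator_one hB,
      lintegral_map hm measurable_fst,
      lintegral_pow_succ' _ hm', lintegral_pow_succ' _ hm,
      ← map_fst_of_autonomous hA z, lintegral_map hm.lintegral_kernel measurable_fst]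
    refine lintegral_congr fun z' => ?_
    rw [← ih z', lintegral_map hm measurable_fst]

lemma lintegral_fst_pow {κ : Kernel (X × Y) (X × Y)} {κX : Kernel X X}
    (hA : Autonomous κ κX) (t : ℕ) (z : X × Y) {φ : X → ℝ≥0∞} (hφ : Measurable φ) :
    ∫⁻ z', φ z'.1 ∂((κ ^ t) z) = ∫⁻ x, φ x ∂((κX ^ t) z.1) := by
  rw [← map_fst_pow_of_autonomous hA, lintegral_map hφ measurable_fst]

lemma integral_fst_pow {κ : Kernel (X × Y) (X × Y)} {κX : Kernel X X}
    (hA : Autonomous κ κX) (t : ℕ) (z : X × Y) {f : X → ℝ} (hf : Measurable f) :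
    ∫ z', f z'.1 ∂((κ ^ t) z) = ∫ x, f x ∂((κX ^ t) z.1) := by
  rw [← map_fst_pow_of_autonomous hA, integral_map measurable_fst.aemeasurable
    hf.aestronglyMeasurable]

/-- Killing on entering `V × Y` depends on the first coordinate only, so the pair survives with the
same probabilities as `X`. -/
lemma autonomous_taboo {κ : Kernel (X × Y) (X × Y)} {κX : Kernel X X}
    (hA : Autonomous κ κX) {V : Set X} (hV : MeasurableSet V) :
    Autonomous (tabooKernel κ (measurable_fst hV : MeasurableSet {z : X × Y | z.1 ∈ V}))
      (tabooKernel κX hV) := by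
  intro x y B hB
  have hB' : MeasurableSet {z : X × Y | z.1 ∈ B} := measurable_fst hB
  unfold tabooKernel
  rw [Kernel.restrict_apply' _ _ _ hB', Kernel.restrict_apply' _ _ _ hB]
  exact hA x y (B ∩ Vᶜ) (hB.inter hV.compl)

lemma tendsto_taboo_fst {κ : Kernel (X × Y) (X × Y)} {κX : Kernel X X} [IsMarkovKernel κX]
    (hA : Autonomous κ κX) {V : Set X} (hV : MeasurableSet V) (hrec : PositiveRecurrent κX V)
    (z : X × Y) :
    Tendsto (fun n => (tabooKernel κ
      (measurable_fst hV : MeasurableSet {z : X × Y | z.1 ∈ V}) ^ n) z Set.univ) atTop (𝓝 0) := by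
  refine (((positiveRecurrent_iff κX hV).1 hrec).1 z.1).congr fun n => ?_
  rw [← map_fst_pow_of_autonomous (autonomous_taboo hA hV) n z,
    Measure.map_apply measurable_fst MeasurableSet.univ, Set.preimage_univ]

/-- The drift of a large component over a fixed time. -/
lemma integral_sub_le_of_large {κ : Kernel (X × Y) (X × Y)} [IsMarkovKernel κ] {κX : Kernel X X}
    (hA : Autonomous κ κX) {l : X × Y → ℝ} (hl : Measurable l) (hl0 : ∀ z, 0 ≤ l z) {U : ℝ≥0}
    (hU : ∀ z, ∫⁻ z', ENNReal.ofReal |l z' - l z| ∂(κ z) ≤ U) {h : ℝ → ℝ}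
    (hh : DecreasesToZero h) {f : X → ℝ} (hf : Measurable f) {K : ℝ} (hK : ∀ x, |f x| ≤ K)
    (hdrift : ∀ z, ∫ z', (l z' - l z) ∂(κ z) ≤ f z.1 + h (l z)) {a : ℝ} (ha : 0 < a)
    {z : X × Y} (hz : 2 * a ≤ l z) (T : ℕ) :
    ∫ z', l z' ∂((κ ^ T) z) - l z ≤ ∑ t ∈ Finset.range T, ∫ x, f x ∂((κX ^ t) z.1) +
      T * (h a + h 0 * (T * U) / a) := by
  have hint := integrable_pow κ hl hU
  have hint1 : ∀ x, Integrable l (κ x) := fun x => by simpa using hint 1 x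
  have hfi : ∀ (ν : Measure (X × Y)) [IsFiniteMeasure ν], Integrable (fun z => f z.1) ν :=
    fun ν _ => integrable_of_abs_le (hf.comp measurable_fst) fun z => hK z.1
  have habs : ∀ t : ℕ, Integrable (fun z' => h 0 * |l z' - l z| / a) ((κ ^ t) z) := fun t =>
    ((integrable_sub_pow κ hl hU t z).abs.const_mul _).div_const _
  have h0 : 0 ≤ h 0 := hh.1 0 le_rfl
  set b : X × Y → ℝ := fun z' => f z'.1 + h a + h 0 * |l z' - l z| / a with hb
  have hbi : ∀ t : ℕ, Integrable b ((κ ^ t) z) := fun t =>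
    ((hfi _).add (integrable_const _)).add (habs t)
  have hdr : ∀ x, ∫ y, l y ∂(κ x) ≤ l x + b x := by
    intro x
    have h1 := hdrift x
    rw [integral_sub (hint1 x) (integrable_const _)] at h1
    simp only [integral_const, probReal_univ, smul_eq_mul, one_mul] at h1
    -- Either the level is still at least `a`, or it has fallen by at least `a` from `l z ≥ 2 a`,
    -- and then the factor `|l x - l z| / a ≥ 1` pays for `h 0`. The bound is affine in the
    -- displacement, whose mean after `t` steps is at most `t U`.
    have h2 : h (l x) ≤ h a + h 0 * |l x - l z| / a := by
      rcases le_or_gt a (l x) with h3 | h3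
      · have := hh.2.1 (Set.mem_Ici.2 ha.le) (Set.mem_Ici.2 (hl0 x)) h3
        have h4 : 0 ≤ h 0 * |l x - l z| / a := by positivity
        linarith
      · have h4 : h (l x) ≤ h 0 :=
          hh.2.1 (Set.mem_Ici.2 le_rfl) (Set.mem_Ici.2 (hl0 x)) (hl0 x)
        have h5 : a ≤ |l x - l z| := by
          rw [abs_sub_comm]
          exact le_trans (by linarith) (le_abs_self _)
        have h6 : h 0 ≤ h 0 * |l x - l z| / a := by
          rw [le_div_iff₀ ha]; gcongr
        have h7 := hh.1 a ha.le
        linarith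
    simp only [hb]
    linarith
  have key := integral_pow_le_of_drift κ z (fun t => hint t z) hl hbi hdr T
  have h3 : ∀ t ∈ Finset.range T, ∫ y, b y ∂((κ ^ t) z) ≤
      ∫ x, f x ∂((κX ^ t) z.1) + (h a + h 0 * (T * U) / a) := by
    intro t ht
    simp only [hb]
    have hfa : Integrable (fun z' : X × Y => f z'.1 + h a) ((κ ^ t) z) :=
      (hfi _).add (integrable_const _)
    rw [integral_add hfa (habs t),
      integral_add (hfi _) (integrable_const _), integral_fst_pow hA t z hf, integral_div,
      integral_const_mul]
    simp only [integral_const, probReal_univ, smul_eq_mul, one_mul]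
    have h4 := integral_abs_sub_pow_le κ hl hU t z
    have h5 : (t : ℝ) * U ≤ T * U := by
      gcongr
      exact (Finset.mem_range.1 ht).le
    have h6 : h 0 * (∫ z', |l z' - l z| ∂((κ ^ t) z)) / a ≤ h 0 * (T * U) / a := by
      gcongr
      exact h4.trans h5
    linarith
  have h4 := Finset.sum_le_sum h3
  rw [Finset.sum_add_distrib] at h4
  simp only [Finset.sum_const, Finset.card_range, nsmul_eq_mul] at h4
  linarith

end Autonomous

/-! ### Foster's criterion for the two-component chain -/

section Foster

variable {M : ℕ} {X : Type u} {Y : Fin M → Type v} [MeasurableSpace X]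
  [∀ i, MeasurableSpace (Y i)]

lemma ConditionB1.exists_bound {κ : Kernel (X × (Π i, Y i)) (X × (Π i, Y i))} {L : Π i, Y i → ℝ}
    (h : ConditionB1 κ L) : ∃ U : ℝ≥0, ∀ i z,
      ∫⁻ z', ENNReal.ofReal |L i (z'.2 i) - L i (z.2 i)| ∂(κ z) ≤ U := by
  obtain ⟨U, hU⟩ := h
  refine ⟨U, fun i z => le_trans ?_ (hU i)⟩
  exact le_iSup₂ (f := fun (x : X) (y : Π i, Y i) =>
    ∫⁻ z, ENNReal.ofReal |L i (z.2 i) - L i (y i)| ∂(κ (x, y))) z.1 z.2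

/-- Every component grows sublinearly in mean, uniformly over initial states with `x ∈ V`. -/
def SublinearGrowth (κ : Kernel (X × (Π i, Y i)) (X × (Π i, Y i))) (V : Set X)
    (L : Π i, Y i → ℝ) : Prop :=
  ∀ i, ∀ ε : ℝ, 0 < ε → ∃ N : ℕ, ∀ T : ℕ, N ≤ T → ∀ z : X × (Π i, Y i), z.1 ∈ V →
    ∫ z', L i (z'.2 i) ∂((κ ^ T) z) - L i (z.2 i) ≤ ε * T

/-- Budget per step, over `T` steps from `V` with a large sum: the large coordinate contributes `-δ`
and an error `δ / 4` from `h i`, the others at most `δ / 4`, the hitting-time term at most `δ / 4`.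
This leaves `-δ / 4`. First `T` is chosen to absorb the additive constants, then `N₁` to make the `h
i` error small over this fixed `T`. -/
theorem exists_positiveRecurrent (κ : Kernel (X × (Π i, Y i)) (X × (Π i, Y i)))
    [IsMarkovKernel κ] (κX : Kernel X X) [IsMarkovKernel κX] {V : Set X} (hV : MeasurableSet V)
    (hA0 : Autonomous κ κX) (hA2 : PositiveRecurrent κX V) (hA3 : AdmitsMinorant κX V)
    {L : Π i, Y i → ℝ} (hL : ∀ i, Measurable (L i)) (hL0 : ∀ i y, 0 ≤ L i y)
    (hB1 : ConditionB1 κ L) (hB2 : ConditionB2 κ κX L) (hB3 : SublinearGrowth κ V L) (N₀ : ℝ) :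
    ∃ N₁ : ℝ, N₀ ≤ N₁ ∧ PositiveRecurrent κ {z | z.1 ∈ V ∧ ∑ i, L i (z.2 i) ≤ N₁} := by
  obtain ⟨U, hU⟩ := hB1.exists_bound
  have hX : Nonempty X := by
    obtain ⟨p, μ, m, -, -, hμ, -⟩ := hA3
    exact nonempty_of_isProbabilityMeasure μ
  obtain ⟨π, hπ, hπinv, hpi⟩ := exists_invariant_sum_le κX hV hA2 hA3
  choose h f hh hf hfb hneg hdrift using hB2
  choose K hK using hfb
  choose δ' C' hδ' hsum using fun i => hpi (f i) (hf i) ⟨K i, hK i⟩ (hneg i π hπ hπinv)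
  have hlm : ∀ i, Measurable fun z : X × (Π i, Y i) => L i (z.2 i) := fun i =>
    (hL i).comp ((measurable_pi_apply i).comp measurable_snd)
  have hint : ∀ i (t : ℕ) z, Integrable (fun z : X × (Π i, Y i) => L i (z.2 i)) ((κ ^ t) z) :=
    fun i => integrable_pow κ (hlm i) (hU i)
  obtain ⟨δ, hδ0, hδ⟩ : ∃ δ : ℝ, 0 < δ ∧ ∀ i, δ < δ' i / 2 := by
    have h1 : ∀ᶠ δ : ℝ in 𝓝[>] 0, ∀ i, δ < δ' i / 2 := by
      rw [eventually_all]
      intro i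
      exact nhdsWithin_le_nhds (gt_mem_nhds (half_pos (hδ' i)))
    obtain ⟨δ, h2, h3⟩ := (h1.and self_mem_nhdsWithin).exists
    exact ⟨δ, h3, h2⟩
  -- `M * U` bounds the mean one-step growth of the sum; the extra `1` is the net decrease wanted
  -- off `V`.
  set c₀ : ℝ≥0 := M * U + 1 with hc₀
  have hc₀pos : (0 : ℝ) < c₀ := by rw [hc₀]; positivity
  obtain ⟨C, hC⟩ := lintegral_meanHitting_sublinear κX hV hA2 hA3
    (c := δ / (8 * c₀)) (by positivity)
  set ε := δ / (4 * (M + 1)) with hε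
  have hε0 : 0 < ε := by positivity
  choose N hN using fun i => hB3 i ε hε0
  obtain ⟨T, hT1, hTC, hTN, hTC'⟩ : ∃ T : ℕ, 1 ≤ T ∧ c₀ * C ≤ δ / 8 * T ∧ (∀ i, N i ≤ T) ∧
      ∀ i, C' i ≤ δ' i / 2 * T := by
    have hlin : ∀ (a b : ℝ), 0 < a → ∀ᶠ T : ℕ in atTop, b ≤ a * T := fun a b ha =>
      (tendsto_natCast_atTop_atTop.const_mul_atTop ha).eventually_ge_atTop b
    have h1 : ∀ᶠ T : ℕ in atTop, ∀ i, N i ≤ T := by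
      rw [eventually_all]; exact fun i => eventually_ge_atTop _
    have h2 : ∀ᶠ T : ℕ in atTop, ∀ i, C' i ≤ δ' i / 2 * T := by
      rw [eventually_all]; exact fun i => hlin _ _ (half_pos (hδ' i))
    exact ((eventually_ge_atTop 1).and ((hlin (δ / 8) (c₀ * C) (by positivity)).and
      (h1.and h2))).exists
  have hT0 : (0 : ℝ) < T := by exact_mod_cast hT1
  obtain ⟨N₁, hN₁, hN₁0, hN₁h⟩ : ∃ N₁ : ℝ, N₀ ≤ N₁ ∧ 0 < N₁ ∧
      ∀ i, h i (N₁ / (2 * (M + 1))) + h i 0 * (T * U) / (N₁ / (2 * (M + 1))) < δ / 4 := by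
    have h1 : Tendsto (fun N₁ : ℝ => N₁ / (2 * (M + 1))) atTop atTop :=
      tendsto_id.atTop_div_const (by positivity)
    have h2 : ∀ᶠ N₁ : ℝ in atTop,
        ∀ i, h i (N₁ / (2 * (M + 1))) + h i 0 * (T * U) / (N₁ / (2 * (M + 1))) < δ / 4 := by
      rw [eventually_all]
      intro i
      have h3 := ((hh i).2.2.comp h1).add
        ((tendsto_const_nhds (x := h i 0 * (T * U))).div_atTop h1)
      rw [add_zero] at h3
      exact h3.eventually (gt_mem_nhds (by positivity))
    exact ((eventually_ge_atTop N₀).and ((eventually_gt_atTop 0).and h2)).exists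
  refine ⟨N₁, hN₁, ?_⟩
  set s : X × (Π i, Y i) → ℝ := fun z => ∑ i, L i (z.2 i) with hs
  have hsm : Measurable s := Finset.measurable_sum _ fun i _ => hlm i
  have hs0 : ∀ z, 0 ≤ s z := fun z => Finset.sum_nonneg fun i _ => hL0 i _
  have hVm : MeasurableSet {z : X × (Π i, Y i) | z.1 ∈ V} := measurable_fst hV
  have hD : MeasurableSet {z : X × (Π i, Y i) | z.1 ∈ V ∧ s z ≤ N₁} :=
    hVm.inter (measurableSet_le hsm measurable_const)
  have hwm := measurable_meanHitting κX hV
  set Λ : X × (Π i, Y i) → ℝ≥0∞ := fun z => ENNReal.ofReal (s z) + c₀ * meanHitting κX hV z.1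
    with hΛ
  have hsint : ∀ (t : ℕ) z, ∫ z', s z' ∂((κ ^ t) z) = ∑ i, ∫ z', L i (z'.2 i) ∂((κ ^ t) z) :=
    fun t z => integral_finsetSum _ fun i _ => hint i t z
  have hΛint : ∀ (t : ℕ) z, ∫⁻ z', Λ z' ∂((κ ^ t) z) =
      ∫⁻ z', ENNReal.ofReal (s z') ∂((κ ^ t) z) +
        c₀ * ∫⁻ x, meanHitting κX hV x ∂((κX ^ t) z.1) := by
    intro t z
    have hwm' : Measurable fun z' : X × (Π i, Y i) => meanHitting κX hV z'.1 :=
      hwm.comp measurable_fst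
    simp only [hΛ]
    rw [lintegral_add_left hsm.ennreal_ofReal, lintegral_const_mul _ hwm', lintegral_fst_pow hA0 t z hwm]
  have hΛV : ∀ z : X × (Π i, Y i), z.1 ∈ V → Λ z = ENNReal.ofReal (s z) := fun z hz => by
    simp [hΛ, meanHitting, hz]
  have hstep : ∀ z, ∫⁻ z', ENNReal.ofReal (s z') ∂(κ z) ≤ ENNReal.ofReal (s z) + (M * U : ℝ≥0) := by
    intro z
    calc ∫⁻ z', ENNReal.ofReal (s z') ∂(κ z)
        ≤ ∫⁻ z', (ENNReal.ofReal (s z) +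
          ∑ i, ENNReal.ofReal |L i (z'.2 i) - L i (z.2 i)|) ∂(κ z) := by
          refine lintegral_mono fun z' => ?_
          rw [← ENNReal.ofReal_sum_of_nonneg fun i _ => abs_nonneg _,
            ← ENNReal.ofReal_add (hs0 z) (Finset.sum_nonneg fun i _ => abs_nonneg _)]
          refine ENNReal.ofReal_le_ofReal ?_
          simp only [hs]
          rw [← Finset.sum_add_distrib]
          refine Finset.sum_le_sum fun i _ => ?_
          linarith [le_abs_self (L i (z'.2 i) - L i (z.2 i))]
      _ = ENNReal.ofReal (s z) +
          ∑ i, ∫⁻ z', ENNReal.ofReal |L i (z'.2 i) - L i (z.2 i)| ∂(κ z) := by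
          rw [lintegral_add_left measurable_const, lintegral_finsetSum _ fun i _ =>
            (((hlm i).sub_const _).abs).ennreal_ofReal]
          simp
      _ ≤ ENNReal.ofReal (s z) + ∑ _i : Fin M, (U : ℝ≥0∞) := by
          gcongr with i _
          exact hU i z
      _ = _ := by simp
  have hw : ∀ z : X × (Π i, Y i), z.1 ∈ V →
      c₀ * ∫⁻ x, meanHitting κX hV x ∂((κX ^ T) z.1) ≤ ENNReal.ofReal (δ / 4 * T) := by
    intro z hz
    calc c₀ * ∫⁻ x, meanHitting κX hV x ∂((κX ^ T) z.1)
        ≤ c₀ * (C + T * ENNReal.ofReal (δ / (8 * c₀))) := by gcongr; exact hC T z.1 hz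
      _ = ENNReal.ofReal (c₀ * (C + T * (δ / (8 * c₀)))) := by
          rw [ENNReal.ofReal_mul (by positivity), ENNReal.ofReal_add (by positivity) (by positivity),
            ENNReal.ofReal_mul (by positivity), ENNReal.ofReal_natCast, ENNReal.ofReal_coe_nnreal,
            ENNReal.ofReal_coe_nnreal]
      _ ≤ _ := by
          refine ENNReal.ofReal_le_ofReal ?_
          have : (c₀ : ℝ) * (T * (δ / (8 * c₀))) = δ / 8 * T := by field_simp
          linarith
  set c := ENNReal.ofReal (min 1 (δ / 4)) with hc
  have hc0 : c ≠ 0 := by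
    rw [hc, ne_eq, ENNReal.ofReal_eq_zero, not_le]
    exact lt_min one_pos (by positivity)
  have hfoster : ∀ z ∉ {z : X × (Π i, Y i) | z.1 ∈ V ∧ s z ≤ N₁}, ∃ k : ℕ, 1 ≤ k ∧
      c * k + ∫⁻ y, Λ y ∂((κ ^ k) z) ≤ Λ z := by
    intro z hz
    by_cases hzV : z.1 ∈ V
    · have hzs : N₁ < s z := by
        by_contra hcon
        exact hz ⟨hzV, not_lt.1 hcon⟩
      refine ⟨T, hT1, ?_⟩
      -- Pigeonhole, with `M + 1` in place of `M` so that the denominator is positive even for `M =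
      -- 0`.
      obtain ⟨i, hi⟩ : ∃ i, N₁ / (M + 1) ≤ L i (z.2 i) := by
        by_contra hcon
        push Not at hcon
        have h1 : s z ≤ ∑ _i : Fin M, N₁ / (M + 1) := Finset.sum_le_sum fun i _ => (hcon i).le
        simp only [Finset.sum_const, Finset.card_univ, Fintype.card_fin, nsmul_eq_mul] at h1
        have h2 : (M : ℝ) * (N₁ / (M + 1)) ≤ N₁ := by
          rw [← mul_div_assoc, div_le_iff₀ (by positivity)]
          nlinarith
        linarith
      have hbig := integral_sub_le_of_large hA0 (hlm i) (fun z => hL0 i _) (hU i) (hh i) (hf i)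
        (hK i) (fun z => hdrift i z.1 z.2) (a := N₁ / (2 * (M + 1))) (by positivity) (z := z)
        (by
          have : 2 * (N₁ / (2 * (M + 1))) = N₁ / (M + 1) := by field_simp
          rw [this]; exact hi) T
      have h1 := hsum i T z.1 hzV
      have h2 : (T : ℝ) * (h i (N₁ / (2 * (M + 1))) + h i 0 * (T * U) / (N₁ / (2 * (M + 1)))) ≤
          T * (δ / 4) := by gcongr; exact (hN₁h i).le
      have h3 : ∫ z', L i (z'.2 i) ∂((κ ^ T) z) - L i (z.2 i) ≤ -(δ * T) + T * (δ / 4) := by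
        have := hTC' i
        have h4 := mul_lt_mul_of_pos_right (hδ i) hT0
        linarith
      have h4 : ∫ z', s z' ∂((κ ^ T) z) - s z ≤ -(δ / 2 * T) := by
        rw [hsint]
        simp only [hs]
        rw [← Finset.sum_sub_distrib, ← Finset.add_sum_erase _ _ (Finset.mem_univ i)]
        have h5 : ∑ j ∈ Finset.univ.erase i,
            (∫ z', L j (z'.2 j) ∂((κ ^ T) z) - L j (z.2 j)) ≤ (M : ℝ) * (ε * T) := by
          refine (Finset.sum_le_sum fun j _ => hN j T (hTN j) z hzV).trans ?_
          rw [Finset.sum_const, nsmul_eq_mul]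
          gcongr
          exact (Finset.card_erase_le).trans (by simp)
        have h6 : (M : ℝ) * (ε * T) ≤ δ / 4 * T := by
          rw [← mul_assoc]
          gcongr
          rw [hε, ← mul_div_assoc, div_le_div_iff₀ (by positivity) (by positivity)]
          nlinarith
        linarith
      rw [hΛint, hΛV z hzV]
      have h5 : ∫⁻ z', ENNReal.ofReal (s z') ∂((κ ^ T) z) =
          ENNReal.ofReal (∫ z', s z' ∂((κ ^ T) z)) :=
        (ofReal_integral_eq_lintegral_ofReal (integrable_finsetSum _ fun i _ => hint i T z)
          (ae_of_all _ hs0)).symm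
      have h6 : c * T ≤ ENNReal.ofReal (δ / 4 * T) := by
        rw [ENNReal.ofReal_mul (by positivity), ENNReal.ofReal_natCast, hc]
        gcongr
        exact min_le_right _ _
      have h7 : 0 ≤ ∫ z', s z' ∂((κ ^ T) z) := integral_nonneg hs0
      calc c * T + (∫⁻ z', ENNReal.ofReal (s z') ∂((κ ^ T) z) +
            c₀ * ∫⁻ x, meanHitting κX hV x ∂((κX ^ T) z.1))
          ≤ ENNReal.ofReal (δ / 4 * T) + (ENNReal.ofReal (∫ z', s z' ∂((κ ^ T) z)) +
            ENNReal.ofReal (δ / 4 * T)) := by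
            rw [h5]
            gcongr
            exact hw z hzV
        _ = ENNReal.ofReal (δ / 4 * T + (∫ z', s z' ∂((κ ^ T) z) + δ / 4 * T)) := by
            rw [ENNReal.ofReal_add (by positivity) (by positivity),
              ENNReal.ofReal_add h7 (by positivity)]
        _ ≤ _ := ENNReal.ofReal_le_ofReal (by linarith)
    · refine ⟨1, le_rfl, ?_⟩
      rw [hΛint, pow_one, pow_one, Nat.cast_one, mul_one]
      have h1 : meanHitting κX hV z.1 = 1 + ∫⁻ x, meanHitting κX hV x ∂(κX z.1) := by
        rw [one_add_lintegral_meanHitting]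
        simp [meanHitting, hzV]
      have h2 : c ≤ 1 := by
        rw [hc]; exact ENNReal.ofReal_le_one.2 (min_le_left _ _)
      calc c + (∫⁻ z', ENNReal.ofReal (s z') ∂(κ z) +
            c₀ * ∫⁻ x, meanHitting κX hV x ∂(κX z.1))
          ≤ 1 + (ENNReal.ofReal (s z) + (M * U : ℝ≥0) +
            c₀ * ∫⁻ x, meanHitting κX hV x ∂(κX z.1)) := by
            gcongr
            exact hstep z
        _ = Λ z := by
            simp only [hΛ]
            rw [h1, hc₀]
            push_cast
            ring
  -- Starting Foster's bound with `T` steps makes the estimate depend on `z` only through the sum `s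
  -- z`, hence uniform over the set in question.
  have hfin : ∀ z : X × (Π i, Y i), z.1 ∈ V → c * meanReturn κ hD z ≤
      c * T + (ENNReal.ofReal (s z) + T * (M * U : ℝ≥0) + ENNReal.ofReal (δ / 4 * T)) := by
    intro z hz
    refine (meanReturn_le_of_drift κ hD c hfoster z T hT1).trans ?_
    rw [hΛint]
    gcongr
    · exact lintegral_pow_le_of_drift κ hsm.ennreal_ofReal hstep T z
    · exact hw z hz
  have hctop : c ≠ ⊤ := ENNReal.ofReal_ne_top
  have hmul : ∀ (a b : ℝ≥0∞), c * a ≤ b → a ≤ c⁻¹ * b := fun a b hab => by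
    calc a = c⁻¹ * (c * a) := by rw [← mul_assoc, ENNReal.inv_mul_cancel hc0 hctop, one_mul]
      _ ≤ _ := by gcongr
  have hb : ∀ r : ℝ, c⁻¹ * (c * T + (ENNReal.ofReal r + T * (M * U : ℝ≥0) +
      ENNReal.ofReal (δ / 4 * T))) < ⊤ := by
    intro r
    refine ENNReal.mul_lt_top (ENNReal.inv_lt_top.2 (pos_iff_ne_zero.2 hc0)) ?_
    have hTt : (T : ℝ≥0∞) < ⊤ := ENNReal.natCast_lt_top T
    exact ENNReal.add_lt_top.2 ⟨ENNReal.mul_lt_top hctop.lt_top hTt,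
      ENNReal.add_lt_top.2 ⟨ENNReal.add_lt_top.2 ⟨ENNReal.ofReal_lt_top,
        ENNReal.mul_lt_top hTt ENNReal.coe_lt_top⟩, ENNReal.ofReal_lt_top⟩⟩
  refine (positiveRecurrent_iff κ hD).2 ⟨?_, ?_⟩
  -- Off `V` the function `Λ` may be infinite, so almost sure return is obtained by first waiting
  -- for `V`.
  · refine tendsto_taboo_of_tendsto_taboo κ hD hVm (tendsto_taboo_fst hA0 hV hA2) fun z hz => ?_
    refine tendsto_taboo_of_meanReturn_lt_top κ hD z ?_
    exact ((hmul _ _ (hfin z hz)).trans_lt (hb _)).ne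
  · refine lt_of_le_of_lt (iSup₂_le fun z hz => ?_) (hb N₁)
    refine (hmul _ _ (hfin z hz.1)).trans ?_
    gcongr
    exact hz.2

end Foster

end MarkovStability

namespace MarkovStability

/-! ### Correctors -/

section Corrector

variable {S : Type u} [MeasurableSpace S]

/-- `∑_{t < n} P^t f`. -/
noncomputable def potentialSum (κ : Kernel S S) (f : S → ℝ) (n : ℕ) (x : S) : ℝ :=
  ∑ t ∈ Finset.range n, ∫ y, f y ∂((κ ^ t) x)

variable {κ : Kernel S S} [IsMarkovKernel κ] {f : S → ℝ} {K : ℝ}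

omit [IsMarkovKernel κ] in
lemma measurable_potentialSum (hf : Measurable f) (n : ℕ) : Measurable (potentialSum κ f n) :=
  Finset.measurable_sum _ fun _ _ => measurable_integral_kernel _ hf

lemma abs_potentialSum_le (hK : ∀ x, |f x| ≤ K) (n : ℕ) (x : S) :
    |potentialSum κ f n x| ≤ n * K := by
  refine (Finset.abs_sum_le_sum_abs _ _).trans ?_
  refine (Finset.sum_le_sum fun t _ => abs_integral_le hK).trans ?_
  simp

lemma potentialSum_succ (hf : Measurable f) (hK : ∀ x, |f x| ≤ K) (n : ℕ) (x : S) :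
    potentialSum κ f (n + 1) x = f x + ∫ y, potentialSum κ f n y ∂(κ x) := by
  unfold potentialSum
  rw [Finset.sum_range_succ', integral_pow_zero _ hf, add_comm,
    integral_finsetSum _ fun t _ => integrable_of_abs_le (measurable_integral_kernel _ hf)
      fun x => abs_integral_le hK]
  congr 1
  exact Finset.sum_congr rfl fun t _ => integral_pow_succ' _ _ _ (integrable_of_abs_le hf hK)

/-- The probability `𝐏_x (τ(V) > n)`. -/
noncomputable def survival (κ : Kernel S S) {V : Set S} (hV : MeasurableSet V) (n : ℕ) (x : S) :
    ℝ := ((tabooKernel κ hV ^ n) x Set.univ).toReal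

variable {V : Set S} (hV : MeasurableSet V)

omit [IsMarkovKernel κ] in
lemma measurable_survival (n : ℕ) : Measurable (survival κ hV n) :=
  (Kernel.measurable_coe _ MeasurableSet.univ).ennreal_toReal

omit [IsMarkovKernel κ] in
lemma survival_nonneg (n : ℕ) (x : S) : 0 ≤ survival κ hV n x := ENNReal.toReal_nonneg

omit [IsMarkovKernel κ] in
lemma survival_zero (x : S) : survival κ hV 0 x = 1 := by
  have := lintegral_pow_zero (tabooKernel κ hV) (measurable_one (α := ℝ≥0∞)) x
  simp only [Pi.one_apply, lintegral_one] at this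
  rw [survival, this, ENNReal.toReal_one]

lemma taboo_pow_univ_le_one (n : ℕ) (x : S) : (tabooKernel κ hV ^ n) x Set.univ ≤ 1 := by
  rw [← pathLaw_avoid]; exact prob_le_one

lemma survival_le_one (n : ℕ) (x : S) : survival κ hV n x ≤ 1 :=
  ENNReal.toReal_le_of_le_ofReal zero_le_one (by simpa using taboo_pow_univ_le_one hV n x)

lemma survival_succ (n : ℕ) (x : S) :
    survival κ hV (n + 1) x = ∫ y, Vᶜ.indicator (survival κ hV n) y ∂(κ x) := by
  have e : ∀ ψ : Measure S, ψ Set.univ = ∫⁻ _, 1 ∂ψ := fun ψ => by simp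
  have h1 : (tabooKernel κ hV ^ (n + 1)) x Set.univ =
      ∫⁻ y, Vᶜ.indicator (fun y => (tabooKernel κ hV ^ n) y Set.univ) y ∂(κ x) := by
    rw [lintegral_indicator_compl κ hV, e, lintegral_pow_succ' _ measurable_const]
    simp
  rw [survival, h1, ← integral_toReal]
  · refine integral_congr_ae (ae_of_all _ fun y => ?_)
    by_cases hy : y ∈ V <;> simp [hy, survival]
  · exact ((Kernel.measurable_coe _ MeasurableSet.univ).indicator hV.compl).aemeasurable
  · refine ae_of_all _ fun y => ?_
    by_cases hy : y ∈ V
    · simp [hy]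
    · rw [Set.indicator_of_mem (by simpa using hy)]
      exact (taboo_pow_univ_le_one hV n y).trans_lt ENNReal.one_lt_top

/-- The truncated expected hitting time of `V`. -/
noncomputable def truncatedHitting (κ : Kernel S S) {V : Set S} (hV : MeasurableSet V) (n : ℕ)
    (x : S) : ℝ := ∑ k ∈ Finset.range n, Vᶜ.indicator (survival κ hV k) x

omit [IsMarkovKernel κ] in
lemma measurable_truncatedHitting (n : ℕ) : Measurable (truncatedHitting κ hV n) :=
  Finset.measurable_sum _ fun _ _ => (measurable_survival hV _).indicator hV.compl

lemma indicator_survival_mem (n : ℕ) (x : S) :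
    0 ≤ Vᶜ.indicator (survival κ hV n) x ∧ Vᶜ.indicator (survival κ hV n) x ≤ 1 := by
  by_cases hx : x ∈ V
  · simp [hx]
  · rw [Set.indicator_of_mem (by simpa using hx)]
    exact ⟨survival_nonneg hV n x, survival_le_one hV n x⟩

lemma truncatedHitting_nonneg (n : ℕ) (x : S) : 0 ≤ truncatedHitting κ hV n x :=
  Finset.sum_nonneg fun k _ => (indicator_survival_mem hV k x).1

lemma truncatedHitting_le (n : ℕ) (x : S) : truncatedHitting κ hV n x ≤ n := by
  refine (Finset.sum_le_sum fun k _ => (indicator_survival_mem hV k x).2).trans ?_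
  simp

omit [IsMarkovKernel κ] in
lemma truncatedHitting_of_mem {x : S} (hx : x ∈ V) (n : ℕ) : truncatedHitting κ hV n x = 0 := by
  simp [truncatedHitting, hx]

lemma truncatedHitting_succ {x : S} (hx : x ∉ V) (n : ℕ) :
    truncatedHitting κ hV (n + 1) x = 1 + ∫ y, truncatedHitting κ hV n y ∂(κ x) := by
  have hx' : x ∈ Vᶜ := hx
  unfold truncatedHitting
  rw [Finset.sum_range_succ', integral_finsetSum, add_comm]
  · congr 1
    · rw [Set.indicator_of_mem hx', survival_zero]
    · refine Finset.sum_congr rfl fun k _ => ?_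
      rw [Set.indicator_of_mem hx', survival_succ]
  · intro k _
    refine integrable_of_abs_le ((measurable_survival hV _).indicator hV.compl) (K := 1) fun y => ?_
    have := indicator_survival_mem (κ := κ) hV k y
    rw [abs_of_nonneg this.1]; exact this.2

/-- A linear bound on `potentialSum` over `V` extends to all initial states at the cost of the
truncated hitting time of `V`. -/
lemma potentialSum_le (hf : Measurable f) (hK : ∀ x, |f x| ≤ K) {δ C : ℝ}
    (h : ∀ n : ℕ, ∀ x ∈ V, potentialSum κ f n x ≤ C - δ * n) (hC : 0 ≤ C) (n : ℕ) (x : S) :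
    potentialSum κ f n x ≤ C - δ * n + (K + δ) * truncatedHitting κ hV n x := by
  induction n generalizing x with
  | zero => simp [potentialSum, truncatedHitting, hC]
  | succ n ih =>
    by_cases hx : x ∈ V
    · rw [truncatedHitting_of_mem hV hx, mul_zero, add_zero]
      exact h _ x hx
    · have hti : ∀ x, Integrable (truncatedHitting κ hV n) (κ x) := fun x =>
        integrable_of_abs_le (measurable_truncatedHitting hV n) (K := n) fun y => by
          rw [abs_of_nonneg (truncatedHitting_nonneg hV n y)]; exact truncatedHitting_le hV n y
      have h1 : ∫ y, potentialSum κ f n y ∂(κ x) ≤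
          ∫ y, (C - δ * n + (K + δ) * truncatedHitting κ hV n y) ∂(κ x) :=
        integral_mono (integrable_of_abs_le (measurable_potentialSum hf n)
          (abs_potentialSum_le hK n)) ((integrable_const _).add ((hti x).const_mul _)) ih
      rw [integral_add (integrable_const _) ((hti x).const_mul _), integral_const_mul] at h1
      simp only [integral_const, probReal_univ, smul_eq_mul, one_mul] at h1
      rw [potentialSum_succ hf hK, truncatedHitting_succ hV hx]
      have h2 := (abs_le.1 (hK x)).2
      push_cast
      linarith

omit [IsMarkovKernel κ] in
-- A Cesàro mean of survival probabilities tending to zero. Almost sure hitting suffices; the mean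
-- hitting time may be infinite.
lemma tendsto_truncatedHitting_div {x : S}
    (h : Tendsto (fun n => (tabooKernel κ hV ^ n) x Set.univ) atTop (𝓝 0)) :
    Tendsto (fun n : ℕ => truncatedHitting κ hV n x / n) atTop (𝓝 0) := by
  have h1 : Tendsto (fun n => Vᶜ.indicator (survival κ hV n) x) atTop (𝓝 0) := by
    by_cases hx : x ∈ V
    · simp [hx]
    · have hx' : x ∈ Vᶜ := hx
      simp only [Set.indicator_of_mem hx']
      have := (ENNReal.tendsto_toReal ENNReal.zero_ne_top).comp h
      rw [ENNReal.toReal_zero] at this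
      exact this
  refine h1.cesaro.congr fun n => ?_
  rw [truncatedHitting, div_eq_inv_mul]

/-- A bounded function `f` of negative stationary mean is dominated, up to a bounded corrector `u`,
by a non-negative function `e` whose long-run average from `V` is arbitrarily small. -/
theorem exists_corrector (hV : MeasurableSet V) (hrec : PositiveRecurrent κ V) {π : Measure S} [IsProbabilityMeasure π]
    (hpi : ∀ f : S → ℝ, Measurable f → (∃ K, ∀ x, |f x| ≤ K) → ∫ x, f x ∂π < 0 →
        ∃ δ C : ℝ, 0 < δ ∧ ∀ T : ℕ, ∀ x ∈ V,
          ∑ t ∈ Finset.range T, ∫ y, f y ∂((κ ^ t) x) ≤ C - δ * T)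
    (hf : Measurable f) (hK : ∀ x, |f x| ≤ K) (hneg : ∫ x, f x ∂π < 0) {ε : ℝ} (hε : 0 < ε) :
    ∃ (u e : S → ℝ) (B C : ℝ), Measurable u ∧ Measurable e ∧ (∀ x, |u x| ≤ B) ∧
      (∀ x, |e x| ≤ B) ∧ (∀ x, 0 ≤ e x) ∧ (∀ x, f x + ∫ y, u y ∂(κ x) - u x ≤ e x) ∧
      ∀ T : ℕ, ∀ x ∈ V, ∑ t ∈ Finset.range T, ∫ y, e y ∂((κ ^ t) x) ≤ C + ε * T := by
  obtain ⟨δ, C₀, hδ, hC₀⟩ := hpi f hf ⟨K, hK⟩ hneg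
  have hS : Nonempty S := nonempty_of_isProbabilityMeasure π
  have hK0 : 0 ≤ K := (abs_nonneg _).trans (hK hS.some)
  set C₁ := max C₀ 0 with hC₁
  have hC₁0 : 0 ≤ C₁ := le_max_right _ _
  -- An upper bound for `potentialSum κ f n / n`, by `potentialSum_le`. The truncation keeps it
  -- bounded uniformly in `n`, so its `π`-mean tends to zero by dominated convergence.
  set e : ℕ → S → ℝ := fun n x => C₁ / n + (K + δ) * (truncatedHitting κ hV n x / n) with he
  have hem : ∀ n, Measurable (e n) := fun n =>
    (((measurable_truncatedHitting hV n).div_const _).const_mul _).const_add _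
  have hq : ∀ n x, 0 ≤ truncatedHitting κ hV n x / n ∧ truncatedHitting κ hV n x / n ≤ 1 := by
    intro n x
    refine ⟨div_nonneg (truncatedHitting_nonneg hV n x) (Nat.cast_nonneg n), ?_⟩
    exact div_le_one_of_le₀ (truncatedHitting_le hV n x) (Nat.cast_nonneg n)
  have he0 : ∀ n x, 0 ≤ e n x := fun n x => by
    have := (hq n x).1
    simp only [he]; positivity
  have heB : ∀ n x, |e n x| ≤ C₁ + (K + δ) := by
    intro n x
    rw [abs_of_nonneg (he0 n x)]
    have h1 : C₁ / n ≤ C₁ := by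
      rcases Nat.eq_zero_or_pos n with rfl | hn
      · simpa using hC₁0
      · exact div_le_self hC₁0 (by exact_mod_cast hn)
    have h2 : (K + δ) * (truncatedHitting κ hV n x / n) ≤ (K + δ) * 1 := by
      gcongr
      exact (hq n x).2
    simp only [he]; linarith
  have hlim : Tendsto (fun n => ∫ x, e n x ∂π) atTop (𝓝 0) := by
    have h0 : (0 : ℝ) = ∫ _, (0 : ℝ) ∂π := by simp
    rw [h0]
    refine tendsto_integral_of_dominated_convergence (fun _ => C₁ + (K + δ))
      (fun n => (hem n).aestronglyMeasurable) (integrable_const _)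
      (fun n => ae_of_all _ (heB n)) (ae_of_all _ fun x => ?_)
    have h1 : Tendsto (fun n : ℕ => C₁ / n) atTop (𝓝 0) :=
      tendsto_const_div_atTop_nhds_zero_nat C₁
    have h2 := (tendsto_truncatedHitting_div hV (((positiveRecurrent_iff κ hV).1 hrec).1 x)).const_mul
      (K + δ)
    simpa using h1.add h2
  obtain ⟨n, hnε, hn⟩ := ((hlim.eventually (gt_mem_nhds hε)).and (eventually_ge_atTop 1)).exists
  have hn0 : (0 : ℝ) < n := by exact_mod_cast hn
  have hei : ∀ (ν : Measure S) [IsFiniteMeasure ν], Integrable (e n) ν := fun ν _ =>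
    integrable_of_abs_le (hem n) (heB n)
  -- As `e n` has `π`-mean below `ε`, linear decrease of the sums of `e n - ε` is the required
  -- long-run bound for `e n`.
  obtain ⟨δ', C', hδ', hC'⟩ := hpi (fun x => e n x - ε) ((hem n).sub_const _)
    ⟨C₁ + (K + δ) + ε, fun x => (abs_sub _ _).trans (by
      rw [abs_of_pos hε]; gcongr; exact heB n x)⟩ (by
      rw [integral_sub (hei _) (integrable_const _)]
      simpa using hnε)
  -- For `S_k = potentialSum κ f k` one has `P S_k = S_{k+1} - f`, so averaging over `k < n` gives
  -- exactly `f + P u - u = S_n / n`.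
  set u : S → ℝ := fun x => (n : ℝ)⁻¹ * ∑ k ∈ Finset.range n, potentialSum κ f k x with hu
  have hum : Measurable u :=
    (Finset.measurable_sum _ fun k _ => measurable_potentialSum hf k).const_mul _
  have huB : ∀ x, |u x| ≤ n * K := by
    intro x
    simp only [hu]
    rw [abs_mul, abs_of_pos (inv_pos.2 hn0), inv_mul_le_iff₀ hn0]
    refine (Finset.abs_sum_le_sum_abs _ _).trans ?_
    refine (Finset.sum_le_sum fun k hk => (abs_potentialSum_le hK k x).trans
      (?_ : (k : ℝ) * K ≤ n * K)).trans ?_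
    · gcongr; exact (Finset.mem_range.1 hk).le
    · simp
  refine ⟨u, e n, n * K + (C₁ + (K + δ)), C', hum, hem n, fun x => ?_, fun x => ?_, he0 n,
    fun x => ?_, fun T x hx => ?_⟩
  · have := huB x
    linarith
  · have := heB n x
    have : 0 ≤ n * K := by positivity
    linarith
  · have h1 : ∫ y, u y ∂(κ x) = u x + (n : ℝ)⁻¹ * potentialSum κ f n x - f x := by
      simp only [hu]
      rw [integral_const_mul, integral_finsetSum _ fun k _ => integrable_of_abs_le
        (measurable_potentialSum hf k) (abs_potentialSum_le hK k)]
      have h2 : ∀ k, ∫ y, potentialSum κ f k y ∂(κ x) = potentialSum κ f (k + 1) x - f x :=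
        fun k => by rw [potentialSum_succ hf hK]; ring
      simp_rw [h2]
      rw [Finset.sum_sub_distrib]
      have h3 := Finset.sum_range_succ (fun k => potentialSum κ f k x) n
      rw [Finset.sum_range_succ'] at h3
      have h4 : potentialSum κ f 0 x = 0 := by simp [potentialSum]
      rw [h4, add_zero] at h3
      rw [h3]
      simp only [Finset.sum_const, Finset.card_range, nsmul_eq_mul]
      field_simp
    have h5 := potentialSum_le hV hf hK (δ := δ) (C := C₁) (fun n x hx =>
      (hC₀ n x hx).trans (by linarith [le_max_left C₀ 0])) hC₁0 n x
    have h6 : (n : ℝ)⁻¹ * potentialSum κ f n x ≤ e n x := by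
      rw [inv_mul_le_iff₀ hn0]
      have h7 : (n : ℝ) * e n x = C₁ + (K + δ) * truncatedHitting κ hV n x := by
        simp only [he]; field_simp
      rw [h7]
      have : 0 ≤ δ * n := by positivity
      linarith
    linarith
  · have h1 := hC' T x hx
    have h2 : ∀ t : ℕ, ∫ y, (e n y - ε) ∂((κ ^ t) x) = ∫ y, e n y ∂((κ ^ t) x) - ε := fun t => by
      rw [integral_sub (hei _) (integrable_const _)]; simp
    simp_rw [h2] at h1
    rw [Finset.sum_sub_distrib] at h1
    simp only [Finset.sum_const, Finset.card_range, nsmul_eq_mul] at h1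
    have : 0 ≤ δ' * T := by positivity
    linarith

end Corrector

end MarkovStability

namespace MarkovStability

/-! ### Sublinear growth under uniformly integrable dominating increments -/

section Huber

/-- The derivative of `huber K`. -/
noncomputable def ramp (K s : ℝ) : ℝ := max 0 (min 1 (s / K))

/-- The `C¹` function equal to `0` on `(-∞, 0]`, to `s ^ 2 / (2 * K)` on `[0, K]` and to
`s - K / 2` on `[K, ∞)`. -/
noncomputable def huber (K s : ℝ) : ℝ := ramp K s * s - K / 2 * ramp K s ^ 2

lemma ramp_nonneg (K s : ℝ) : 0 ≤ ramp K s := le_max_left _ _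

lemma ramp_le_one (K s : ℝ) : ramp K s ≤ 1 := max_le zero_le_one (min_le_left _ _)

lemma abs_ramp_le_one (K s : ℝ) : |ramp K s| ≤ 1 := by
  rw [abs_of_nonneg (ramp_nonneg K s)]; exact ramp_le_one K s

lemma measurable_ramp (K : ℝ) : Measurable (ramp K) := by
  unfold ramp; fun_prop

lemma measurable_huber (K : ℝ) : Measurable (huber K) := by
  have := measurable_ramp K
  unfold huber; fun_prop

variable {K : ℝ} (hK : 0 < K)
include hK

lemma ramp_le_div {s : ℝ} (hs : 0 ≤ s) : ramp K s ≤ s / K :=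
  max_le (by positivity) (min_le_right _ _)

lemma abs_ramp_sub_le (s t : ℝ) : |ramp K s - ramp K t| ≤ |s - t| / K := by
  unfold ramp
  refine (abs_max_sub_max_le_max _ _ _ _).trans ?_
  refine max_le (by rw [sub_self, abs_zero]; positivity) ?_
  refine (abs_min_sub_min_le_max _ _ _ _).trans ?_
  refine max_le (by rw [sub_self, abs_zero]; positivity) ?_
  rw [← sub_div, abs_div, abs_of_pos hK]

/-- `huber K s` is the maximum of these affine functions over `0 ≤ c ≤ 1`, attained at `c = ramp K
s`. Monotonicity and the Lipschitz bound come from this family of supporting lines. -/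
lemma le_huber {c : ℝ} (h0 : 0 ≤ c) (h1 : c ≤ 1) (s : ℝ) : c * s - K / 2 * c ^ 2 ≤ huber K s := by
  unfold huber
  rcases le_or_gt s 0 with hs | hs
  · have : ramp K s = 0 :=
      max_eq_left ((min_le_right _ _).trans (div_nonpos_of_nonpos_of_nonneg hs hK.le))
    rw [this]
    have h2 : c * s ≤ 0 := mul_nonpos_of_nonneg_of_nonpos h0 hs
    have h3 : 0 ≤ K / 2 * c ^ 2 := by positivity
    linarith
  · rcases le_or_gt s K with hsK | hsK
    · have h2 : ramp K s = s / K := by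
        unfold ramp
        rw [min_eq_right ((div_le_one hK).2 hsK), max_eq_right (by positivity)]
      obtain ⟨r, rfl⟩ : ∃ r, s = K * r := ⟨s / K, by field_simp⟩
      rw [h2, mul_div_cancel_left₀ _ hK.ne']
      nlinarith [mul_nonneg hK.le (sq_nonneg (r - c))]
    · have h2 : ramp K s = 1 := by
        unfold ramp
        rw [min_eq_left ((one_le_div hK).2 hsK.le), max_eq_right zero_le_one]
      rw [h2]
      nlinarith [mul_nonneg (sub_nonneg.2 h1) (sub_nonneg.2 hsK.le),
        mul_nonneg hK.le (sq_nonneg (1 - c))]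

/-- The supporting line at `s + d`, evaluated at `s`. -/
lemma huber_add_le_ramp (s d : ℝ) : huber K (s + d) ≤ huber K s + ramp K (s + d) * d := by
  have := le_huber hK (ramp_nonneg K (s + d)) (ramp_le_one K (s + d)) s
  have h2 : huber K (s + d) = ramp K (s + d) * (s + d) - K / 2 * ramp K (s + d) ^ 2 := rfl
  linarith

/-- A second-order estimate that needs no second moment of `d`: the slope is `1 / K`-Lipschitz and
never changes by more than `1`. -/
lemma huber_add_le (s d : ℝ) :
    huber K (s + d) ≤ huber K s + ramp K s * d + |d| * min 1 (|d| / K) := by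
  have h1 := huber_add_le_ramp hK s d
  have h2 : |ramp K (s + d) - ramp K s| ≤ min 1 (|d| / K) := by
    refine le_min ?_ ?_
    · rw [abs_le]
      constructor <;>
        linarith [ramp_nonneg K s, ramp_nonneg K (s + d), ramp_le_one K s, ramp_le_one K (s + d)]
    · have := abs_ramp_sub_le hK (s + d) s
      rwa [add_sub_cancel_left] at this
  have h3 : (ramp K (s + d) - ramp K s) * d ≤ |d| * min 1 (|d| / K) := by
    refine (le_abs_self _).trans ?_
    rw [abs_mul, mul_comm]
    gcongr
  linarith

lemma huber_monotone : Monotone (huber K) := by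
  intro s t hst
  have h1 := huber_add_le_ramp hK t (s - t)
  rw [add_sub_cancel] at h1
  have := mul_nonpos_of_nonneg_of_nonpos (ramp_nonneg K s) (sub_nonpos.2 hst)
  linarith

lemma huber_lipschitz : LipschitzWith 1 (huber K) := by
  refine LipschitzWith.of_le_add fun s t => ?_
  have h1 := huber_add_le_ramp hK t (s - t)
  rw [add_sub_cancel] at h1
  refine h1.trans ?_
  rw [Real.dist_eq]
  gcongr
  refine (le_abs_self _).trans ?_
  rw [abs_mul]
  exact mul_le_of_le_one_left (abs_nonneg _) (abs_ramp_le_one K s)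

lemma huber_le {s : ℝ} (hs : 0 ≤ s) : huber K s ≤ s := by
  have h1 := mul_le_of_le_one_left hs (ramp_le_one K s)
  have h2 : 0 ≤ K / 2 * ramp K s ^ 2 := by positivity
  unfold huber
  linarith

lemma sub_le_huber (s : ℝ) : s - K / 2 ≤ huber K s := by
  have := le_huber hK zero_le_one le_rfl s
  linarith

end Huber

/-! ### A Lyapunov function for sublinear growth -/

section Growth

variable {X : Type u} {Y : Type v} [MeasurableSpace X] [MeasurableSpace Y]

lemma _root_.LipschitzWith.integrable_comp_real {Ω : Type*} [MeasurableSpace Ω] {ν : Measure Ω}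
    [IsFiniteMeasure ν] {G : ℝ → ℝ} {C : ℝ≥0} (hG : LipschitzWith C G) {g : Ω → ℝ}
    (hg : Integrable g ν) : Integrable (fun ω => G (g ω)) ν := by
  refine ((hg.abs.const_mul (C : ℝ)).add (integrable_const |G 0|)).mono'
    (hG.continuous.comp_aestronglyMeasurable hg.aestronglyMeasurable) (ae_of_all _ fun ω => ?_)
  have h1 := hG.dist_le_mul (g ω) 0
  rw [Real.dist_eq, Real.dist_eq, sub_zero] at h1
  have h2 : |G (g ω)| ≤ |G (g ω) - G 0| + |G 0| := by
    have := abs_add_le (G (g ω) - G 0) (G 0)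
    rwa [sub_add_cancel] at this
  rw [Real.norm_eq_abs]
  simp only [Pi.add_apply]
  linarith

/-- The one-step change of `huber K` of a process with increments dominated by `ξ + H`. -/
lemma integral_huber_le {ξ : Measure ℝ} [IsProbabilityMeasure ξ] (hint : Integrable id ξ)
    {K : ℝ} (hK : 0 < K) {C : ℝ} (hC : 1 ≤ C) {H b : ℝ} (hH : 0 ≤ H) (hHb : H ≤ b) {ε : ℝ}
    (hξ : ∫ s, {s : ℝ | C ≤ |s|}.indicator (fun s => |s|) s ∂ξ ≤ ε) (a : ℝ) :
    ∫ s, huber K (a + H + s) ∂ξ ≤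
      huber K a + ramp K a * (∫ s, s ∂ξ) + ramp K a * H + (C + b) ^ 2 / K + (1 + b) * ε := by
  have hint' : Integrable (fun s : ℝ => s) ξ := hint
  have hb : 0 ≤ b := hH.trans hHb
  have hm : MeasurableSet {s : ℝ | C ≤ |s|} := measurableSet_le measurable_const (by fun_prop)
  have hi : Integrable ({s : ℝ | C ≤ |s|}.indicator fun s => |s|) ξ := hint'.abs.indicator hm
  have hpt : ∀ s, huber K (a + H + s) ≤ (huber K a + ramp K a * H + (C + b) ^ 2 / K) +
      ramp K a * s + (1 + b) * {s : ℝ | C ≤ |s|}.indicator (fun s => |s|) s := by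
    intro s
    have h1 := huber_add_le hK a (H + s)
    rw [← add_assoc] at h1
    have h2 : |H + s| ≤ b + |s| := (abs_add_le _ _).trans (by rw [abs_of_nonneg hH]; gcongr)
    have h3 : |H + s| * min 1 (|H + s| / K) ≤
        (C + b) ^ 2 / K + (1 + b) * {s : ℝ | C ≤ |s|}.indicator (fun s => |s|) s := by
      -- Large jumps satisfy `|H + s| ≤ (1 + b) |s|` because `|s| ≥ C ≥ 1`; small ones satisfy `|H +
      -- s| ≤ C + b` and gain the factor `1 / K`.
      by_cases hs : C ≤ |s|
      · rw [Set.indicator_of_mem (by exact hs)]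
        have h4 : |H + s| * min 1 (|H + s| / K) ≤ |H + s| :=
          mul_le_of_le_one_right (abs_nonneg _) (min_le_left _ _)
        have h5 : 0 ≤ (C + b) ^ 2 / K := by positivity
        nlinarith [mul_nonneg hb (sub_nonneg.2 (hC.trans hs))]
      · rw [Set.indicator_of_notMem (by exact hs), mul_zero, add_zero]
        push Not at hs
        have h4 : |H + s| ≤ C + b := by linarith
        calc |H + s| * min 1 (|H + s| / K) ≤ |H + s| * (|H + s| / K) := by
              gcongr; exact min_le_right _ _
          _ = |H + s| ^ 2 / K := by ring
          _ ≤ _ := by gcongr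
    rw [mul_add] at h1
    linarith
  have hi1 : Integrable (fun s => (huber K a + ramp K a * H + (C + b) ^ 2 / K) + ramp K a * s) ξ :=
    (integrable_const _).add (hint'.const_mul _)
  have hi2 := hi.const_mul (1 + b)
  have h1 := integral_mono ((huber_lipschitz hK).integrable_comp_real
    ((integrable_const (a + H)).add hint')) (hi1.add hi2) hpt
  have h2 : ∫ s, ((huber K a + ramp K a * H + (C + b) ^ 2 / K) + ramp K a * s +
      (1 + b) * {s : ℝ | C ≤ |s|}.indicator (fun s => |s|) s) ∂ξ =
      (huber K a + ramp K a * H + (C + b) ^ 2 / K) + ramp K a * (∫ s, s ∂ξ) +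
        (1 + b) * ∫ s, {s : ℝ | C ≤ |s|}.indicator (fun s => |s|) s ∂ξ := by
    rw [integral_add hi1 hi2, integral_add (integrable_const _) (hint'.const_mul _),
      integral_const_mul, integral_const_mul]
    simp
  have h3 : (1 + b) * ∫ s, {s : ℝ | C ≤ |s|}.indicator (fun s => |s|) s ∂ξ ≤ (1 + b) * ε := by
    gcongr
  simp only [Pi.add_apply] at h1
  linarith

/-- Used directly, `l` would accumulate `h (l)` at low levels, where `h` is not small. The slope of
`huber K` is at most `a / K` up to level `a`, and above it `h ≤ η`, so slope times `h` is small
everywhere. The increments are dominated from above only, which is why `hdom` is restricted to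
monotone test functions. -/
theorem integral_sub_le_of_dominated {κ : Kernel (X × Y) (X × Y)} [IsMarkovKernel κ]
    {κX : Kernel X X} [IsMarkovKernel κX] {V : Set X} (hV : MeasurableSet V)
    (hA : Autonomous κ κX) (hrec : PositiveRecurrent κX V) {π : Measure X} [IsProbabilityMeasure π]
    (hpi : ∀ f : X → ℝ, Measurable f → (∃ K, ∀ x, |f x| ≤ K) → ∫ x, f x ∂π < 0 →
        ∃ δ C : ℝ, 0 < δ ∧ ∀ T : ℕ, ∀ x ∈ V,
          ∑ t ∈ Finset.range T, ∫ y, f y ∂((κX ^ t) x) ≤ C - δ * T)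
    {l : X × Y → ℝ} (hl : Measurable l) (hl0 : ∀ z, 0 ≤ l z) {U : ℝ≥0}
    (hU : ∀ z, ∫⁻ z', ENNReal.ofReal |l z' - l z| ∂(κ z) ≤ U) {h : ℝ → ℝ}
    (hh : DecreasesToZero h) {ξ : X → Measure ℝ} [∀ x, IsProbabilityMeasure (ξ x)]
    (hξ : ∀ x, Integrable id (ξ x))
    (hui : ∀ ε : ℝ, 0 < ε → ∃ C : ℝ, ∀ x,
      ∫ s, {s : ℝ | C ≤ |s|}.indicator (fun s => |s|) s ∂(ξ x) ≤ ε)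
    (hdom : ∀ z, ∀ G : ℝ → ℝ, Monotone G → LipschitzWith 1 G →
      ∫ z', G (l z') ∂(κ z) ≤ ∫ s, G (l z + h (l z) + s) ∂(ξ z.1))
    {f : X → ℝ} (hf : Measurable f) {K₀ : ℝ} (hK₀ : ∀ x, |f x| ≤ K₀)
    (hfξ : ∀ x, f x = ∫ s, s ∂(ξ x)) (hneg : ∫ x, f x ∂π < 0) {ε : ℝ} (hε : 0 < ε) :
    ∃ N : ℕ, ∀ T : ℕ, N ≤ T → ∀ z : X × Y, z.1 ∈ V →
      ∫ z', l z' ∂((κ ^ T) z) - l z ≤ ε * T := by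
  set η := ε / 8 with hη
  have hη0 : 0 < η := by positivity
  obtain ⟨u, e, B, C₁, hum, hem, huB, heB, he0, hue, hsum⟩ :=
    exists_corrector hV hrec hpi hf hK₀ hneg hη0
  have hX : Nonempty X := nonempty_of_isProbabilityMeasure π
  have hB0 : 0 ≤ B := (abs_nonneg _).trans (huB hX.some)
  set b := h 0 with hb
  have hb0 : 0 ≤ b := hh.1 0 le_rfl
  have hhb : ∀ s, 0 ≤ s → h s ≤ b := fun s hs =>
    hh.2.1 (Set.mem_Ici.2 le_rfl) (Set.mem_Ici.2 hs) hs
  obtain ⟨C, hC1, hC⟩ : ∃ C : ℝ, 1 ≤ C ∧ ∀ x,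
      ∫ s, {s : ℝ | C ≤ |s|}.indicator (fun s => |s|) s ∂(ξ x) ≤ η / (1 + b) := by
    obtain ⟨C, hC⟩ := hui (η / (1 + b)) (by positivity)
    refine ⟨max 1 C, le_max_left _ _, fun x => le_trans ?_ (hC x)⟩
    have hm : ∀ C : ℝ, MeasurableSet {s : ℝ | C ≤ |s|} := fun C =>
      measurableSet_le measurable_const (by fun_prop)
    have hi : ∀ C : ℝ, Integrable ({s : ℝ | C ≤ |s|}.indicator fun s => |s|) (ξ x) := fun C =>
      ((hξ x).abs : Integrable (fun s : ℝ => |s|) (ξ x)).indicator (hm C)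
    refine integral_mono (hi _) (hi _) fun s => ?_
    exact Set.indicator_le_indicator_of_subset
      (fun s (hs : max 1 C ≤ |s|) => (le_max_right 1 C).trans hs) (fun s => abs_nonneg s) s
  obtain ⟨a, ha0, ha⟩ : ∃ a : ℝ, 0 ≤ a ∧ h a ≤ η :=
    ((eventually_ge_atTop 0).and (hh.2.2.eventually (ge_mem_nhds hη0))).exists
  -- Makes three costs at most `η` together: the curvature on small jumps, `h` at low levels, and
  -- the change of the slope multiplying the corrector.
  set K := max 1 (((C + b) ^ 2 + b * a + B * U) / η) with hKdef
  have hK : 0 < K := one_pos.trans_le (le_max_left _ _)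
  have hKη : (C + b) ^ 2 / K + b * a / K + B * U / K ≤ η := by
    rw [← add_div, ← add_div, div_le_iff₀ hK, mul_comm η, ← div_le_iff₀ hη0]
    exact le_max_right _ _
  have hint := integrable_pow κ hl hU
  have hint1 : ∀ z, Integrable l (κ z) := fun z => by simpa using hint 1 z
  have hstep : ∀ z, ∫ z', huber K (l z') ∂(κ z) ≤ huber K (l z) + ramp K (l z) * f z.1 +
      (C + b) ^ 2 / K + b * a / K + 2 * η := by
    intro z
    have h1 := (hdom z (huber K) (huber_monotone hK) (huber_lipschitz hK)).trans
      (integral_huber_le (hξ z.1) hK hC1 (hh.1 _ (hl0 z)) (hhb _ (hl0 z)) (hC z.1) (l z))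
    rw [← hfξ, mul_div_cancel₀ _ (by positivity : (1 + b) ≠ 0)] at h1
    have h2 : ramp K (l z) * h (l z) ≤ b * a / K + η := by
      rcases le_total a (l z) with h3 | h3
      · have h4 := hh.2.1 (Set.mem_Ici.2 ha0) (Set.mem_Ici.2 (hl0 z)) h3
        have h5 := mul_le_of_le_one_left (hh.1 _ (hl0 z)) (ramp_le_one K (l z))
        have h6 : 0 ≤ b * a / K := by positivity
        linarith
      · have h4 : ramp K (l z) * h (l z) ≤ a / K * b := by
          have h5 : ramp K (l z) ≤ a / K := (ramp_le_div hK (hl0 z)).trans (by gcongr)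
          exact mul_le_mul h5 (hhb _ (hl0 z)) (hh.1 _ (hl0 z)) (by positivity)
        have h6 : a / K * b = b * a / K := by ring
        linarith
    linarith
  -- The corrector carries the weight `ramp K (l z)` because `f` enters the drift of `huber K` with
  -- this factor. As the weight is in `[0, 1]` and `e ≥ 0`, it may be dropped in front of `e`.
  set Ψ : X × Y → ℝ := fun z => huber K (l z) + ramp K (l z) * u z.1 with hΨ
  have hGm : Measurable fun z => huber K (l z) := (measurable_huber K).comp hl
  have hrm : Measurable fun z => ramp K (l z) := (measurable_ramp K).comp hl
  have hum' : Measurable fun z : X × Y => u z.1 := hum.comp measurable_fst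
  have hem' : Measurable fun z : X × Y => e z.1 := hem.comp measurable_fst
  have hΨm : Measurable Ψ := hGm.add (hrm.mul hum')
  have hru : ∀ z z' : X × Y, |ramp K (l z) * u z'.1| ≤ B := fun z z' => by
    rw [abs_mul]
    exact (mul_le_of_le_one_left (abs_nonneg _) (abs_ramp_le_one K _)).trans (huB _)
  have hrui : ∀ (ν : Measure (X × Y)) [IsFiniteMeasure ν],
      Integrable (fun z => ramp K (l z) * u z.1) ν := fun ν _ =>
    integrable_of_abs_le (hrm.mul hum') fun z => hru z z
  have hui' : ∀ (ν : Measure (X × Y)) [IsFiniteMeasure ν], Integrable (fun z => u z.1) ν :=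
    fun ν _ => integrable_of_abs_le hum' fun z => huB _
  have hei : ∀ (ν : Measure (X × Y)) [IsFiniteMeasure ν], Integrable (fun z => e z.1) ν :=
    fun ν _ => integrable_of_abs_le hem' fun z => heB _
  have hGi : ∀ (t : ℕ) z, Integrable (fun z => huber K (l z)) ((κ ^ t) z) := fun t z =>
    (huber_lipschitz hK).integrable_comp_real (hint t z)
  have hGi1 : ∀ z, Integrable (fun z => huber K (l z)) (κ z) := fun z => by simpa using hGi 1 z
  have hΨi : ∀ (t : ℕ) z, Integrable Ψ ((κ ^ t) z) := fun t z => (hGi t z).add (hrui _)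
  have hdrift : ∀ z, ∫ z', Ψ z' ∂(κ z) ≤ Ψ z + (e z.1 + 3 * η) := by
    intro z
    have h1 : ∫ z', ramp K (l z') * u z'.1 ∂(κ z) ≤
        ∫ z', (ramp K (l z) * u z'.1 + B / K * |l z' - l z|) ∂(κ z) := by
      have hai : Integrable (fun z' => |l z' - l z|) (κ z) :=
        ((hint1 z).sub (integrable_const _)).abs
      refine integral_mono (hrui _) (((hui' _).const_mul _).add (hai.const_mul _)) fun z' => ?_
      have h2 : (ramp K (l z') - ramp K (l z)) * u z'.1 ≤ |l z' - l z| / K * B := by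
        refine (le_abs_self _).trans ?_
        rw [abs_mul]
        exact mul_le_mul (abs_ramp_sub_le hK _ _) (huB _) (abs_nonneg _) (by positivity)
      have h3 : |l z' - l z| / K * B = B / K * |l z' - l z| := by ring
      simp only
      linarith
    have hai : Integrable (fun z' => |l z' - l z|) (κ z) :=
      ((hint1 z).sub (integrable_const _)).abs
    rw [integral_add ((hui' _).const_mul _) (hai.const_mul _), integral_const_mul,
      integral_const_mul] at h1
    have h2 : ∫ z', |l z' - l z| ∂(κ z) ≤ U := by
      simpa using integral_abs_sub_pow_le κ hl hU 1 z
    have h3 : B / K * ∫ z', |l z' - l z| ∂(κ z) ≤ B * U / K := by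
      calc B / K * ∫ z', |l z' - l z| ∂(κ z) ≤ B / K * U := by gcongr
        _ = _ := by ring
    have h4 : ∫ z', u z'.1 ∂(κ z) = ∫ x, u x ∂(κX z.1) := by
      simpa using integral_fst_pow hA 1 z hum
    have h5 : ramp K (l z) * (f z.1 + ∫ x, u x ∂(κX z.1)) ≤ ramp K (l z) * u z.1 + e z.1 := by
      have h6 := mul_le_mul_of_nonneg_left
        (by linarith [hue z.1] : f z.1 + ∫ x, u x ∂(κX z.1) ≤ u z.1 + e z.1)
        (ramp_nonneg K (l z))
      have h7 := mul_le_of_le_one_left (he0 z.1) (ramp_le_one K (l z))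
      linarith
    have h8 : ∫ z', Ψ z' ∂(κ z) =
        ∫ z', huber K (l z') ∂(κ z) + ∫ z', ramp K (l z') * u z'.1 ∂(κ z) :=
      integral_add (hGi1 z) (hrui _)
    have h9 := hstep z
    rw [h8]
    simp only [hΨ]
    rw [h4] at h1
    linarith
  -- Of `ε = 8 η` per step, `3 η` is spent by the drift and `η` by the average of `e`; the remaining
  -- `4 η` absorb the constants.
  obtain ⟨N, hN⟩ : ∃ N : ℕ, ∀ T : ℕ, N ≤ T → K / 2 + 2 * B + C₁ ≤ 4 * η * T := by
    obtain ⟨N, hN⟩ := exists_nat_ge ((K / 2 + 2 * B + C₁) / (4 * η))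
    refine ⟨N, fun T hT => ?_⟩
    rw [← div_le_iff₀' (by positivity : 0 < 4 * η)]
    exact hN.trans (Nat.cast_le.2 hT)
  refine ⟨N, fun T hT z hz => ?_⟩
  have h1 := integral_pow_le_of_drift κ (a := fun z' => e z'.1 + 3 * η) z (fun t => hΨi t z) hΨm
    (fun t => (hei _).add (integrable_const (3 * η))) hdrift T
  have h2 : ∀ t : ℕ, ∫ z', (e z'.1 + 3 * η) ∂((κ ^ t) z) =
      ∫ x, e x ∂((κX ^ t) z.1) + 3 * η := fun t => by
    rw [integral_add (hei _) (integrable_const _), integral_fst_pow hA t z hem]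
    simp
  simp_rw [h2] at h1
  rw [Finset.sum_add_distrib] at h1
  simp only [Finset.sum_const, Finset.card_range, nsmul_eq_mul] at h1
  have h3 := hsum T z.1 hz
  have h4 : ∫ z', l z' ∂((κ ^ T) z) - (K / 2 + B) ≤ ∫ z', Ψ z' ∂((κ ^ T) z) := by
    have h5 : ∫ z', (l z' - (K / 2 + B)) ∂((κ ^ T) z) ≤ ∫ z', Ψ z' ∂((κ ^ T) z) := by
      refine integral_mono ((hint T z).sub (integrable_const _)) (hΨi T z) fun z' => ?_
      have h6 := sub_le_huber hK (l z')
      have h7 := (abs_le.1 (hru z' z')).1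
      simp only [hΨ]
      linarith
    rw [integral_sub (hint T z) (integrable_const _)] at h5
    simpa using h5
  have h5 : Ψ z ≤ l z + B := by
    have h6 := huber_le hK (hl0 z)
    have h7 := (abs_le.1 (hru z z)).2
    simp only [hΨ]
    linarith
  have h6 := hN T hT
  have h7 : ε * T = 8 * (η * T) := by rw [hη]; ring
  rw [h7]
  linarith

end Growth

end MarkovStability

namespace MarkovStability

/-! ### The conditions of the stability theorem -/

section Conditions

variable {M : ℕ} {X : Type u} {Y : Fin M → Type v} [MeasurableSpace X]
  [∀ i, MeasurableSpace (Y i)]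

/-- The dominating increments in condition `B̂`, described by their laws `ξ x`. -/
theorem ConditionBHat.exists_law [Nonempty (X × (Π i, Y i))]
    {κ : Kernel (X × (Π i, Y i)) (X × (Π i, Y i))}
    [IsMarkovKernel κ] {κX : Kernel X X} {L : Π i, Y i → ℝ} (hB : ConditionBHat.{u, v, w} κ κX L)
    (hL : ∀ i, Measurable (L i)) (hB1 : ConditionB1 κ L) (i : Fin M) :
    ∃ (h : ℝ → ℝ) (f : X → ℝ) (ξ : X → Measure ℝ), DecreasesToZero h ∧
      NegativeStationaryMean κX f ∧ Measurable f ∧ (∃ K, ∀ x, |f x| ≤ K) ∧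
      (∀ x, IsProbabilityMeasure (ξ x)) ∧ (∀ x, Integrable id (ξ x)) ∧
      (∀ ε : ℝ, 0 < ε → ∃ C : ℝ, ∀ x,
        ∫ s, {s : ℝ | C ≤ |s|}.indicator (fun s => |s|) s ∂(ξ x) ≤ ε) ∧
      (∀ x, f x = ∫ s, s ∂(ξ x)) ∧
      ∀ z, ∀ G : ℝ → ℝ, Monotone G → LipschitzWith 1 G →
        ∫ z', G (L i (z'.2 i)) ∂(κ z) ≤
          ∫ s, G (L i (z.2 i) + h (L i (z.2 i)) + s) ∂(ξ z.1) := by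
  obtain ⟨U, hU⟩ := hB1.exists_bound
  have hlm : Measurable fun z : X × (Π i, Y i) => L i (z.2 i) :=
    (hL i).comp ((measurable_pi_apply i).comp measurable_snd)
  obtain ⟨h, F, f, hh, hF, hneg, hreal⟩ := hB i
  choose Ω mΩ P Z φ hP hZ0 hlaw hφm _ hφui hφF hle hf using hreal
  obtain ⟨z₀⟩ := ‹Nonempty (X × (Π i, Y i))›
  -- Any realization and any time would do: the law of `φ x t` is determined by `F x`.
  set ξ : X → Measure ℝ := fun x => (P z₀).map (φ z₀ x 0) with hξ
  have hξp : ∀ x, IsProbabilityMeasure (ξ x) := fun x =>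
    Measure.isProbabilityMeasure_map (hφm z₀ x 0).aemeasurable
  have hcdf : ∀ z x t s, ((P z).map (φ z x t)) (Set.Iic s) = ENNReal.ofReal (F x s) := by
    intro z x t s
    rw [Measure.map_apply (hφm z x t) measurableSet_Iic, ← hφF z x t s, ofReal_measureReal]
    rfl
  have hlawξ : ∀ z x t, (P z).map (φ z x t) = ξ x := by
    intro z x t
    have := Measure.isProbabilityMeasure_map (μ := P z) (hφm z x t).aemeasurable
    exact Measure.ext_of_Iic _ _ fun s => by rw [hcdf, hcdf]
  have hφi : ∀ z x t, Integrable (φ z x t) (P z) := fun z x t =>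
    memLp_one_iff_integrable.1 ((hφui z t).memLp x)
  have hξi : ∀ x, Integrable id (ξ x) := fun x =>
    (integrable_map_measure aestronglyMeasurable_id (hφm z₀ x 0).aemeasurable).2 (hφi z₀ x 0)
  have hint : ∀ z x t (g : ℝ → ℝ), Measurable g → ∫ s, g s ∂(ξ x) = ∫ ω, g (φ z x t ω) ∂(P z) :=
    fun z x t g hg => by
      rw [← hlawξ z x t, integral_map (hφm z x t).aemeasurable hg.aestronglyMeasurable]
  have hm : ∀ C : ℝ, MeasurableSet {s : ℝ | C ≤ |s|} := fun C =>
    measurableSet_le measurable_const (by fun_prop)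
  have hξui : ∀ ε : ℝ, 0 < ε → ∃ C : ℝ, ∀ x,
      ∫ s, {s : ℝ | C ≤ |s|}.indicator (fun s => |s|) s ∂(ξ x) ≤ ε := by
    intro ε hε
    obtain ⟨C, hC⟩ := (hφui z₀ 0).spec one_ne_zero ENNReal.one_ne_top hε
    refine ⟨C, fun x => ?_⟩
    have hset : {ω | C ≤ ‖φ z₀ x 0 ω‖₊} = φ z₀ x 0 ⁻¹' {s : ℝ | (C : ℝ) ≤ |s|} := by
      ext ω
      simp [← NNReal.coe_le_coe]
    have h1 := hC x
    rw [eLpNorm_one_eq_lintegral_enorm, hset] at h1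
    have habs : Measurable fun s : ℝ => |s| := by fun_prop
    rw [hint z₀ x 0 _ (habs.indicator (hm C))]
    have h2 : ∀ ω, {s : ℝ | (C : ℝ) ≤ |s|}.indicator (fun s => |s|) (φ z₀ x 0 ω) =
        ‖(φ z₀ x 0 ⁻¹' {s : ℝ | (C : ℝ) ≤ |s|}).indicator (φ z₀ x 0) ω‖ := by
      intro ω
      by_cases hω : (C : ℝ) ≤ |φ z₀ x 0 ω| <;> simp [Set.indicator, hω]
    simp_rw [h2]
    rw [integral_norm_eq_lintegral_enorm
      ((hφm z₀ x 0).indicator (hφm z₀ x 0 (hm C))).aestronglyMeasurable]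
    exact ENNReal.toReal_le_of_le_ofReal hε.le h1
  have hfξ : ∀ x, f x = ∫ s, s ∂(ξ x) := fun x => by
    rw [hf z₀ x]; exact (hint z₀ x 1 id measurable_id).symm
  have hξm : Measurable ξ :=
    Measurable.measure_of_isPiSystem_of_isProbabilityMeasure
      ((BorelSpace.measurable_eq (α := ℝ)).trans (borel_eq_generateFrom_Iic ℝ)) isPiSystem_Iic <| by
      rintro _ ⟨s, rfl⟩
      simp only [hξ, hcdf]
      exact (hF s).ennreal_ofReal
  have hfm : Measurable f := by
    have := (stronglyMeasurable_id (α := ℝ)).integral_kernel (κ := ⟨ξ, hξm⟩)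
    rw [funext hfξ]
    exact this.measurable
  refine ⟨h, f, ξ, hh, hneg, hfm, ?_, hξp, hξi, hξui, hfξ, fun z G hG hG1 => ?_⟩
  · obtain ⟨C, hC⟩ := hξui 1 one_pos
    refine ⟨|C| + 1, fun x => ?_⟩
    have hi : Integrable (fun s : ℝ => |s|) (ξ x) := (hξi x).abs
    rw [hfξ]
    calc |∫ s, s ∂(ξ x)| ≤ ∫ s, |s| ∂(ξ x) := abs_integral_le_integral_abs
      _ ≤ ∫ s, (|C| + {s : ℝ | C ≤ |s|}.indicator (fun s => |s|) s) ∂(ξ x) := by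
          refine integral_mono hi ((integrable_const _).add (hi.indicator (hm C))) fun s => ?_
          by_cases hs : C ≤ |s|
          · simp [Set.indicator, hs]
          · simp only [Set.indicator, Set.mem_ofPred_eq, hs, if_false]
            linarith [le_abs_self C, not_le.1 hs]
      _ ≤ |C| + 1 := by
          rw [integral_add (integrable_const _) (hi.indicator (hm C))]
          simpa using hC x
  · have hZm : AEMeasurable (Z z 1) (P z) :=
      (measurable_pi_apply 1).comp_aemeasurable (hlaw z).aemeasurable
    have hκ : (P z).map (Z z 1) = κ z := by
      rw [← pow_one κ, ← map_pathLaw, ← (hlaw z).map_eq,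
        AEMeasurable.map_map_of_aemeasurable (measurable_pi_apply 1).aemeasurable
          (hlaw z).aemeasurable]
      rfl
    have hGm : Measurable G := hG.measurable
    have hli : Integrable (fun z' : X × (Π i, Y i) => L i (z'.2 i)) (κ z) := by
      simpa using integrable_pow κ hlm (hU i) 1 z
    have hGl : Measurable fun z' : X × (Π i, Y i) => G (L i (z'.2 i)) := hGm.comp hlm
    have hGi := hG1.integrable_comp_real hli
    rw [← hκ] at hGi
    rw [hint z z.1 0 _ (by fun_prop), ← hκ, integral_map hZm hGl.aestronglyMeasurable]
    refine integral_mono_ae (hGi.comp_aemeasurable hZm)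
      (hG1.integrable_comp_real ((integrable_const _).add (hφi z z.1 0))) ?_
    -- Only time `0` is used. There `Z 0 = z` almost surely, so the random index of `φ` becomes the
    -- fixed state `z.1`.
    filter_upwards [hle z 0, hZ0 z] with ω h1 h2
    rw [h2] at h1
    refine hG ?_
    simp only [zero_add] at h1
    linarith

/-- The domination of laws, tested with the identity. -/
theorem ConditionBHat.conditionB2 {κ : Kernel (X × (Π i, Y i)) (X × (Π i, Y i))}
    [IsMarkovKernel κ] {κX : Kernel X X} {L : Π i, Y i → ℝ} [Nonempty (X × (Π i, Y i))]
    (hB : ConditionBHat.{u, v, w} κ κX L) (hL : ∀ i, Measurable (L i)) (hB1 : ConditionB1 κ L) :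
    ConditionB2 κ κX L := by
  intro i
  obtain ⟨U, hU⟩ := hB1.exists_bound
  obtain ⟨h, f, ξ, hh, hneg, hf, hK, hξ, hξi, -, hfξ, hdom⟩ := hB.exists_law hL hB1 i
  refine ⟨h, f, hh, hf, hK, hneg, fun x y => ?_⟩
  have hlm : Measurable fun z : X × (Π i, Y i) => L i (z.2 i) :=
    (hL i).comp ((measurable_pi_apply i).comp measurable_snd)
  have hli : Integrable (fun z' : X × (Π i, Y i) => L i (z'.2 i)) (κ (x, y)) := by
    simpa using integrable_pow κ hlm (hU i) 1 (x, y)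
  have h1 := hdom (x, y) id monotone_id LipschitzWith.id
  have hi : Integrable (fun s : ℝ => s) (ξ x) := hξi x
  simp only [id] at h1
  rw [integral_add (integrable_const _) hi, ← hfξ] at h1
  rw [integral_sub hli (integrable_const _)]
  simp only [integral_const, probReal_univ, smul_eq_mul, one_mul] at h1 ⊢
  linarith

theorem ConditionBHat.sublinearGrowth {κ : Kernel (X × (Π i, Y i)) (X × (Π i, Y i))}
    [IsMarkovKernel κ] {κX : Kernel X X} [IsMarkovKernel κX] {V : Set X} {L : Π i, Y i → ℝ}
    [Nonempty (X × (Π i, Y i))] (hB : ConditionBHat.{u, v, w} κ κX L) (hV : MeasurableSet V)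
    (hA0 : Autonomous κ κX) (hA2 : PositiveRecurrent κX V) (hA3 : AdmitsMinorant κX V)
    (hL : ∀ i, Measurable (L i)) (hL0 : ∀ i y, 0 ≤ L i y) (hB1 : ConditionB1 κ L) :
    SublinearGrowth κ V L := by
  intro i ε hε
  obtain ⟨U, hU⟩ := hB1.exists_bound
  have hX : Nonempty X := ‹Nonempty (X × (Π i, Y i))›.map Prod.fst
  obtain ⟨π, hπ, hπinv, hpi⟩ := exists_invariant_sum_le κX hV hA2 hA3
  obtain ⟨h, f, ξ, hh, hneg, hf, ⟨K, hK⟩, hξ, hξi, hui, hfξ, hdom⟩ := hB.exists_law hL hB1 i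
  exact integral_sub_le_of_dominated hV hA0 hA2 hpi
    ((hL i).comp ((measurable_pi_apply i).comp measurable_snd)) (fun z => hL0 i _) (hU i) hh hξi
    hui hdom hf hK hfξ (hneg π hπ hπinv) hε

theorem ConditionB3.sublinearGrowth {κ : Kernel (X × (Π i, Y i)) (X × (Π i, Y i))}
    [IsMarkovKernel κ] {V : Set X} {L : Π i, Y i → ℝ} (hB : ConditionB3 κ V L)
    (hL : ∀ i, Measurable (L i)) (hB1 : ConditionB1 κ L) : SublinearGrowth κ V L := by
  intro i ε hε
  obtain ⟨U, hU⟩ := hB1.exists_bound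
  have hlm : Measurable fun z : X × (Π i, Y i) => L i (z.2 i) :=
    (hL i).comp ((measurable_pi_apply i).comp measurable_snd)
  have hε' : (0 : EReal) < (ε : EReal) := by exact_mod_cast hε
  obtain ⟨N, hN, hN1⟩ := (((hB i).eventually (gt_mem_nhds hε')).and (eventually_ge_atTop 1)).exists
  refine ⟨N, fun T hT z hz => ?_⟩
  have hT0 : (0 : ℝ) < T := by exact_mod_cast hN1.trans hT
  have h1 : (((∫ w, (L i ((w T).2 i) - L i (z.2 i)) ∂(pathLaw κ z)) / (T : ℝ) : ℝ) : EReal) ≤ ε :=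
    le_trans (le_iSup_of_le T <| le_iSup_of_le hT <| le_iSup_of_le z.2 <| le_iSup_of_le z.1 <|
      le_iSup (fun _ : z.1 ∈ V => (((∫ w, (L i ((w T).2 i) - L i (z.2 i)) ∂(pathLaw κ z)) /
        (T : ℝ) : ℝ) : EReal)) hz) hN.le
  rw [EReal.coe_le_coe_iff, div_le_iff₀ hT0] at h1
  have h2 : ∫ w, (L i ((w T).2 i) - L i (z.2 i)) ∂(pathLaw κ z) =
      ∫ z', (L i (z'.2 i) - L i (z.2 i)) ∂((κ ^ T) z) := by
    rw [← map_pathLaw, integral_map (measurable_pi_apply T).aemeasurable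
      (hlm.sub_const _).aestronglyMeasurable]
  rw [h2, integral_sub (integrable_pow κ hlm (hU i) T z) (integrable_const _)] at h1
  simpa using h1

end Conditions

end MarkovStability

theorem theorem2 {M : ℕ} {X : Type u} {Y : Fin M → Type v}
    [MeasurableSpace X] [MeasurableSpace.CountablyGenerated X]
    [∀ i, MeasurableSpace (Y i)] [∀ i, MeasurableSpace.CountablyGenerated (Y i)]
    (κ : Kernel (X × (Π i, Y i)) (X × (Π i, Y i))) [IsMarkovKernel κ]
    (κX : Kernel X X) [IsMarkovKernel κX] (V : Set X) (hV : MeasurableSet V)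
    (hA0 : Autonomous κ κX) (hA1 : Aperiodic κX) (hA2 : PositiveRecurrent κX V)
    (hA3 : AdmitsMinorant κX V)
    (L : Π i, Y i → ℝ) (hL : ∀ i, Measurable (L i)) (hL0 : ∀ i y, 0 ≤ L i y)
    (hB1 : ConditionB1 κ L)
    (hB : (ConditionB2 κ κX L ∧ ConditionB3 κ V L) ∨ ConditionBHat.{u, v, w} κ κX L)
    (N₀ : ℝ) :
    ∃ N₁ : ℝ, N₀ ≤ N₁ ∧
      PositiveRecurrent κ {z | z.1 ∈ V ∧ ∑ i, L i (z.2 i) ≤ N₁} := by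
  rcases hB with ⟨hB2, hB3⟩ | hB
  · exact exists_positiveRecurrent κ κX hV hA0 hA2 hA3 hL hL0 hB1 hB2
      (hB3.sublinearGrowth hL hB1) N₀
  · rcases isEmpty_or_nonempty (X × (Π i, Y i)) with hZ | hZ
    -- On an empty state space no realization exists to read the laws from, and the claim is
    -- vacuous.
    · exact ⟨N₀, le_rfl, fun z => hZ.elim z, by simp⟩
    · exact exists_positiveRecurrent κ κX hV hA0 hA2 hA3 hL hL0 hB1 (hB.conditionB2 hL hB1)
        (hB.sublinearGrowth hV hA0 hA2 hA3 hL hL0 hB1) N₀
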